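/- **Theorem (Complexity of rational half-plane sampling).** Let $A$ be a finite multiset of integers (repeated elements count as distinct steps), and write $w(s)\in\mathbb Z$ for the value of a step $s\in A$. Assume that $A$ is non-trivial, i.e. it contains both a positive and a negative element. A *nonnegative walk* of length $n$ is a sequence of $n$ steps of $A$ all of whose prefixes have nonnegative sum. (1) Let $\bar a=\max A$, $\bar b=-\min A$, and let $\mathsf{grammar}(A)$ be the context-free grammar with terminals the steps of $A$, initial nonterminal $P$, nonterminals $P_{\mathrm{aux}}, D, L_k, R_k$, and rules $$P\to D\,P_{\mathrm{aux}},\qquad P_{\mathrm{aux}}\to \varepsilon,\qquad P_{\mathrm{aux}}\to L_k\,D\,P_{\mathrm{aux}}\ (1\le k\le\bar a),$$ $$D\to\varepsilon,\qquad D\to c\,D\ (w(c)=0),\qquad D\to L_k\,D\,R_k\,D\ (1\le k\le\max(\bar a,\bar b)),$$ $$L_i\to s\ (w(s)=i),\qquad L_i\to L_k\,D\,R_{k-i}\ (i<k\le\min(\bar a,i+\bar b)),\qquad 1\le i\le\bar a,$$ $$R_j\to s\ (w(s)=-j),\qquad R_j\to L_{k-j}\,D\,R_k\ (j<k\le\min(j+\bar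 a,\bar b)),\qquad 1\le j\le\bar b.$$ The language of $\mathsf{grammar}(A)$ is exactly the set of nonnegative walks, and the grammar is unambiguous: each word of the language has exactly one leftmost derivation. (2) There is a randomized program, depending only on $A$, with a fixed finite number of integer registers (storage for $O(1)$ numbers) and a write-only output tape. Its unit-cost instructions are: assignment of a constant, $+$, $-$, $\times$, integer quotient, drawing a uniform random integer in $\{0,\dots,m-1\}$ for a register value $m$, writing a step of $A$, doing nothing, and the control steps (composition, and conditionals and while loops with positivity tests). For all $n,k\ge 0$, on input $(n,k)$, it halts within a bounded number of steps whatever the random draws are, and outputs, one after the other, $k$ independent uniformly distributed nonnegative walks of length $n$. Moreover there is a constant $C$ depending only on $A$ such that for all $n\ge2$ and $k\ge1$ the total number of executed instructions is always at most $C\,k\,n\log n$, and the numbers stored in the registers have at all times bit length at most $C\,(n+\log k)$. -/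

import Mathlib

/-! ### Unidimensional walk models -/

namespace HalfPlane

/-- The steps of the model given by a multiset `A` of integers: the elements of `A`, counted
with multiplicity, so that equal integers occurring several times give distinct steps. -/
abbrev Step (A : Multiset ℤ) : Type := A.ToType

/-- The (signed) height `w(a)` of a step. -/
def Step.weight {A : Multiset ℤ} (a : Step A) : ℤ := a.1

/-- The model is non-trivial: there are both a positive and a negative step. -/
def Nontriv (A : Multiset ℤ) : Prop := (∃ a ∈ A, 0 < a) ∧ (∃ b ∈ A, b < 0)

/-- A sequence of steps, started at height `0`, is a nonnegative walk if all its prefixes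
have nonnegative sum. -/
def IsNonnegWalk {A : Multiset ℤ} (w : List (Step A)) : Prop :=
  ∀ p : List (Step A), p <+: w → 0 ≤ (p.map Step.weight).sum

/-- The nonnegative walks with exactly `n` steps (a finite set). -/
def walks (A : Multiset ℤ) (n : ℕ) : Set (List (Step A)) :=
  {w | w.length = n ∧ IsNonnegWalk w}

/-! ### Unambiguous context-free grammars -/

/-- `LeftmostDerivation g s rs w`: applying the rules `rs`, in this order, each one to the
leftmost nonterminal of the current string, rewrites the string `s` into the terminal word `w`. -/
inductive LeftmostDerivation {T : Type} (g : ContextFreeGrammar T) :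
    List (Symbol T g.NT) → List (ContextFreeRule T g.NT) → List T → Prop
  | done (w : List T) : LeftmostDerivation g (w.map Symbol.terminal) [] w
  | step (u : List T) (v : List (Symbol T g.NT)) (ρ : ContextFreeRule T g.NT)
      (rs : List (ContextFreeRule T g.NT)) (w : List T) (hρ : ρ ∈ g.rules)
      (h : LeftmostDerivation g (u.map Symbol.terminal ++ ρ.output ++ v) rs w) :
      LeftmostDerivation g
        (u.map Symbol.terminal ++ [Symbol.nonterminal ρ.input] ++ v) (ρ :: rs) w

/-- A grammar is unambiguous if every word of its language has exactly one leftmost derivation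
from the initial nonterminal. -/
def Unambiguous {T : Type} (g : ContextFreeGrammar T) : Prop :=
  ∀ w ∈ g.language, ∃! rs : List (ContextFreeRule T g.NT),
    LeftmostDerivation g [Symbol.nonterminal g.initial] rs w

/-! ### The grammar of a unidimensional model -/

/-- The nonterminals `P`, `P_aux`, `D`, `L_k`, `R_k`. Only finitely many of them occur in
the rules of the grammar. -/
inductive NT : Type
  | P : NT
  | Paux : NT
  | D : NT
  | L (k : ℕ) : NT
  | R (k : ℕ) : NT

/-- The largest upward step length. -/
def maxUp (A : Multiset ℤ) : ℕ := (A.map fun a => a.toNat).sup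

/-- The largest downward step length. -/
def maxDown (A : Multiset ℤ) : ℕ := (A.map fun a => (-a).toNat).sup

section Rules

open Symbol NT

open Classical in
/-- The rules of the grammar:
* `P → D P_aux`;
* `P_aux → ε` and `P_aux → L_k D P_aux` for `1 ≤ k ≤ a`;
* `D → ε`, `D → c D` for `w(c) = 0`, and `D → L_k D R_k D` for `1 ≤ k ≤ max a b`;
* `L_i → s` for `w(s) = i`, and `L_i → L_k D R_{k-i}` for `i < k ≤ min a (i + b)`, where
  `1 ≤ i ≤ a`;
* `R_j → s` for `w(s) = -j`, and `R_j → L_{k-j} D R_k` for `j < k ≤ min (j + a) b`, where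
  `1 ≤ j ≤ b`;

here `a` and `b` are the largest upward and downward step lengths. -/
noncomputable def grammarRules (A : Multiset ℤ) : Finset (ContextFreeRule (Step A) NT) :=
  {⟨P, [nonterminal D, nonterminal Paux]⟩, ⟨Paux, []⟩, ⟨D, []⟩}
  ∪ (Finset.Icc 1 (maxUp A)).image
      (fun k => ⟨Paux, [nonterminal (L k), nonterminal D, nonterminal Paux]⟩)
  ∪ (Finset.univ.filter fun c : Step A => c.weight = 0).image
      (fun c => ⟨D, [terminal c, nonterminal D]⟩)
  ∪ (Finset.Icc 1 (max (maxUp A) (maxDown A))).image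
      (fun k => ⟨D, [nonterminal (L k), nonterminal D, nonterminal (R k), nonterminal D]⟩)
  ∪ (Finset.univ.filter fun s : Step A => 0 < s.weight).image
      (fun s => ⟨L s.weight.toNat, [terminal s]⟩)
  ∪ (Finset.Icc 1 (maxUp A)).biUnion (fun i =>
      (Finset.Icc (i + 1) (min (maxUp A) (i + maxDown A))).image
        (fun k => ⟨L i, [nonterminal (L k), nonterminal D, nonterminal (R (k - i))]⟩))
  ∪ (Finset.univ.filter fun s : Step A => s.weight < 0).image
      (fun s => ⟨R (-s.weight).toNat, [terminal s]⟩)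
  ∪ (Finset.Icc 1 (maxDown A)).biUnion (fun j =>
      (Finset.Icc (j + 1) (min (j + maxUp A) (maxDown A))).image
        (fun k => ⟨R j, [nonterminal (L (k - j)), nonterminal D, nonterminal (R k)]⟩))

end Rules

/-- The grammar of the unidimensional model given by `A`; its terminals are the steps. -/
noncomputable abbrev grammar (A : Multiset ℤ) : ContextFreeGrammar (Step A) where
  NT := NT
  initial := NT.P
  rules := grammarRules A

/-! ### Randomized arithmetic programs

A program works on a fixed finite number `r` of registers, each of which holds one integer, and
on a write-only output tape with symbols in `T`. Every elementary instruction, test, and control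
step has unit cost. -/

/-- Programs over `r` integer registers, with output alphabet `T`. -/
inductive Prog (T : Type) (r : ℕ) : Type
  /-- do nothing -/
  | skip : Prog T r
  /-- `x := z` for a constant `z` -/
  | const (x : Fin r) (z : ℤ) : Prog T r
  /-- `x := y + z` -/
  | add (x y z : Fin r) : Prog T r
  /-- `x := y - z` -/
  | sub (x y z : Fin r) : Prog T r
  /-- `x := y * z` -/
  | mul (x y z : Fin r) : Prog T r
  /-- `x := y / z`, the integer quotient -/
  | div (x y z : Fin r) : Prog T r
  /-- `x :=` a fresh uniform random element of `{0, …, y - 1}` (and `0` if `y ≤ 0`) -/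
  | rand (x y : Fin r) : Prog T r
  /-- append the symbol `t` to the output -/
  | emit (t : T) : Prog T r
  /-- sequential composition -/
  | seq (c d : Prog T r) : Prog T r
  /-- if `0 < x` then `c` else `d` -/
  | ifPos (x : Fin r) (c d : Prog T r) : Prog T r
  /-- while `0 < x` do `c` -/
  | whilePos (x : Fin r) (c : Prog T r) : Prog T r

/-- A configuration: the programs still to be executed (there are boundedly many of them
at any time, as programs have no recursion), the contents of the registers, and the output
written so far. -/
structure Config (T : Type) (r : ℕ) : Type where
  todo : List (Prog T r)
  regs : Fin r → ℤ
  out : List T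

/-- The uniform distribution on `{0, …, m - 1}`, and the point mass at `0` if `m ≤ 0`. -/
noncomputable def uniformBelow (m : ℤ) : PMF ℤ :=
  PMF.map (fun i : Fin (m.toNat - 1 + 1) => (i.val : ℤ)) (PMF.uniformOfFintype _)

/-- One unit-cost step of the execution; a configuration with nothing left to do is halted. -/
noncomputable def step {T : Type} {r : ℕ} : Config T r → PMF (Config T r)
  | ⟨[], ρ, o⟩ => PMF.pure ⟨[], ρ, o⟩
  | ⟨.skip :: K, ρ, o⟩ => PMF.pure ⟨K, ρ, o⟩
  | ⟨.const x z :: K, ρ, o⟩ => PMF.pure ⟨K, Function.update ρ x z, o⟩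
  | ⟨.add x y z :: K, ρ, o⟩ => PMF.pure ⟨K, Function.update ρ x (ρ y + ρ z), o⟩
  | ⟨.sub x y z :: K, ρ, o⟩ => PMF.pure ⟨K, Function.update ρ x (ρ y - ρ z), o⟩
  | ⟨.mul x y z :: K, ρ, o⟩ => PMF.pure ⟨K, Function.update ρ x (ρ y * ρ z), o⟩
  | ⟨.div x y z :: K, ρ, o⟩ => PMF.pure ⟨K, Function.update ρ x (ρ y / ρ z), o⟩
  | ⟨.rand x y :: K, ρ, o⟩ =>
      (uniformBelow (ρ y)).map fun v => ⟨K, Function.update ρ x v, o⟩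
  | ⟨.emit t :: K, ρ, o⟩ => PMF.pure ⟨K, ρ, o ++ [t]⟩
  | ⟨.seq c d :: K, ρ, o⟩ => PMF.pure ⟨c :: d :: K, ρ, o⟩
  | ⟨.ifPos x c d :: K, ρ, o⟩ => PMF.pure ⟨(if 0 < ρ x then c else d) :: K, ρ, o⟩
  | ⟨.whilePos x c :: K, ρ, o⟩ =>
      PMF.pure ⟨if 0 < ρ x then c :: .whilePos x c :: K else K, ρ, o⟩

/-- The distribution of the configuration after `t` steps, started from `c₀`. -/
noncomputable def run {T : Type} {r : ℕ} (c₀ : Config T r) : ℕ → PMF (Config T r)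
  | 0 => PMF.pure c₀
  | t + 1 => (run c₀ t).bind step

/-- The initial configuration on input `(n, k)`: the first two registers hold `n` and `k`,
all other registers hold `0`, and the output is empty. -/
def init {T : Type} {r : ℕ} (p : Prog T (r + 2)) (n k : ℕ) : Config T (r + 2) where
  todo := [p]
  regs := fun i => if i = 0 then (n : ℤ) else if i = 1 then (k : ℤ) else 0
  out := []

/-- On input `(n, k)`, whatever the random draws are, the program halts after at most
`t` steps. -/
def HaltsWithin {T : Type} {r : ℕ} (p : Prog T (r + 2)) (n k t : ℕ) : Prop :=
  ∀ c ∈ (run (init p n k) t).support, c.todo = []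

/-- On input `(n, k)`, whatever the random draws are, at any time every register holds an
integer of bit length at most `s`. -/
def StoresBits {T : Type} {r : ℕ} (p : Prog T (r + 2)) (n k s : ℕ) : Prop :=
  ∀ t : ℕ, ∀ c ∈ (run (init p n k) t).support, ∀ x, (c.regs x).natAbs.size ≤ s

/-- The distribution of the output after `t` steps on input `(n, k)`. -/
noncomputable def outputDist {T : Type} {r : ℕ} (p : Prog T (r + 2)) (n k t : ℕ) :
    PMF (List T) :=
  (run (init p n k) t).map Config.out

open Classical in
/-- `μ` is the law of `k` independent uniform random nonnegative walks of length `n`, written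
one after the other: each of the `|walks A n| ^ k` sequences of `k` walks of length `n` has
the same probability, and nothing else is ever written. -/
def IsUniformWalks (A : Multiset ℤ) (n k : ℕ) (μ : PMF (List (Step A))) : Prop :=
  ∀ o : List (Step A), μ o =
    if ∃ ws : Fin k → List (Step A), (∀ i, ws i ∈ walks A n) ∧ o = (List.ofFn ws).flatten
    then (((walks A n).ncard : ENNReal) ^ k)⁻¹ else 0

end HalfPlane

/-! ### Algebraic power series satisfy recurrences with polynomial coefficients -/

/-! Part (1). Every rule of the grammar cuts a walk at a canonical prefix. A nonnegative walk is cut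
at its last visit to height 0, into an excursion and a walk that stays positive. A nonempty positive
walk is cut at the first prefix that reaches the minimum height `k` of its nonempty prefixes. An
excursion is cut at its first return to 0. The symbols `L_i` and `R_j` describe the `bridges` of
height `i` and `-j`: the walks whose proper nonempty prefixes lie above both ends. A bridge with at
least two steps is cut at the first and at the last prefix of height `k`, where `k` is the minimum
height of its proper nonempty prefixes. As first and last prefixes are unique (`IsFirst.eq`,
`IsLast.eq`), each word determines the rule and the factors; this is `Describes`, from which the
language and the unambiguity follow by induction.

Part (2). The program works with another unambiguous grammar of the nonnegative walks, with rules `X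
→ a` and `X → Y Z` only (`Strip.generates`). It is found by looking at a walk in a strip of height
`d`, where `d` bounds all steps, and by raising the ground by `d` when the walk leaves the strip
upwards. A uniform walk is the walk of a uniform random rank, so the task is to find the word of
given rank with few registers and in time `O(n log n)`.

Time: the words of length `s` are enumerated by increasing length `j` of the shorter of the two
factors. A split is then found in `O(j)` trials, and `j + j log j + (s - j) log (s - j) ≤ s log s`
for `2 j ≤ s` (`mul_log_split`) makes the total `O(n log n)`; the amortized accounting is in
`Searching.loop` and `Tape.processFront`.

Counts: they cannot be tabulated in finitely many registers. The generating series solve a quadratic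
system whose Jacobian determinant is invertible, so they are algebraic, hence satisfy linear
differential equations, and the counts satisfy recurrences with polynomial coefficients
(`exists_isPRecursive_of_quadratic`). A window of boundedly many consecutive counts moves by one
index in either direction in `O(1)` operations (`exists_step_expr`). The search keeps a near window
at `j`, moving up, and a far window at `s - j`, moving down.

Memory: the recursion is replaced by a list of pending items (symbol, length, rank), stored in two
integers: one with the symbols, one with the ranks. In both, an item of length `s` fills `s` digits
of a fixed base, so `O(n)` bits suffice. The variables `w` and `v` hold the items right of the
current one, `wl` and `vl` those on its left.

The algorithm is written in a small structured language and compiled to programs with constant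
overhead (`Runs.steps`); `Good` then tracks halting, register sizes and the law of the output
through the random draws. -/

namespace HalfPlane

open scoped PowerSeries LaurentSeries Polynomial

/-! ### Finiteness of the field generated by a solution of a quadratic system -/

section Algebraic

variable {K F I : Type} [Field K] [Field F] [Algebra K F] [Fintype I] [DecidableEq I]

/-- The Jacobian matrix of the quadratic system `y X = c X + ∑ m X Y Z * y Y * y Z`. -/
def jacobian {R : Type} [CommRing R] [Algebra K R] (m : I → I → I → K) (y : I → R) :
    Matrix I I R :=
  Matrix.of fun X W => ∑ Y, (m X Y W + m X W Y) • y Y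

-- The derivation takes values in an arbitrary module because two cases are needed: the universal
-- derivation of a field extension, and `d/dX` on power series.
omit [DecidableEq I] in
theorem derivation_quadratic {R M : Type} [CommRing R] [Algebra K R] [AddCommGroup M] [Module K M]
    [Module R M] [IsScalarTower K R M] (m : I → I → I → K) (y : I → R) (D : Derivation K R M)
    (X : I) : D (∑ Y, ∑ Z, m X Y Z • (y Y * y Z)) = ∑ W, jacobian m y X W • D (y W) := by
  have h1 : ∑ W, jacobian m y X W • D (y W) =
      ∑ W, ∑ Y, ((m X Y W • y Y) • D (y W) + (m X W Y • y Y) • D (y W)) := by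
    refine Finset.sum_congr rfl fun W _ => ?_
    simp [jacobian, Finset.sum_smul, add_smul]
  rw [h1]
  simp only [map_sum, Derivation.map_smul, Derivation.leibniz, smul_add, Finset.sum_add_distrib,
    smul_assoc]
  rw [Finset.sum_comm]

/-- Cramer's rule: the adjugate applied to the relations leaves the determinant times each unknown,
with unknowns in any module. -/
theorem smul_eq_zero_of_matrix {R M : Type} [CommRing R] [AddCommGroup M] [Module R M]
    (A : Matrix I I R) (x : I → M) (h : ∀ X, ∑ W, A X W • x W = 0) (X : I) :
    A.det • x X = 0 := by
  have h2 : ∑ Y, A.adjugate X Y • ∑ W, A Y W • x W = A.det • x X := by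
    simp only [Finset.smul_sum, smul_smul]
    rw [Finset.sum_comm]
    simp only [← Finset.sum_smul]
    have : ∀ W, ∑ Y, A.adjugate X Y * A Y W = (A.det • (1 : Matrix I I R)) X W := by
      intro W
      rw [← Matrix.adjugate_mul, Matrix.mul_apply]
    simp [this, Matrix.one_apply, ite_smul]
  rw [← h2]
  simp [h]

/-- The universal derivation applied to the system gives `(1 - J) D y = 0` in `Ω[L⁄K]`. Since the
determinant is not zero, every `D (y X)` vanishes, hence `D` vanishes on all of `L`, and `Ω[L⁄K] =
0`. An essentially finitely generated field extension that is unramified is finite. -/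
theorem finiteDimensional_adjoin_of_quadratic (y : I → F) (c : I → K) (m : I → I → I → K)
    (hy : ∀ X, y X = algebraMap K F (c X) + ∑ Y, ∑ Z, m X Y Z • (y Y * y Z))
    (hdet : (1 - jacobian m y).det ≠ 0) :
    FiniteDimensional K (IntermediateField.adjoin K (Set.range y)) := by
  set L := IntermediateField.adjoin K (Set.range y) with hL
  have hfg : L.FG := IntermediateField.fg_adjoin_of_finite (Set.finite_range y)
  have : Algebra.EssFiniteType K L := IntermediateField.essFiniteType_iff.mpr hfg
  -- The system is moved from `F` into `L`, since the differentials are those of `L` over `K`.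
  let z : I → L := fun X => ⟨y X, IntermediateField.subset_adjoin _ _ ⟨X, rfl⟩⟩
  have hz : ∀ X, z X = algebraMap K L (c X) + ∑ Y, ∑ Z, m X Y Z • (z Y * z Z) := by
    intro X
    apply Subtype.ext
    have := hy X
    push_cast
    simpa [z] using this
  have hdetz : (1 - jacobian m z).det ≠ 0 := by
    intro h
    apply hdet
    have h3 := congrArg (algebraMap L F) h
    rw [map_zero, RingHom.map_det] at h3
    rw [← h3]
    congr 1
    ext X W
    simp only [jacobian, Matrix.sub_apply, RingHom.mapMatrix_apply, Matrix.map_apply,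
      Matrix.of_apply, map_sub, map_sum, Matrix.one_apply]
    congr 1
    split_ifs <;> simp
  let D := KaehlerDifferential.D K L
  have hDz : ∀ X, D (z X) = 0 := by
    intro X
    have h4 : ∀ X, ∑ W, (1 - jacobian m z) X W • D (z W) = 0 := by
      intro X
      have h5 : D (z X) = ∑ W, jacobian m z X W • D (z W) := by
        conv_lhs => rw [hz X]
        rw [map_add, Derivation.map_algebraMap, zero_add, derivation_quadratic]
      simp only [Matrix.sub_apply, sub_smul, Finset.sum_sub_distrib, ← h5, Matrix.one_apply,
        ite_smul, one_smul, zero_smul]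
      simp
    have := smul_eq_zero_of_matrix _ _ h4 X
    exact (smul_eq_zero.mp this).resolve_left hdetz
  have hD : ∀ x (hx : x ∈ L), D ⟨x, hx⟩ = 0 := by
    intro x hx
    induction hx using IntermediateField.adjoin_induction with
    | mem x hx => obtain ⟨X, rfl⟩ := hx; exact hDz X
    | algebraMap x => exact D.map_algebraMap x
    | add x y hx hy h1 h2 =>
      have := D.map_add ⟨x, hx⟩ ⟨y, hy⟩
      rw [h1, h2, add_zero] at this; exact this
    | mul x y hx hy h1 h2 =>
      have := D.leibniz ⟨x, hx⟩ ⟨y, hy⟩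
      rw [h1, h2, smul_zero, smul_zero, add_zero] at this; exact this
    | inv x hx h1 =>
      have := D.leibniz_inv ⟨x, hx⟩
      rw [h1, smul_zero] at this
      exact this
  have hun : Algebra.FormallyUnramified K L := by
    constructor
    refine (subsingleton_iff_forall_eq 0).mpr fun w => ?_
    have : (⊤ : Submodule L Ω[L⁄K]) ≤ ⊥ := by
      rw [← KaehlerDifferential.span_range_derivation, Submodule.span_le]
      rintro _ ⟨x, rfl⟩
      exact hD x.1 x.2
    exact this trivial
  exact Algebra.FormallyUnramified.finite_of_free K L

end Algebraic

end HalfPlane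

namespace HalfPlane

open scoped PowerSeries LaurentSeries Polynomial

/-! ### Differential equations for algebraic power series -/

section DFinite

variable {I : Type} [Fintype I] [DecidableEq I]

theorem mem_subalgebra_of_matrix {R : Type} [CommRing R] [Algebra ℚ R] (S : Subalgebra ℚ R)
    (A : Matrix I I R) (hA : ∀ X W, A X W ∈ S) : A.det ∈ S ∧ ∀ X W, A.adjugate X W ∈ S := by
  let B : Matrix I I S := Matrix.of fun X W => ⟨A X W, hA X W⟩
  have hB : A = S.val.mapMatrix B := by ext; rfl
  constructor
  · rw [hB, ← AlgHom.map_det]; exact (B.det).2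
  · intro X W
    rw [hB, ← AlgHom.map_adjugate]; exact (B.adjugate X W).2

/-- The algebra generated by the solution of a quadratic system and by the inverse of the
determinant of the system. -/
noncomputable def solutionAlgebra (m : I → I → I → ℚ) (f : I → ℚ⟦X⟧) : Subalgebra ℚ ℚ⟦X⟧ :=
  Algebra.adjoin ℚ (insert PowerSeries.X (Set.range f) ∪ {((1 - jacobian m f).det)⁻¹})

theorem jacobian_mem (S : Subalgebra ℚ ℚ⟦X⟧) (m : I → I → I → ℚ) (f : I → ℚ⟦X⟧)
    (hf : ∀ X, f X ∈ S) (X W : I) : (1 - jacobian m f) X W ∈ S := by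
  simp only [Matrix.sub_apply, jacobian, Matrix.of_apply, Matrix.one_apply]
  refine sub_mem ?_ (sum_mem fun Y _ => S.smul_mem (hf Y) _)
  split_ifs
  exacts [one_mem _, zero_mem _]

/-- The entries of the Jacobian are linear forms in the `f Y`, which have no constant term, so `1 -
J` is the identity modulo `X`. -/
theorem constantCoeff_det_jacobian (m : I → I → I → ℚ) (f : I → ℚ⟦X⟧)
    (h0 : ∀ X, PowerSeries.constantCoeff (f X) = 0) :
    PowerSeries.constantCoeff (1 - jacobian m f).det = 1 := by
  rw [RingHom.map_det]
  have : (PowerSeries.constantCoeff (R := ℚ)).mapMatrix (1 - jacobian m f) = 1 := by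
    ext X W
    simp [jacobian, Matrix.one_apply, h0, apply_ite, map_sum]
  rw [this, Matrix.det_one]

/-- Differentiating the system gives `(1 - J) f' = c`, so `f'` is `Δ⁻¹` times the adjugate applied
to `c`; this is why `Δ⁻¹` is adjoined. Its own derivative is `-Δ⁻² Δ'`. -/
theorem derivative_mem_solutionAlgebra (m : I → I → I → ℚ) (f : I → ℚ⟦X⟧) (c : I → ℚ)
    (h0 : ∀ X, PowerSeries.constantCoeff (f X) = 0)
    (hf : ∀ X, f X = c X • PowerSeries.X + ∑ Y, ∑ Z, m X Y Z • (f Y * f Z))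
    (g : ℚ⟦X⟧) (hg : g ∈ solutionAlgebra m f) :
    PowerSeries.derivative ℚ g ∈ solutionAlgebra m f := by
  set S := solutionAlgebra m f with hS
  set Δ := (1 - jacobian m f).det with hΔ
  have hΔ0 : PowerSeries.constantCoeff Δ ≠ 0 := by
    rw [constantCoeff_det_jacobian m f h0]; exact one_ne_zero
  have hfS : ∀ X, f X ∈ S := fun X => Algebra.subset_adjoin (by simp)
  have hΔi : Δ⁻¹ ∈ S := Algebra.subset_adjoin (by simp [hΔ])
  have hmat := mem_subalgebra_of_matrix S _ (jacobian_mem S m f hfS)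
  set D := PowerSeries.derivative ℚ with hD
  have hDf : ∀ X, D (f X) ∈ S := by
    have h4 : ∀ X, ∑ W, (1 - jacobian m f) X W • D (f W) = c X • (1 : ℚ⟦X⟧) := by
      intro X
      have h5 : D (f X) = c X • (1 : ℚ⟦X⟧) + ∑ W, jacobian m f X W • D (f W) := by
        conv_lhs => rw [hf X]
        rw [map_add, derivation_quadratic, Derivation.map_smul, hD, PowerSeries.derivative_X]
      simp only [Matrix.sub_apply, sub_smul, Finset.sum_sub_distrib, Matrix.one_apply,
        ite_smul, one_smul, zero_smul]
      simp [h5]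
    intro X
    have h6 : Δ * D (f X) = ∑ Y, (1 - jacobian m f).adjugate X Y * (c Y • (1 : ℚ⟦X⟧)) := by
      have h7 : ∀ Y, c Y • (1 : ℚ⟦X⟧) = ((1 - jacobian m f).mulVec fun W => D (f W)) Y := by
        intro Y; rw [← h4 Y]; rfl
      have h8 : ∑ Y, (1 - jacobian m f).adjugate X Y * (c Y • (1 : ℚ⟦X⟧)) =
          ((1 - jacobian m f).adjugate.mulVec
            ((1 - jacobian m f).mulVec fun W => D (f W))) X := by
        simp only [h7]; rfl
      rw [h8, Matrix.mulVec_mulVec, Matrix.adjugate_mul, Matrix.smul_mulVec, Matrix.one_mulVec]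
      rfl
    have h9 : D (f X) = Δ⁻¹ * ∑ Y, (1 - jacobian m f).adjugate X Y * (c Y • (1 : ℚ⟦X⟧)) := by
      rw [← h6, ← mul_assoc, PowerSeries.inv_mul_cancel _ hΔ0, one_mul]
    rw [h9]
    exact mul_mem hΔi (sum_mem fun Y _ => mul_mem (hmat.2 _ _) (S.smul_mem (one_mem _) _))
  -- Used for two sets of generators: for all of them, and for those without `Δ⁻¹`, whose algebra
  -- already contains `Δ`, in order to get `D Δ ∈ S`.
  have key : ∀ s : Set ℚ⟦X⟧, (∀ x ∈ s, D x ∈ S) → s ⊆ S → ∀ g ∈ Algebra.adjoin ℚ s, D g ∈ S := by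
    intro s hs hsS g hg
    induction hg using Algebra.adjoin_induction with
    | mem x hx => exact hs x hx
    | algebraMap r => rw [Derivation.map_algebraMap]; exact zero_mem _
    | add x y _ _ h1 h2 => rw [map_add]; exact add_mem h1 h2
    | mul x y hx hy h1 h2 =>
      have hle : Algebra.adjoin ℚ s ≤ S := Algebra.adjoin_le hsS
      rw [Derivation.leibniz]
      exact add_mem (mul_mem (hle hx) h2) (mul_mem (hle hy) h1)
  have hgen : ∀ x ∈ insert PowerSeries.X (Set.range f), D x ∈ S := by
    rintro x (rfl | ⟨X, rfl⟩)
    · rw [hD, PowerSeries.derivative_X]; exact one_mem _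
    · exact hDf X
  refine key _ ?_ Algebra.subset_adjoin g hg
  rintro x (hx | hx)
  · exact hgen x hx
  · rw [Set.mem_singleton_iff.mp hx, hD, PowerSeries.derivative_inv']
    refine mul_mem (neg_mem (pow_mem hΔi 2)) ?_
    refine key _ hgen (fun x hx => Algebra.subset_adjoin (Or.inl hx)) _ ?_
    exact (mem_subalgebra_of_matrix _ _ (jacobian_mem _ m f
      fun X => Algebra.subset_adjoin (by simp))).1

/-- All derivatives of `f X` stay in the solution algebra, and `φ` maps this algebra into a finite
extension `L` of `K = ℚ(X)`. Too many derivatives are therefore linearly dependent. -/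
theorem exists_differential_equation_aux {K F : Type} [Field K] [Field F] [Algebra K F]
    [Algebra ℚ K] [Algebra ℚ[X] K] [IsScalarTower ℚ ℚ[X] K] [IsFractionRing ℚ[X] K]
    (φ : ℚ⟦X⟧ →+* F) (hφ : Function.Injective φ)
    (hφp : ∀ q : ℚ[X], φ (q : ℚ⟦X⟧) = algebraMap K F (algebraMap ℚ[X] K q))
    (m : I → I → I → ℚ) (f : I → ℚ⟦X⟧) (c : I → ℚ)
    (h0 : ∀ X, PowerSeries.constantCoeff (f X) = 0)
    (hf : ∀ X, f X = c X • PowerSeries.X + ∑ Y, ∑ Z, m X Y Z • (f Y * f Z)) (X : I) :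
    ∃ (N : ℕ) (p : Fin N → ℚ[X]), (∃ i, p i ≠ 0) ∧
      ∑ i, (p i : ℚ⟦X⟧) * ((PowerSeries.derivative ℚ)^[i] (f X)) = 0 := by
  set S := solutionAlgebra m f with hS
  have hmem : ∀ i : ℕ, (PowerSeries.derivative ℚ)^[i] (f X) ∈ S := by
    intro i
    induction i with
    | zero => exact Algebra.subset_adjoin (by simp)
    | succ i ih =>
      rw [Function.iterate_succ_apply']
      exact derivative_mem_solutionAlgebra m f c h0 hf _ ih
  have hφc : ∀ (q : ℚ) (g : ℚ⟦X⟧), φ (q • g) = algebraMap ℚ K q • φ g := by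
    intro q g
    rw [Algebra.smul_def, Algebra.smul_def, map_mul]
    congr 1
    have := hφp (Polynomial.C q)
    rw [Polynomial.coe_C] at this
    rw [IsScalarTower.algebraMap_apply ℚ ℚ[X] K]
    exact this
  let y : I → F := fun X => φ (f X)
  let m' : I → I → I → K := fun X Y Z => algebraMap ℚ K (m X Y Z)
  have hjac : (1 - jacobian m' y) = φ.mapMatrix (1 - jacobian m f) := by
    ext1 X W
    simp only [jacobian, Matrix.sub_apply, RingHom.mapMatrix_apply, Matrix.map_apply,
      Matrix.of_apply, map_sub, map_sum, Matrix.one_apply, hφc, m', y, map_add]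
    congr 1
    split_ifs <;> simp
  have hdet : (1 - jacobian m' y).det ≠ 0 := by
    rw [hjac, ← RingHom.map_det]
    intro h
    have h1 := constantCoeff_det_jacobian m f h0
    rw [hφ (h.trans φ.map_zero.symm)] at h1
    simp at h1
  have hy : ∀ X, y X = algebraMap K F (algebraMap ℚ[X] K (c X • Polynomial.X)) +
      ∑ Y, ∑ Z, m' X Y Z • (y Y * y Z) := by
    intro X
    rw [← hφp]
    simp only [y, m', ← map_mul, ← hφc, ← map_sum, ← map_add]
    congr 1
    conv_lhs => rw [hf X]
    congr 1
    rw [Polynomial.coe_smul, Polynomial.coe_X]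
  have hfin := finiteDimensional_adjoin_of_quadratic y _ m' hy hdet
  set L := IntermediateField.adjoin K (Set.range y) with hL
  have hyL : ∀ X, φ (f X) ∈ L := fun X => IntermediateField.subset_adjoin _ _ ⟨X, rfl⟩
  -- The series `X` and `f Y` are mapped into `L`, the determinant is a polynomial in them, and `L`
  -- is closed under inverses.
  have hSL : ∀ g ∈ S, φ g ∈ L := by
    have hc : ∀ q : ℚ, φ (algebraMap ℚ _ q) ∈ L := by
      intro q
      rw [Algebra.algebraMap_eq_smul_one, hφc, map_one]
      exact L.smul_mem (one_mem _)
    have key : ∀ s : Set ℚ⟦X⟧, (∀ x ∈ s, φ x ∈ L) → ∀ g ∈ Algebra.adjoin ℚ s, φ g ∈ L := by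
      intro s hs g hg
      induction hg using Algebra.adjoin_induction with
      | mem x hx => exact hs x hx
      | algebraMap r => exact hc r
      | add x y _ _ h1 h2 => rw [map_add]; exact add_mem h1 h2
      | mul x y hx hy h1 h2 => rw [map_mul]; exact mul_mem h1 h2
    have hgen : ∀ x ∈ insert PowerSeries.X (Set.range f), φ x ∈ L := by
      rintro x (rfl | ⟨X, rfl⟩)
      · have := hφp Polynomial.X
        rw [Polynomial.coe_X] at this
        rw [this]
        exact L.algebraMap_mem _
      · exact hyL X
    refine key _ ?_
    rintro x (hx | hx)
    · exact hgen x hx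
    · rw [Set.mem_singleton_iff.mp hx]
      have h1 : φ (1 - jacobian m f).det * φ ((1 - jacobian m f).det)⁻¹ = 1 := by
        rw [← map_mul, PowerSeries.mul_inv_cancel _ (by
          rw [constantCoeff_det_jacobian m f h0]; exact one_ne_zero), map_one]
      rw [eq_inv_of_mul_eq_one_right h1]
      refine inv_mem (key _ hgen _ ?_)
      exact (mem_subalgebra_of_matrix _ _ (jacobian_mem _ m f
        fun X => Algebra.subset_adjoin (by simp))).1
  let _ : Module ℚ[X] L := Module.compHom L (algebraMap ℚ[X] K)
  have : IsScalarTower ℚ[X] K L := IsScalarTower.of_algebraMap_smul fun _ _ => rfl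
  -- One more derivative than the dimension of `L`. A dependence over the fraction field `K` yields
  -- one with coefficients in `ℚ[X]`.
  let N := Module.finrank K L + 1
  let b : Fin N → L := fun i => ⟨φ ((PowerSeries.derivative ℚ)^[i] (f X)), hSL _ (hmem i)⟩
  have hdep : ¬ LinearIndependent K b := by
    intro h
    have := h.fintype_card_le_finrank
    simp [N] at this
  rw [← LinearIndependent.iff_fractionRing ℚ[X] K, Fintype.not_linearIndependent_iff] at hdep
  obtain ⟨p, hp, i, hi⟩ := hdep
  refine ⟨N, p, ⟨i, hi⟩, hφ ?_⟩
  rw [map_zero, map_sum]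
  have h2 := congrArg (fun z : L => (z : F)) hp
  simp only [ZeroMemClass.coe_zero] at h2
  rw [← h2]
  push_cast
  refine Finset.sum_congr rfl fun i _ => ?_
  rw [map_mul, hφp]
  have h3 : p i • b i = algebraMap ℚ[X] K (p i) • b i := by
    rw [algebraMap_smul]
  rw [h3]
  simp [b, Algebra.smul_def]

open scoped RatFunc in
theorem exists_differential_equation (m : I → I → I → ℚ) (f : I → ℚ⟦X⟧) (c : I → ℚ)
    (h0 : ∀ X, PowerSeries.constantCoeff (f X) = 0)
    (hf : ∀ X, f X = c X • PowerSeries.X + ∑ Y, ∑ Z, m X Y Z • (f Y * f Z)) (X : I) :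
    ∃ (N : ℕ) (p : Fin N → ℚ[X]), (∃ i, p i ≠ 0) ∧
      ∑ i, (p i : ℚ⟦X⟧) * ((PowerSeries.derivative ℚ)^[i] (f X)) = 0 :=
  exists_differential_equation_aux (K := RatFunc ℚ) (algebraMap ℚ⟦X⟧ ℚ⸨X⸩)
    HahnSeries.ofPowerSeries_injective (fun q => RatFunc.coe_coe q) m f c h0 hf X

end DFinite

end HalfPlane

namespace HalfPlane

open scoped PowerSeries Polynomial

/-! ### Recurrences with polynomial coefficients -/

section PRecursive

theorem coeff_polynomial_mul (p : ℚ[X]) (g : ℚ⟦X⟧) (B n : ℕ) (hB : p.natDegree ≤ B) :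
    PowerSeries.coeff (n + B) ((p : ℚ⟦X⟧) * g) =
      ∑ j ∈ Finset.range (B + 1), p.coeff j * PowerSeries.coeff (n + B - j) g := by
  rw [PowerSeries.coeff_mul, Finset.Nat.sum_antidiagonal_eq_sum_range_succ
    (fun i j => PowerSeries.coeff i (p : ℚ⟦X⟧) * PowerSeries.coeff j g)]
  symm
  have hsub : Finset.range (B + 1) ⊆ Finset.range (n + B).succ := by
    intro x; simp only [Finset.mem_range]; omega
  rw [← Finset.sum_subset hsub]
  · simp
  · intro x _ hx
    rw [Polynomial.coeff_coe, Polynomial.coeff_eq_zero_of_natDegree_lt, zero_mul]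
    simp only [Finset.mem_range] at hx
    omega

/-- Polynomial coefficients of the recurrence extracted from the differential equation
`∑ p i * f^(i) = 0`. -/
noncomputable def recurrencePoly {N : ℕ} (p : Fin N → ℚ[X]) (B s : ℕ) : ℚ[X] :=
  ∑ i : Fin N, ∑ j ∈ Finset.range (B + 1), if s + j = B + i then
    Polynomial.C ((p i).coeff j) *
      (ascPochhammer ℚ i).comp (Polynomial.X + Polynomial.C (B - j + 1 : ℚ)) else 0

/-- This is the coefficient of `X ^ (m + B)` in the differential equation: the monomial `X ^ j` of
`p i` contributes the coefficient of `f` of index `m + B - j + i`, times a rising factorial in `m`,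
so it belongs to the shift `s = B + i - j`. -/
theorem sum_recurrencePoly {N : ℕ} (p : Fin N → ℚ[X]) (B : ℕ) (hB : ∀ i, (p i).natDegree ≤ B)
    (f : ℚ⟦X⟧) (hp : ∑ i, (p i : ℚ⟦X⟧) * ((PowerSeries.derivative ℚ)^[i] f) = 0) (m : ℕ) :
    ∑ s ∈ Finset.range (B + N), (recurrencePoly p B s).eval (m : ℚ) *
      PowerSeries.coeff (m + s) f = 0 := by
  have h1 := congrArg (PowerSeries.coeff (m + B)) hp
  rw [map_sum, map_zero] at h1
  rw [← h1]
  simp only [recurrencePoly, Polynomial.eval_finsetSum, Finset.sum_mul]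
  rw [Finset.sum_comm]
  refine Finset.sum_congr rfl fun i _ => ?_
  rw [Finset.sum_comm, coeff_polynomial_mul _ _ _ _ (hB i)]
  refine Finset.sum_congr rfl fun j hj => ?_
  have hj' : j ≤ B := by simpa [Nat.lt_succ_iff] using hj
  rw [Finset.sum_eq_single (B + i - j)]
  · rw [if_pos (by omega), PowerSeries.coeff_iterate_derivative]
    have : m + B - j + i = m + (B + i - j) := by omega
    rw [this, ← mul_assoc]
    congr 1
    simp only [Polynomial.eval_mul, Polynomial.eval_C, Polynomial.eval_comp, Polynomial.eval_add,
      Polynomial.eval_X]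
    congr 1
    rw [← ascPochhammer_nat_eq_natCast_ascFactorial]
    congr 1
    have : ((m + B - j : ℕ) : ℚ) = m + B - j := by
      rw [Nat.cast_sub (by omega)]; push_cast; ring
    push_cast [this]
    ring
  · intro s _ hs
    rw [if_neg (by omega)]; simp
  · intro h
    exfalso
    apply h
    have := i.2
    simp only [Finset.mem_range]; omega

/-- Let `i` be the largest index with `p i ≠ 0`, and `d` the degree of `p i`. In the polynomial of
shift `B + i - d`, the coefficient of degree `i` is the leading coefficient of `p i`: smaller
indices only give degrees below `i`, and the index `i` itself occurs only with `j = d`. -/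
theorem exists_recurrencePoly_ne_zero {N : ℕ} (p : Fin N → ℚ[X]) (B : ℕ)
    (hB : ∀ i, (p i).natDegree ≤ B) (h : ∃ i, p i ≠ 0) :
    ∃ s < B + N, recurrencePoly p B s ≠ 0 := by
  classical
  obtain ⟨i, hi, hmax⟩ := (Finset.univ.filter fun i => p i ≠ 0).exists_max_image id
    (by obtain ⟨i, hi⟩ := h; exact ⟨i, by simpa using hi⟩)
  simp only [Finset.mem_filter, Finset.mem_univ, true_and, id] at hi hmax
  have hlead : (p i).coeff (p i).natDegree ≠ 0 := by simpa using hi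
  set d := (p i).natDegree with hd
  have hdB : d ≤ B := hB i
  refine ⟨B + i - d, by have := i.2; omega, fun hz => hlead ?_⟩
  have h2 := congrArg (fun q : ℚ[X] => q.coeff i) hz
  simp only [recurrencePoly, Polynomial.finsetSum_coeff, Polynomial.coeff_zero] at h2
  have hasc : ∀ (k : ℕ) (c : ℚ),
      ((ascPochhammer ℚ k).comp (Polynomial.X + Polynomial.C c)).natDegree = k := by
    intro k c
    rw [Polynomial.natDegree_comp, ascPochhammer_natDegree, Polynomial.natDegree_X_add_C, mul_one]
  rw [Finset.sum_eq_single i, Finset.sum_eq_single d] at h2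
  · rw [if_pos (by omega), Polynomial.coeff_C_mul] at h2
    have hm : ((ascPochhammer ℚ i).comp
        (Polynomial.X + Polynomial.C (B - d + 1 : ℚ))).coeff i = 1 := by
      have := (monic_ascPochhammer ℚ (i : ℕ)).comp_X_add_C (B - d + 1 : ℚ)
      rw [Polynomial.Monic, Polynomial.leadingCoeff, hasc] at this
      exact this
    rwa [hm, mul_one] at h2
  · intro j _ hj
    rw [if_neg (by omega), Polynomial.coeff_zero]
  · intro h; exfalso; apply h; simp only [Finset.mem_range]; omega
  · intro k _ hk
    refine Finset.sum_eq_zero fun j _ => ?_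
    split_ifs
    · rw [Polynomial.coeff_C_mul]
      rcases lt_or_gt_of_ne hk with hlt | hgt
      · rw [Polynomial.coeff_eq_zero_of_natDegree_lt (p := Polynomial.comp _ _)
          (by rw [hasc]; exact hlt), mul_zero]
      · have : p k = 0 := by
          by_contra hne
          exact absurd (hmax k hne) (not_le.mpr hgt)
        rw [this]; simp
    · simp
  · simp

/-- The sequence `a` satisfies, from index `n₀` on, a recurrence of order `r` with polynomial
coefficients whose first and last coefficients do not vanish. -/
def IsPRecursive (r n₀ : ℕ) (a : ℕ → ℤ) : Prop :=
  ∃ q : ℕ → ℤ[X], ∀ n ≥ n₀, (q 0).eval (n : ℤ) ≠ 0 ∧ (q r).eval (n : ℤ) ≠ 0 ∧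
    ∑ i ∈ Finset.range (r + 1), (q i).eval (n : ℤ) * a (n + i) = 0

/-- The recurrence at `n + 1` is added to the one at `n`. The end coefficients become `q 0` at `n`
and `q r` at `n + 1`, which are still nonzero. This serves to bring several sequences to a common
order. -/
theorem IsPRecursive.succ_order {r n₀ : ℕ} {a : ℕ → ℤ} (h : IsPRecursive r n₀ a) :
    IsPRecursive (r + 1) n₀ a := by
  obtain ⟨q, hq⟩ := h
  refine ⟨fun i => Nat.casesOn i (q 0) fun i =>
    (if i + 1 ≤ r then q (i + 1) else 0) + (q i).comp (Polynomial.X + 1), fun n hn => ?_⟩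
  obtain ⟨h1, h2, h3⟩ := hq n hn
  obtain ⟨h1', h2', h3'⟩ := hq (n + 1) (by omega)
  refine ⟨h1, ?_, ?_⟩
  · simpa using h2'
  · rw [Finset.sum_range_succ']
    simp only [Polynomial.eval_add, Polynomial.eval_comp, Polynomial.eval_X, Polynomial.eval_one,
      add_mul, Finset.sum_add_distrib]
    have h4 : ∑ i ∈ Finset.range (r + 1), (q i).eval ((n : ℤ) + 1) * a (n + (i + 1)) = 0 := by
      rw [← h3']
      refine Finset.sum_congr rfl fun i _ => ?_
      push_cast
      rw [show n + (i + 1) = n + 1 + i by ring]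
    have h5 : ∑ i ∈ Finset.range (r + 1), (if i + 1 ≤ r then q (i + 1) else 0).eval (n : ℤ) *
        a (n + (i + 1)) = ∑ i ∈ Finset.range r, (q (i + 1)).eval (n : ℤ) * a (n + (i + 1)) := by
      rw [Finset.sum_range_succ, if_neg (by omega), Polynomial.eval_zero, zero_mul, add_zero]
      refine Finset.sum_congr rfl fun i hi => ?_
      rw [if_pos (by simp only [Finset.mem_range] at hi; omega)]
    rw [h4, h5, add_zero, ← h3, Finset.sum_range_succ' _ r]
    rfl

theorem IsPRecursive.mono {r n₀ r' n₀' : ℕ} {a : ℕ → ℤ} (h : IsPRecursive r n₀ a) (hr : r ≤ r')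
    (hn : n₀ ≤ n₀') : IsPRecursive r' n₀' a := by
  induction r', hr using Nat.le_induction with
  | base =>
    obtain ⟨q, hq⟩ := h
    exact ⟨q, fun n h => hq n (hn.trans h)⟩
  | succ r' _ ih => exact ih.succ_order

theorem exists_eval_ne_zero (q : ℤ[X]) (hq : q ≠ 0) : ∃ n₀ : ℕ, ∀ n ≥ n₀, q.eval (n : ℤ) ≠ 0 := by
  obtain ⟨b, hb⟩ := (q.roots.toFinset.finite_toSet).bddAbove
  refine ⟨b.toNat + 1, fun n hn h => ?_⟩
  have : (n : ℤ) ≤ b := hb (by simp [hq, h])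
  omega

/-- A common denominator is cleared because the programs compute with integers only. -/
theorem exists_integer_multiple (S : ℕ) (q : ℕ → ℚ[X]) :
    ∃ D : ℤ, D ≠ 0 ∧ ∀ s < S, ∃ Q : ℤ[X], Q.map (Int.castRingHom ℚ) = (D : ℚ) • q s := by
  induction S with
  | zero => exact ⟨1, one_ne_zero, fun s hs => absurd hs (by omega)⟩
  | succ S ih =>
    obtain ⟨D, hD, h⟩ := ih
    obtain ⟨b, hb, hb'⟩ := IsLocalization.integerNormalization_spec (nonZeroDivisors ℤ) (q S)
    have hb0 : b ≠ 0 := nonZeroDivisors.ne_zero hb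
    refine ⟨D * b, mul_ne_zero hD hb0, fun s hs => ?_⟩
    rcases Nat.lt_succ_iff_lt_or_eq.mp hs with hs | rfl
    · obtain ⟨Q, hQ⟩ := h s hs
      refine ⟨b • Q, ?_⟩
      rw [zsmul_eq_mul, Polynomial.map_mul, hQ]
      push_cast
      rw [mul_comm (D : ℚ), mul_smul]
      simp [Polynomial.smul_eq_C_mul]
    · refine ⟨D • IsLocalization.integerNormalization (nonZeroDivisors ℤ) (q s), ?_⟩
      have hb2 : Polynomial.map (Int.castRingHom ℚ)
        (IsLocalization.integerNormalization (nonZeroDivisors ℤ) (q s)) = b • q s := hb'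
      rw [zsmul_eq_mul, Polynomial.map_mul, hb2]
      push_cast
      rw [mul_smul]
      simp [Polynomial.smul_eq_C_mul]

/-- Only the terms between the first and the last nonzero polynomial are kept. These two have
finitely many roots, so they do not vanish from some index on. -/
theorem exists_isPRecursive_of_sum (S : ℕ) (q : ℕ → ℚ[X]) (a : ℕ → ℤ)
    (hne : ∃ s < S, q s ≠ 0)
    (h : ∀ m : ℕ, ∑ s ∈ Finset.range S, (q s).eval (m : ℚ) * (a (m + s) : ℚ) = 0) :
    ∃ r n₀, IsPRecursive r n₀ a := by
  classical
  obtain ⟨D, hD, hQ⟩ := exists_integer_multiple S q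
  choose! Q hQ using hQ
  have hQe : ∀ s < S, ∀ m : ℤ, (((Q s).eval m : ℤ) : ℚ) = D * (q s).eval (m : ℚ) := by
    intro s hs m
    have h1 : ((Q s).map (Int.castRingHom ℚ)).eval (m : ℚ) = ((Q s).eval m : ℤ) := by
      exact Polynomial.eval_intCast_map (Int.castRingHom ℚ) (Q s) m
    rw [← h1, hQ s hs, Polynomial.eval_smul, smul_eq_mul]
  have hQ0 : ∀ s < S, q s ≠ 0 → Q s ≠ 0 := by
    intro s hs hne h0
    have := hQ s hs
    rw [h0, Polynomial.map_zero] at this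
    have hD' : (D : ℚ) ≠ 0 := by exact_mod_cast hD
    exact (smul_ne_zero hD' hne) this.symm
  have hsum : ∀ m : ℕ, ∑ s ∈ Finset.range S, (Q s).eval (m : ℤ) * a (m + s) = 0 := by
    intro m
    have h1 : ((∑ s ∈ Finset.range S, (Q s).eval (m : ℤ) * a (m + s) : ℤ) : ℚ) = 0 := by
      push_cast
      have h2 : ∀ s ∈ Finset.range S, (((Q s).eval (m : ℤ) : ℤ) : ℚ) * (a (m + s) : ℚ) =
          D * ((q s).eval (m : ℚ) * (a (m + s) : ℚ)) := by
        intro s hs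
        rw [hQe s (Finset.mem_range.mp hs)]
        push_cast; ring
      rw [Finset.sum_congr rfl h2, ← Finset.mul_sum, h m, mul_zero]
    exact_mod_cast h1
  set Z := (Finset.range S).filter fun s => Q s ≠ 0 with hZ
  have hZne : Z.Nonempty := by
    obtain ⟨s, hs, hs'⟩ := hne
    exact ⟨s, by simp [hZ, hs, hQ0 s hs hs']⟩
  set s₀ := Z.min' hZne
  set s₁ := Z.max' hZne
  have h0 := Z.min'_mem hZne
  have h1 := Z.max'_mem hZne
  have h01 : s₀ ≤ s₁ := Z.min'_le _ h1
  simp only [hZ, Finset.mem_filter, Finset.mem_range] at h0 h1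
  obtain ⟨n0, hn0⟩ := exists_eval_ne_zero _ h0.2
  obtain ⟨n1, hn1⟩ := exists_eval_ne_zero _ h1.2
  have h0S : s₀ < S := h0.1
  have h1S : s₁ < S := h1.1
  -- The shift by `s₀` gives the first nonzero polynomial the index `0`. The threshold ensures that
  -- `n - s₀` is beyond the roots of both end polynomials.
  refine ⟨s₁ - s₀, s₀ + n0 + n1,
    fun i => (Q (s₀ + i)).comp (Polynomial.X - Polynomial.C (s₀ : ℤ)), fun n hn => ?_⟩
  have he : ∀ s, ((Q s).comp (Polynomial.X - Polynomial.C (s₀ : ℤ))).eval (n : ℤ) =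
      (Q s).eval ((n - s₀ : ℕ) : ℤ) := by
    intro s
    simp only [Polynomial.eval_comp, Polynomial.eval_sub, Polynomial.eval_X, Polynomial.eval_C]
    rw [Nat.cast_sub (by omega)]
  simp only [he]
  refine ⟨hn0 _ (by omega), ?_, ?_⟩
  · rw [show s₀ + (s₁ - s₀) = s₁ by omega]; exact hn1 _ (by omega)
  · rw [← hsum (n - s₀)]
    have hsub : Finset.Ico s₀ (s₁ + 1) ⊆ Finset.range S := by
      intro x; simp only [Finset.mem_Ico, Finset.mem_range]; omega
    rw [← Finset.sum_subset hsub, Finset.sum_Ico_eq_sum_range,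
      show s₁ + 1 - s₀ = s₁ - s₀ + 1 by omega]
    · refine Finset.sum_congr rfl fun i _ => ?_
      rw [show n - s₀ + (s₀ + i) = n + i by omega]
    · intro x hx hx'
      have : Q x = 0 := by
        by_contra hne
        have hxZ : x ∈ Z := by simp only [hZ, Finset.mem_filter]; exact ⟨hx, hne⟩
        have ha := Z.min'_le x hxZ
        have hb := Z.le_max' x hxZ
        apply hx'
        simp only [Finset.mem_Ico]
        exact ⟨ha, Nat.lt_succ_of_le hb⟩
      rw [this]; simp

theorem exists_isPRecursive_of_quadratic {I : Type} [Fintype I] [DecidableEq I]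
    (m : I → I → I → ℚ) (a : I → ℕ → ℤ) (c : I → ℚ) (h0 : ∀ X, a X 0 = 0)
    (hf : ∀ X, PowerSeries.mk (fun n => (a X n : ℚ)) = c X • PowerSeries.X + ∑ Y, ∑ Z,
      m X Y Z • (PowerSeries.mk (fun n => (a Y n : ℚ)) * PowerSeries.mk (fun n => (a Z n : ℚ)))) :
    ∃ r n₀, ∀ X, IsPRecursive r n₀ (a X) := by
  have h : ∀ X, ∃ r n₀, IsPRecursive r n₀ (a X) := by
    intro X
    obtain ⟨N, p, hp, heq⟩ := exists_differential_equation m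
      (fun X => PowerSeries.mk (fun n => (a X n : ℚ))) c (by intro X; simp [h0]) hf X
    obtain ⟨B, hB⟩ : ∃ B, ∀ i, (p i).natDegree ≤ B :=
      ⟨Finset.univ.sup fun i => (p i).natDegree, fun i =>
        Finset.le_sup (f := fun i => (p i).natDegree) (Finset.mem_univ i)⟩
    refine exists_isPRecursive_of_sum (B + N) (recurrencePoly p B) (a X)
      (exists_recurrencePoly_ne_zero p B hB hp) fun n => ?_
    simpa using sum_recurrencePoly p B hB _ heq n
  choose r n hrn using h
  exact ⟨Finset.univ.sup r, Finset.univ.sup n, fun X => (hrn X).mono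
    (Finset.le_sup (Finset.mem_univ X)) (Finset.le_sup (Finset.mem_univ X))⟩

end PRecursive

end HalfPlane

namespace HalfPlane

/-! ### A structured language and its compilation to programs -/

/-- Arithmetic expressions over the variables `V`. -/
inductive Expr (V : Type) : Type
  | var (x : V) : Expr V
  | const (z : ℤ) : Expr V
  | add (a b : Expr V) : Expr V
  | sub (a b : Expr V) : Expr V
  | mul (a b : Expr V) : Expr V
  | div (a b : Expr V) : Expr V
  /-- `a` if `0 < c`, and `b` otherwise -/
  | ite (c a b : Expr V) : Expr V

namespace Expr

variable {V W : Type}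

/-- The value of an expression. -/
def eval (σ : V → ℤ) : Expr V → ℤ
  | var x => σ x
  | const z => z
  | add a b => a.eval σ + b.eval σ
  | sub a b => a.eval σ - b.eval σ
  | mul a b => a.eval σ * b.eval σ
  | div a b => a.eval σ / b.eval σ
  | ite c a b => if 0 < c.eval σ then a.eval σ else b.eval σ

instance : Add (Expr V) := ⟨add⟩
instance : Sub (Expr V) := ⟨sub⟩
instance : Mul (Expr V) := ⟨mul⟩
instance : Div (Expr V) := ⟨div⟩
instance (n : ℕ) : OfNat (Expr V) n := ⟨const n⟩

@[simp] theorem eval_var (σ : V → ℤ) (x : V) : (var x).eval σ = σ x := rfl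
@[simp] theorem eval_const (σ : V → ℤ) (z : ℤ) : (const z).eval σ = z := rfl
@[simp] theorem eval_add (σ : V → ℤ) (a b : Expr V) :
    (a + b).eval σ = a.eval σ + b.eval σ := rfl
@[simp] theorem eval_sub (σ : V → ℤ) (a b : Expr V) :
    (a - b).eval σ = a.eval σ - b.eval σ := rfl
@[simp] theorem eval_mul (σ : V → ℤ) (a b : Expr V) :
    (a * b).eval σ = a.eval σ * b.eval σ := rfl
@[simp] theorem eval_div (σ : V → ℤ) (a b : Expr V) :
    (a / b).eval σ = a.eval σ / b.eval σ := rfl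
@[simp] theorem eval_ite (σ : V → ℤ) (c a b : Expr V) :
    (ite c a b).eval σ = if 0 < c.eval σ then a.eval σ else b.eval σ := rfl

/-- The exponent in the bound on the values of the subexpressions. -/
def size : Expr V → ℕ
  | var _ => 1
  | const z => z.natAbs + 1
  | add a b | sub a b | mul a b | div a b => a.size + b.size
  | ite c a b => c.size + a.size + b.size

/-- The number of temporary registers needed for the evaluation. -/
def depth : Expr V → ℕ
  | var _ | const _ => 1
  | add a b | sub a b | mul a b | div a b => max a.depth (b.depth + 1)
  | ite c a b => max c.depth (max a.depth b.depth)

/-- A bound for the number of instructions needed for the evaluation. -/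
def cost : Expr V → ℕ
  | var _ => 3
  | const _ => 1
  | add a b | sub a b | mul a b | div a b => a.cost + b.cost + 3
  | ite c a b => c.cost + a.cost + b.cost + 2

/-- Replacing the variables by expressions. -/
def subst (f : V → Expr W) : Expr V → Expr W
  | var x => f x
  | const z => const z
  | add a b => add (a.subst f) (b.subst f)
  | sub a b => sub (a.subst f) (b.subst f)
  | mul a b => mul (a.subst f) (b.subst f)
  | div a b => div (a.subst f) (b.subst f)
  | ite c a b => ite (c.subst f) (a.subst f) (b.subst f)

@[simp] theorem eval_subst (f : V → Expr W) (σ : W → ℤ) (e : Expr V) :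
    (e.subst f).eval σ = e.eval fun x => (f x).eval σ := by
  induction e <;> simp_all [subst, eval]

theorem one_le_size (e : Expr V) : 1 ≤ e.size := by
  induction e <;> simp only [size] <;> omega

theorem one_le_depth (e : Expr V) : 1 ≤ e.depth := by
  induction e <;> simp only [depth] <;> omega

/-- Two numbers that are at least `2` have a sum not larger than their product. As `M ≥ 2`,
exponents can thus be added for sums as well as for products, and an expression multiplies bit
lengths by a constant only. -/
theorem natAbs_eval_le (e : Expr V) (σ : V → ℤ) (M : ℕ) (hM : 2 ≤ M)
    (h : ∀ x, (σ x).natAbs ≤ M) : (e.eval σ).natAbs ≤ M ^ e.size := by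
  have hadd : ∀ a b : Expr V, (a.eval σ).natAbs ≤ M ^ a.size → (b.eval σ).natAbs ≤ M ^ b.size →
      (a.eval σ).natAbs + (b.eval σ).natAbs ≤ M ^ (a.size + b.size) := by
    intro a b ha hb
    have h1 : 2 ≤ M ^ a.size := hM.trans (Nat.le_self_pow (by have := a.one_le_size; omega) M)
    have h2 : 2 ≤ M ^ b.size := hM.trans (Nat.le_self_pow (by have := b.one_le_size; omega) M)
    rw [pow_add]
    nlinarith
  induction e with
  | var x => simpa [eval, size] using h x
  | const z =>
    simp only [eval, size]
    calc z.natAbs ≤ 2 ^ (z.natAbs + 1) := (Nat.lt_two_pow_self).le.trans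
          (Nat.pow_le_pow_right (by omega) (by omega))
      _ ≤ M ^ (z.natAbs + 1) := Nat.pow_le_pow_left hM _
  | add a b ha hb => exact (Int.natAbs_add_le _ _).trans (hadd a b ha hb)
  | sub a b ha hb => exact (Int.natAbs_sub_le _ _).trans (hadd a b ha hb)
  | mul a b ha hb =>
    simp only [eval, size, Int.natAbs_mul, pow_add]
    exact Nat.mul_le_mul ha hb
  | div a b ha hb =>
    refine le_trans ?_ (ha.trans (Nat.pow_le_pow_right (by omega) (Nat.le_add_right _ b.size)))
    have := Int.abs_ediv_le_abs (a.eval σ) (b.eval σ)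
    rw [Int.abs_eq_natAbs, Int.abs_eq_natAbs] at this
    exact_mod_cast this
  | ite c a b hc ha hb =>
    simp only [eval, size]
    split_ifs
    · exact ha.trans (Nat.pow_le_pow_right (by omega) (by omega))
    · exact hb.trans (Nat.pow_le_pow_right (by omega) (by omega))

end Expr

/-- All values are bounded by `M`. -/
def Bdd {ι : Type} (M : ℕ) (ρ : ι → ℤ) : Prop := ∀ x, (ρ x).natAbs ≤ M

theorem Bdd.update {ι : Type} [DecidableEq ι] {M : ℕ} {ρ : ι → ℤ} (h : Bdd M ρ) (x : ι) {z : ℤ}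
    (hz : z.natAbs ≤ M) : Bdd M (Function.update ρ x z) := by
  intro y
  rcases eq_or_ne y x with rfl | hne
  · simpa using hz
  · rw [Function.update_of_ne hne]; exact h y

/-- Deterministic execution in at most `t` steps, with all registers bounded by `M` in all
configurations after the first one. -/
inductive Steps {T : Type} {R : ℕ} (M : ℕ) : ℕ → Config T R → Config T R → Prop
  | refl (t : ℕ) (c : Config T R) : Steps M t c c
  | head (t : ℕ) (c c₁ c' : Config T R) (hs : step c = PMF.pure c₁) (hb : Bdd M c₁.regs)
      (h : Steps M t c₁ c') : Steps M (t + 1) c c'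

namespace Steps

variable {T : Type} {R M : ℕ}

theorem mono {t t' : ℕ} {c c' : Config T R} (h : Steps M t c c') (ht : t ≤ t') :
    Steps M t' c c' := by
  induction h generalizing t' with
  | refl t c => exact refl t' c
  | head t c c₁ c' hs hb _ ih =>
    obtain ⟨s, rfl⟩ : ∃ s, t' = s + 1 := ⟨t' - 1, by omega⟩
    exact head s c c₁ c' hs hb (ih (by omega))

theorem trans {t t' : ℕ} {c c' c'' : Config T R} (h : Steps M t c c') (h' : Steps M t' c' c'') :
    Steps M (t + t') c c'' := by
  induction h with
  | refl t c => exact h'.mono (by omega)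
  | head t c c₁ c' hs hb _ ih =>
    rw [show t + 1 + t' = t + t' + 1 by omega]
    exact head _ c c₁ c'' hs hb (ih h')

theorem trans_le {t t' s : ℕ} {c c' c'' : Config T R} (h : Steps M t c c')
    (h' : Steps M t' c' c'') (hs : t + t' ≤ s) : Steps M s c c'' :=
  (h.trans h').mono hs

theorem single {c c' : Config T R} (hs : step c = PMF.pure c') (hb : Bdd M c'.regs) :
    Steps M 1 c c' :=
  head 0 c c' c' hs hb (refl 0 c')

/-- The relation also allows no step at all, so a first step can be split off only if the
configurations differ. -/
theorem tail_of_ne {t : ℕ} {c c₁ c' : Config T R} (h : Steps M t c c') (hne : c ≠ c')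
    (hs : step c = PMF.pure c₁) : ∃ s, t = s + 1 ∧ Steps M s c₁ c' := by
  cases h with
  | refl => exact absurd rfl hne
  | head t _ c₂ _ hs' hb h' =>
    have : c₁ = c₂ := by
      have h1 : (PMF.pure c₁ : PMF (Config T R)) = PMF.pure c₂ := hs.symm.trans hs'
      have h2 : c₁ ∈ (PMF.pure c₂ : PMF (Config T R)).support := by rw [← h1]; simp
      simpa using h2
    subst this
    exact ⟨t, rfl, h'⟩

end Steps

/-- An assignment of registers to the variables, to a second copy of the variables, and to
`D` temporary values. -/
structure Layout (V : Type) (D R : ℕ) where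
  val : V → Fin R
  copy : V → Fin R
  tmp : ℕ → Fin R
  val_inj : Function.Injective val
  copy_inj : Function.Injective copy
  tmp_inj : ∀ i < D, ∀ j < D, tmp i = tmp j → i = j
  val_ne_copy : ∀ x y, val x ≠ copy y
  val_ne_tmp : ∀ x i, val x ≠ tmp i
  copy_ne_tmp : ∀ x i, copy x ≠ tmp i

variable {T V : Type} {D R : ℕ}

/-- The program `x := y`. -/
def Prog.move (x y : Fin R) : Prog T R := .seq (.const x 0) (.add x x y)

theorem steps_move {M : ℕ} (x y : Fin R) (hxy : y ≠ x) (K : List (Prog T R)) (ρ : Fin R → ℤ)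
    (o : List T) (hb : Bdd M ρ) :
    Steps M 3 ⟨.move x y :: K, ρ, o⟩ ⟨K, Function.update ρ x (ρ y), o⟩ := by
  refine Steps.head _ _ ⟨.const x 0 :: .add x x y :: K, ρ, o⟩ _ rfl hb ?_
  refine Steps.head _ _ ⟨.add x x y :: K, Function.update ρ x 0, o⟩ _ rfl
    (hb.update x (by simp)) ?_
  refine Steps.single ?_ (hb.update x (hb y))
  simp [step, Function.update_of_ne hxy]

/-- The program that evaluates an expression into the `d`-th temporary register. -/
def Expr.compile (l : Layout V D R) : Expr V → ℕ → Prog T R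
  | .var x, d => .move (l.tmp d) (l.val x)
  | .const z, d => .const (l.tmp d) z
  | .add a b, d => .seq (a.compile l d) (.seq (b.compile l (d + 1))
      (.add (l.tmp d) (l.tmp d) (l.tmp (d + 1))))
  | .sub a b, d => .seq (a.compile l d) (.seq (b.compile l (d + 1))
      (.sub (l.tmp d) (l.tmp d) (l.tmp (d + 1))))
  | .mul a b, d => .seq (a.compile l d) (.seq (b.compile l (d + 1))
      (.mul (l.tmp d) (l.tmp d) (l.tmp (d + 1))))
  | .div a b, d => .seq (a.compile l d) (.seq (b.compile l (d + 1))
      (.div (l.tmp d) (l.tmp d) (l.tmp (d + 1))))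
  | .ite c a b, d => .seq (c.compile l d) (.ifPos (l.tmp d) (a.compile l d) (b.compile l d))

/-- The register contents `ρ'` and `ρ` differ at most in temporary registers. -/
def SameVars (l : Layout V D R) (d : ℕ) (ρ ρ' : Fin R → ℤ) : Prop :=
  ∀ x, (∀ i, d ≤ i → i < D → x ≠ l.tmp i) → ρ' x = ρ x

theorem SameVars.trans {l : Layout V D R} {d d' : ℕ} {ρ ρ' ρ'' : Fin R → ℤ}
    (h : SameVars l d ρ ρ') (h' : SameVars l d' ρ' ρ'') (hd : d ≤ d') : SameVars l d ρ ρ'' :=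
  fun x hx => (h' x fun i hi hi' => hx i (hd.trans hi) hi').trans (h x hx)

theorem SameVars.update {l : Layout V D R} {d i : ℕ} {ρ ρ' : Fin R → ℤ}
    (h : SameVars l d ρ ρ') (hi : d ≤ i) (hi' : i < D) (z : ℤ) :
    SameVars l d ρ (Function.update ρ' (l.tmp i) z) := by
  intro x hx
  rw [Function.update_of_ne (hx i hi hi')]
  exact h x hx

theorem SameVars.val {l : Layout V D R} {d : ℕ} {ρ ρ' : Fin R → ℤ}
    (h : SameVars l d ρ ρ') (x : V) : ρ' (l.val x) = ρ (l.val x) :=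
  h _ fun i _ _ => l.val_ne_tmp x i

/-- The effect of the evaluation of an expression. -/
def Evaluates (l : Layout V D R) (M : ℕ) (p : Prog T R) (d t : ℕ) (σ : V → ℤ) (z : ℤ) : Prop :=
  ∀ (K : List (Prog T R)) (ρ : Fin R → ℤ) (o : List T), (∀ x, ρ (l.val x) = σ x) → Bdd M ρ →
    ∃ ρ', SameVars l d ρ ρ' ∧ ρ' (l.tmp d) = z ∧ Bdd M ρ' ∧ Steps M t ⟨p :: K, ρ, o⟩ ⟨K, ρ', o⟩

/-- The second operand is evaluated with temporaries from `d + 1` on, so the first one survives in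
the temporary `d`. -/
theorem evaluates_binary (l : Layout V D R) (M : ℕ) (p q : Prog T R) (d t t' : ℕ) (σ : V → ℤ)
    (y z w : ℤ) (f : Fin R → Fin R → Fin R → Prog T R) (hd : d + 1 < D)
    (hp : Evaluates l M p d t σ y) (hq : Evaluates l M q (d + 1) t' σ z) (hw : w.natAbs ≤ M)
    (hf : ∀ K ρ o, ρ (l.tmp d) = y → ρ (l.tmp (d + 1)) = z →
      step ⟨f (l.tmp d) (l.tmp d) (l.tmp (d + 1)) :: K, ρ, o⟩ =
        PMF.pure (⟨K, Function.update ρ (l.tmp d) w, o⟩ : Config T R)) :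
    Evaluates l M (.seq p (.seq q (f (l.tmp d) (l.tmp d) (l.tmp (d + 1))))) d (t + t' + 3) σ w := by
  intro K ρ o hρ hb
  set r : Prog T R := f (l.tmp d) (l.tmp d) (l.tmp (d + 1)) with hr
  obtain ⟨ρ₁, h1, h2, h3, h4⟩ := hp (.seq q r :: K) ρ o hρ hb
  obtain ⟨ρ₂, h5, h6, h7, h8⟩ := hq (r :: K) ρ₁ o
    (fun x => (h1.val x).trans (hρ x)) h3
  have hy : ρ₂ (l.tmp d) = y := by
    rw [h5 _ fun i hi hi' h => ?_, h2]
    have := l.tmp_inj d (by omega) i hi' h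
    omega
  refine ⟨Function.update ρ₂ (l.tmp d) w, ?_, by simp, h7.update _ hw, ?_⟩
  · exact (h1.trans h5 (by omega)).update le_rfl (by omega) w
  · have hlast : Steps M 1 ⟨r :: K, ρ₂, o⟩ ⟨K, Function.update ρ₂ (l.tmp d) w, o⟩ :=
      Steps.single (hf K ρ₂ o hy h6) (h7.update _ hw)
    have hmid : Steps M (1 + (t' + 1)) ⟨.seq q r :: K, ρ₁, o⟩
        ⟨K, Function.update ρ₂ (l.tmp d) w, o⟩ :=
      (Steps.single (c' := ⟨q :: r :: K, ρ₁, o⟩) rfl h3).trans (h8.trans hlast)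
    have hfirst : Steps M (1 + t) ⟨.seq p (.seq q r) :: K, ρ, o⟩ ⟨.seq q r :: K, ρ₁, o⟩ :=
      (Steps.single (c' := ⟨p :: .seq q r :: K, ρ, o⟩) rfl hb).trans h4
    exact hfirst.trans_le hmid (by omega)

theorem Expr.evaluates_compile (l : Layout V D R) (M M' : ℕ) (hM : 2 ≤ M) (σ : V → ℤ)
    (hσ : ∀ x, (σ x).natAbs ≤ M) (e : Expr V) (d : ℕ) (hd : d + e.depth ≤ D)
    (hM' : M ^ e.size ≤ M') :
    Evaluates l M' (e.compile l d : Prog T R) d e.cost σ (e.eval σ) := by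
  have hval : (e.eval σ).natAbs ≤ M' := (e.natAbs_eval_le σ M hM hσ).trans hM'
  have hleft : ∀ a b : ℕ, M ^ (a + b) ≤ M' → M ^ a ≤ M' := fun a b h =>
    (Nat.pow_le_pow_right (by omega) (by omega)).trans h
  have hright : ∀ a b : ℕ, M ^ (a + b) ≤ M' → M ^ b ≤ M' := fun a b h =>
    (Nat.pow_le_pow_right (by omega) (by omega)).trans h
  induction e generalizing d with
  | var x =>
    intro K ρ o hρ hb
    have hs : SameVars l d ρ ρ := fun _ _ => rfl
    refine ⟨Function.update ρ (l.tmp d) (ρ (l.val x)), ?_, by simp [hρ, eval],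
      hb.update _ (hb _), steps_move _ _ (l.val_ne_tmp x d) K ρ o hb⟩
    exact hs.update le_rfl (by simp only [depth] at hd; omega) _
  | const z =>
    intro K ρ o hρ hb
    have hs : SameVars l d ρ ρ := fun _ _ => rfl
    exact ⟨Function.update ρ (l.tmp d) z, hs.update le_rfl (by simp only [depth] at hd; omega) _,
      by simp [eval], hb.update _ hval, Steps.single rfl (hb.update _ hval)⟩
  | add a b iha ihb =>
    have hb1 := b.one_le_depth
    simp only [depth] at hd
    simp only [size] at hM'
    exact evaluates_binary l M' _ _ d _ _ σ _ _ _ .add (by omega)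
      (iha d (by omega) (hleft _ _ hM') ((a.natAbs_eval_le σ M hM hσ).trans (hleft _ _ hM')))
      (ihb (d + 1) (by omega) (hright _ _ hM')
        ((b.natAbs_eval_le σ M hM hσ).trans (hright _ _ hM'))) hval
      (by intro K ρ o h1 h2; simp [step, h1, h2, eval])
  | sub a b iha ihb =>
    have hb1 := b.one_le_depth
    simp only [depth] at hd
    simp only [size] at hM'
    exact evaluates_binary l M' _ _ d _ _ σ _ _ _ .sub (by omega)
      (iha d (by omega) (hleft _ _ hM') ((a.natAbs_eval_le σ M hM hσ).trans (hleft _ _ hM')))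
      (ihb (d + 1) (by omega) (hright _ _ hM')
        ((b.natAbs_eval_le σ M hM hσ).trans (hright _ _ hM'))) hval
      (by intro K ρ o h1 h2; simp [step, h1, h2, eval])
  | mul a b iha ihb =>
    have hb1 := b.one_le_depth
    simp only [depth] at hd
    simp only [size] at hM'
    exact evaluates_binary l M' _ _ d _ _ σ _ _ _ .mul (by omega)
      (iha d (by omega) (hleft _ _ hM') ((a.natAbs_eval_le σ M hM hσ).trans (hleft _ _ hM')))
      (ihb (d + 1) (by omega) (hright _ _ hM')
        ((b.natAbs_eval_le σ M hM hσ).trans (hright _ _ hM'))) hval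
      (by intro K ρ o h1 h2; simp [step, h1, h2, eval])
  | div a b iha ihb =>
    have hb1 := b.one_le_depth
    simp only [depth] at hd
    simp only [size] at hM'
    exact evaluates_binary l M' _ _ d _ _ σ _ _ _ .div (by omega)
      (iha d (by omega) (hleft _ _ hM') ((a.natAbs_eval_le σ M hM hσ).trans (hleft _ _ hM')))
      (ihb (d + 1) (by omega) (hright _ _ hM')
        ((b.natAbs_eval_le σ M hM hσ).trans (hright _ _ hM'))) hval
      (by intro K ρ o h1 h2; simp [step, h1, h2, eval])
  | ite c a b ihc iha ihb =>
    simp only [depth] at hd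
    simp only [size] at hM'
    have hc' : M ^ c.size ≤ M' := hleft _ _ (hleft _ _ hM')
    have ha' : M ^ a.size ≤ M' := hright _ _ (hleft _ _ hM')
    have hb' : M ^ b.size ≤ M' := hright _ _ hM'
    intro K ρ o hρ hb
    obtain ⟨ρ₁, h1, h2, h3, h4⟩ := ihc d (by omega) hc' ((c.natAbs_eval_le σ M hM hσ).trans hc')
      (.ifPos (l.tmp d) (a.compile l d) (b.compile l d) :: K) ρ o hρ hb
    have hρ₁ : ∀ x, ρ₁ (l.val x) = σ x := fun x => (h1.val x).trans (hρ x)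
    have hfirst : Steps M' (1 + c.cost) ⟨(ite c a b).compile l d :: K, ρ, o⟩ ⟨_, ρ₁, o⟩ :=
      (Steps.single (c' := ⟨c.compile l d :: .ifPos (l.tmp d) (a.compile l d) (b.compile l d) :: K,
        ρ, o⟩) rfl hb).trans h4
    have hif : step ⟨.ifPos (l.tmp d) (a.compile l d) (b.compile l d) :: K, ρ₁, o⟩ =
        PMF.pure (⟨(if 0 < c.eval σ then a.compile l d else b.compile l d) :: K, ρ₁, o⟩ :
          Config T R) := by simp [step, h2]
    simp only [eval]
    split_ifs at hif ⊢ with hpos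
    · obtain ⟨ρ₂, h5, h6, h7, h8⟩ := iha d (by omega) ha'
        ((a.natAbs_eval_le σ M hM hσ).trans ha') K ρ₁ o hρ₁ h3
      exact ⟨ρ₂, h1.trans h5 le_rfl, h6, h7, hfirst.trans_le ((Steps.single hif h3).trans h8)
        (by simp only [cost]; omega)⟩
    · obtain ⟨ρ₂, h5, h6, h7, h8⟩ := ihb d (by omega) hb'
        ((b.natAbs_eval_le σ M hM hσ).trans hb') K ρ₁ o hρ₁ h3
      exact ⟨ρ₂, h1.trans h5 le_rfl, h6, h7, hfirst.trans_le ((Steps.single hif h3).trans h8)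
        (by simp only [cost]; omega)⟩

end HalfPlane

/-! ### Structured commands and their compilation -/

namespace HalfPlane

/-- Structured commands over the variables `V` with output alphabet `T`. -/
inductive Cmd (T V : Type) : Type
  | skip : Cmd T V
  /-- simultaneous assignment of all variables -/
  | upd (f : V → Expr V) : Cmd T V
  /-- write the letter of the list whose index is the value of the expression -/
  | emit (ts : List T) (e : Expr V) : Cmd T V
  | seq (c d : Cmd T V) : Cmd T V
  | ite (e : Expr V) (c d : Cmd T V) : Cmd T V
  | loop (e : Expr V) (c : Cmd T V) : Cmd T V

/-- `Runs M c σ σ' o t`: the command `c`, started with the values `σ`, ends with the values `σ'`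
after at most `t` steps and writes `o`; the assigned values are bounded by `M`. -/
inductive Runs {T V : Type} (M : ℕ) : Cmd T V → (V → ℤ) → (V → ℤ) → List T → ℕ → Prop
  | skip (σ : V → ℤ) (t : ℕ) : Runs M .skip σ σ [] (t + 1)
  | upd (f : V → Expr V) (σ σ' : V → ℤ) (t : ℕ) (hf : ∀ x, (f x).eval σ = σ' x)
      (hb : Bdd M σ') : Runs M (.upd f) σ σ' [] (t + 1)
  | emit (ts : List T) (e : Expr V) (σ : V → ℤ) (i : ℕ) (a : T) (t : ℕ) (he : e.eval σ = i)
      (ha : ts[i]? = some a) : Runs M (.emit ts e) σ σ [a] (t + 1)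
  | seq (c d : Cmd T V) (σ σ₁ σ₂ : V → ℤ) (o₁ o₂ : List T) (t₁ t₂ t : ℕ)
      (h₁ : Runs M c σ σ₁ o₁ t₁) (h₂ : Runs M d σ₁ σ₂ o₂ t₂) (ht : t₁ + t₂ + 1 ≤ t) :
      Runs M (.seq c d) σ σ₂ (o₁ ++ o₂) t
  | iteTrue (e : Expr V) (c d : Cmd T V) (σ σ' : V → ℤ) (o : List T) (t : ℕ) (he : 0 < e.eval σ)
      (h : Runs M c σ σ' o t) : Runs M (.ite e c d) σ σ' o (t + 1)
  | iteFalse (e : Expr V) (c d : Cmd T V) (σ σ' : V → ℤ) (o : List T) (t : ℕ) (he : e.eval σ ≤ 0)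
      (h : Runs M d σ σ' o t) : Runs M (.ite e c d) σ σ' o (t + 1)
  | loopFalse (e : Expr V) (c : Cmd T V) (σ : V → ℤ) (t : ℕ) (he : e.eval σ ≤ 0) :
      Runs M (.loop e c) σ σ [] (t + 1)
  | loopTrue (e : Expr V) (c : Cmd T V) (σ σ₁ σ₂ : V → ℤ) (o₁ o₂ : List T) (t₁ t₂ t : ℕ)
      (he : 0 < e.eval σ) (h₁ : Runs M c σ σ₁ o₁ t₁) (h₂ : Runs M (.loop e c) σ₁ σ₂ o₂ t₂)
      (ht : t₁ + t₂ + 1 ≤ t) : Runs M (.loop e c) σ σ₂ (o₁ ++ o₂) t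

theorem Runs.bdd {T V : Type} {M : ℕ} {c : Cmd T V} {σ σ' : V → ℤ} {o : List T} {t : ℕ}
    (h : Runs M c σ σ' o t) (hb : Bdd M σ) : Bdd M σ' := by
  induction h with
  | skip | emit | loopFalse => exact hb
  | upd _ _ _ _ _ h => exact h
  | seq _ _ _ _ _ _ _ _ _ _ _ _ _ ih₁ ih₂ => exact ih₂ (ih₁ hb)
  | iteTrue _ _ _ _ _ _ _ _ _ ih => exact ih hb
  | iteFalse _ _ _ _ _ _ _ _ _ ih => exact ih hb
  | loopTrue _ _ _ _ _ _ _ _ _ _ _ _ _ _ ih₁ ih₂ => exact ih₂ (ih₁ hb)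

namespace Cmd

variable {T V : Type} [Fintype V] {D R : ℕ}

/-- A number of temporary registers sufficient for the execution. -/
def depth : Cmd T V → ℕ
  | skip => 0
  | upd f => ∑ x, (f x).depth
  | emit _ e => e.depth + 2
  | seq c d => c.depth + d.depth
  | ite e c d => e.depth + c.depth + d.depth
  | loop e c => e.depth + c.depth

/-- An exponent for the bound on the values computed during the execution. -/
def size : Cmd T V → ℕ
  | skip => 1
  | upd f => ∑ x, (f x).size + 1
  | emit _ e => e.size
  | seq c d => c.size + d.size
  | ite e c d => e.size + c.size + d.size
  | loop e c => e.size + c.size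

/-- The number of instructions for each step of the execution. -/
def cost : Cmd T V → ℕ
  | skip => 1
  | upd f => ∑ x, ((f x).cost + 9) + 3
  | emit ts e => e.cost + 5 * ts.length + 3
  | seq c d => c.cost + d.cost + 1
  | ite e c d => e.cost + c.cost + d.cost + 3
  | loop e c => e.cost + c.cost + 4

/-- The evaluation of the expressions `f x`, for `x` in a list, into the copies of the variables. -/
def compileEval (l : Layout V D R) (f : V → Expr V) : List V → Prog T R
  | [] => .skip
  | x :: xs => .seq ((f x).compile l 0) (.seq (.move (l.copy x) (l.tmp 0)) (compileEval l f xs))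

/-- The assignment of the copies to the variables in a list. -/
def compileCopy (l : Layout V D R) : List V → Prog T R
  | [] => .skip
  | x :: xs => .seq (.move (l.val x) (l.copy x)) (compileCopy l xs)

/-- The program that writes the letter whose index is in the first temporary register. -/
def compileEmit (l : Layout V D R) : List T → Prog T R
  | [] => .skip
  | a :: as => .ifPos (l.tmp 0) (.seq (.const (l.tmp 1) 1)
      (.seq (.sub (l.tmp 0) (l.tmp 0) (l.tmp 1)) (compileEmit l as))) (.emit a)

/-- The program of a command. -/
noncomputable def compile (l : Layout V D R) : Cmd T V → Prog T R
  | skip => .skip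
  | upd f => .seq (compileEval l f Finset.univ.toList) (compileCopy l Finset.univ.toList)
  | emit ts e => .seq (e.compile l 0) (compileEmit l ts)
  | seq c d => .seq (c.compile l) (d.compile l)
  | ite e c d => .seq (e.compile l 0) (.ifPos (l.tmp 0) (c.compile l) (d.compile l))
  | loop e c => .seq (e.compile l 0)
      (.whilePos (l.tmp 0) (.seq (c.compile l) (e.compile l 0)))

-- Simultaneous assignment needs the copies: all new values are computed into them while the
-- variables keep their old values, and only then are the variables overwritten.
omit [Fintype V] in
theorem steps_compileEval (l : Layout V D R) (f : V → Expr V) (M M' : ℕ) (hM : 2 ≤ M) (σ : V → ℤ)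
    (hσ : Bdd M σ) (xs : List V) (hD : ∀ x ∈ xs, (f x).depth ≤ D)
    (hM' : ∀ x ∈ xs, M ^ (f x).size ≤ M') (K : List (Prog T R)) (ρ : Fin R → ℤ) (o : List T)
    (hρ : ∀ x, ρ (l.val x) = σ x) (hb : Bdd M' ρ) :
    ∃ ρ', (∀ x, ρ' (l.val x) = σ x) ∧ (∀ x ∈ xs, ρ' (l.copy x) = (f x).eval σ) ∧
      (∀ x ∉ xs, ρ' (l.copy x) = ρ (l.copy x)) ∧ Bdd M' ρ' ∧
      Steps M' ((xs.map fun x => (f x).cost + 5).sum + 1)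
        ⟨compileEval l f xs :: K, ρ, o⟩ ⟨K, ρ', o⟩ := by
  induction xs generalizing ρ with
  | nil => exact ⟨ρ, hρ, by simp, by simp, hb, Steps.single rfl hb⟩
  | cons x xs ih =>
    set p : Prog T R := .move (l.copy x) (l.tmp 0)
    obtain ⟨ρ₁, h1, h2, h3, h4⟩ := (f x).evaluates_compile l M M' hM σ hσ 0
      (by simpa using hD x (by simp)) (hM' x (by simp))
      (.seq p (compileEval l f xs) :: K) ρ o hρ hb
    set ρ₂ := Function.update ρ₁ (l.copy x) (ρ₁ (l.tmp 0)) with hρ₂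
    have hb₂ : Bdd M' ρ₂ := h3.update _ (h3 _)
    have h5 : ∀ y, ρ₂ (l.val y) = σ y := by
      intro y
      rw [hρ₂, Function.update_of_ne (l.val_ne_copy y x), h1.val, hρ]
    have h6 : ∀ y ≠ x, ρ₂ (l.copy y) = ρ (l.copy y) := by
      intro y hy
      rw [hρ₂, Function.update_of_ne (fun h => hy (l.copy_inj h)),
        h1 _ fun i _ _ => l.copy_ne_tmp y i]
    have h7 : ρ₂ (l.copy x) = (f x).eval σ := by rw [hρ₂]; simpa using h2
    obtain ⟨ρ', g1, g2, g3, g4, g5⟩ := ih (fun y hy => hD y (by simp [hy]))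
      (fun y hy => hM' y (by simp [hy])) ρ₂ h5 hb₂
    refine ⟨ρ', g1, ?_, ?_, g4, ?_⟩
    · intro y hy
      by_cases hyx : y ∈ xs
      · exact g2 y hyx
      · have : y = x := by simpa [hyx] using hy
        subst this
        rw [g3 y hyx, h7]
    · intro y hy
      simp only [List.mem_cons, not_or] at hy
      rw [g3 y hy.2, h6 y hy.1]
    · have s1 : Steps M' (1 + (f x).cost) ⟨compileEval l f (x :: xs) :: K, ρ, o⟩
          ⟨.seq p (compileEval l f xs) :: K, ρ₁, o⟩ :=
        (Steps.single (c' := ⟨(f x).compile l 0 :: .seq p (compileEval l f xs) :: K, ρ, o⟩)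
          rfl hb).trans h4
      have s2 : Steps M' (1 + 3) ⟨.seq p (compileEval l f xs) :: K, ρ₁, o⟩
          ⟨compileEval l f xs :: K, ρ₂, o⟩ :=
        (Steps.single (c' := ⟨p :: compileEval l f xs :: K, ρ₁, o⟩) rfl h3).trans
          (steps_move _ _ (l.copy_ne_tmp x 0).symm _ _ _ h3)
      exact (s1.trans s2).trans_le g5 (by simp only [List.map_cons, List.sum_cons]; omega)

omit [Fintype V] in
theorem steps_compileCopy (l : Layout V D R) (M : ℕ) (τ : V → ℤ) (xs : List V)
    (K : List (Prog T R)) (ρ : Fin R → ℤ) (o : List T)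
    (hτ : ∀ x, ρ (l.copy x) = τ x) (hb : Bdd M ρ) :
    ∃ ρ', (∀ x, ρ' (l.copy x) = τ x) ∧ (∀ x ∈ xs, ρ' (l.val x) = τ x) ∧
      (∀ x ∉ xs, ρ' (l.val x) = ρ (l.val x)) ∧ Bdd M ρ' ∧
      Steps M (4 * xs.length + 1) ⟨compileCopy l xs :: K, ρ, o⟩ ⟨K, ρ', o⟩ := by
  induction xs generalizing ρ with
  | nil => exact ⟨ρ, hτ, by simp, by simp, hb, Steps.single rfl hb⟩
  | cons x xs ih =>
    set ρ₂ := Function.update ρ (l.val x) (ρ (l.copy x)) with hρ₂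
    have hb₂ : Bdd M ρ₂ := hb.update _ (hb _)
    obtain ⟨ρ', g1, g2, g3, g4, g5⟩ := ih ρ₂ (fun y => by
      rw [hρ₂, Function.update_of_ne (l.val_ne_copy x y).symm, hτ]) hb₂
    refine ⟨ρ', g1, ?_, ?_, g4, ?_⟩
    · intro y hy
      by_cases hyx : y ∈ xs
      · exact g2 y hyx
      · have : y = x := by simpa [hyx] using hy
        subst this
        rw [g3 y hyx, hρ₂, Function.update_self, hτ]
    · intro y hy
      simp only [List.mem_cons, not_or] at hy
      rw [g3 y hy.2, hρ₂, Function.update_of_ne fun h => hy.1 (l.val_inj h)]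
    · have s1 : Steps M (1 + 3) ⟨compileCopy l (x :: xs) :: K, ρ, o⟩
          ⟨compileCopy l xs :: K, ρ₂, o⟩ :=
        (Steps.single (c' := ⟨.move (l.val x) (l.copy x) :: compileCopy l xs :: K, ρ, o⟩)
          rfl hb).trans (steps_move _ _ (l.val_ne_copy x x).symm _ _ _ hb)
      exact s1.trans_le g5 (by simp only [List.length_cons]; omega)

-- The output instruction has a fixed letter, so the index is counted down along a chain of
-- conditionals with one branch for each letter.
omit [Fintype V] in
theorem steps_compileEmit (l : Layout V D R) (hD : 2 ≤ D) (M : ℕ) (hM : 1 ≤ M) (σ : V → ℤ)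
    (ts : List T) (i : ℕ) (a : T) (ha : ts[i]? = some a)
    (K : List (Prog T R)) (ρ : Fin R → ℤ) (o : List T) (hρ : ∀ x, ρ (l.val x) = σ x)
    (hi : ρ (l.tmp 0) = i) (hb : Bdd M ρ) :
    ∃ ρ', (∀ x, ρ' (l.val x) = σ x) ∧ Bdd M ρ' ∧
      Steps M (5 * ts.length + 1) ⟨compileEmit l ts :: K, ρ, o⟩ ⟨K, ρ', o ++ [a]⟩ := by
  induction ts generalizing i ρ with
  | nil => simp at ha
  | cons b ts ih =>
    cases i with
    | zero =>
      obtain rfl : b = a := by simpa using ha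
      refine ⟨ρ, hρ, hb, Steps.mono (t := 1 + 1) ?_ (by simp only [List.length_cons]; omega)⟩
      refine (Steps.single (c' := ⟨.emit b :: K, ρ, o⟩) ?_ hb).trans (Steps.single rfl hb)
      simp [step, compileEmit, hi]
    | succ i =>
      set ρ₁ := Function.update ρ (l.tmp 1) 1 with hρ₁
      have hb₁ : Bdd M ρ₁ := hb.update _ (by simpa using hM)
      set ρ₂ := Function.update ρ₁ (l.tmp 0) (i : ℤ) with hρ₂
      have hi0 := hb (l.tmp 0)
      rw [hi] at hi0
      rw [Int.natAbs_natCast] at hi0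
      have hi1 : (i : ℤ).natAbs ≤ M := by rw [Int.natAbs_natCast]; omega
      have hb₂ : Bdd M ρ₂ := hb₁.update _ hi1
      have h01 : l.tmp 0 ≠ l.tmp 1 := fun h => by
        have := l.tmp_inj 0 (by omega) 1 (by omega) h
        omega
      obtain ⟨ρ', g1, g2, g3⟩ := ih i (by simpa using ha) ρ₂ (fun x => by
        rw [hρ₂, Function.update_of_ne (l.val_ne_tmp x 0), hρ₁,
          Function.update_of_ne (l.val_ne_tmp x 1), hρ]) (by rw [hρ₂]; simp) hb₂
      refine ⟨ρ', g1, g2, Steps.mono (t := 4 + 1 + (5 * ts.length + 1)) ?_ ?_⟩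
      · refine Steps.trans ?_ g3
        refine Steps.head _ _ ⟨.seq (.const (l.tmp 1) 1)
          (.seq (.sub (l.tmp 0) (l.tmp 0) (l.tmp 1)) (compileEmit l ts)) :: K, ρ, o⟩ _ ?_ hb ?_
        · simp only [step, compileEmit, hi]
          rw [if_pos (by positivity)]
        refine Steps.head _ _ _ _ rfl hb ?_
        refine Steps.head _ _ _ _ rfl hb₁ ?_
        refine Steps.head _ _ _ _ rfl hb₁ ?_
        refine Steps.single ?_ hb₂
        simp [step, ρ₂, ρ₁, Function.update_of_ne h01, hi]
      · simp only [List.length_cons]; omega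

end Cmd

end HalfPlane

/-! ### Simulation of commands by compiled programs -/

namespace HalfPlane

variable {T V : Type} [Fintype V] {D R : ℕ}

/-- Each time unit of the command pays for at most `c.cost` instructions. The variables stay bounded
by `M`, and temporaries and copies by `M ^ c.size`, because every expression is evaluated from
values of variables. -/
theorem Runs.steps {M : ℕ} {c : Cmd T V} {σ σ' : V → ℤ} {o : List T} {t : ℕ}
    (h : Runs M c σ σ' o t) (l : Layout V D R) (κ M' : ℕ) (hM : 2 ≤ M) (hκ : c.cost ≤ κ)
    (hD : c.depth ≤ D) (hM' : M ^ c.size ≤ M') (hσ : Bdd M σ) (K : List (Prog T R))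
    (ρ : Fin R → ℤ) (out : List T) (hρ : ∀ x, ρ (l.val x) = σ x) (hb : Bdd M' ρ) :
    ∃ ρ', (∀ x, ρ' (l.val x) = σ' x) ∧ Bdd M' ρ' ∧
      Steps M' (κ * t) ⟨c.compile l :: K, ρ, out⟩ ⟨K, ρ', out ++ o⟩ := by
  have hpow : ∀ a b : ℕ, M ^ b ≤ M' → a ≤ b → M ^ a ≤ M' := fun a b hb hab =>
    (Nat.pow_le_pow_right (by omega) hab).trans hb
  induction h generalizing K ρ out with
  | skip σ t =>
    refine ⟨ρ, hρ, hb, ?_⟩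
    rw [List.append_nil]
    simp only [Cmd.cost] at hκ
    exact (Steps.single rfl hb).mono (by nlinarith)
  | upd f σ σ' t hf hb' =>
    simp only [Cmd.cost] at hκ
    simp only [Cmd.depth] at hD
    simp only [Cmd.size] at hM'
    have hle : ∀ (g : V → ℕ) x, g x ≤ ∑ x, g x := fun g x =>
      Finset.single_le_sum (f := g) (fun _ _ => Nat.zero_le _) (Finset.mem_univ x)
    obtain ⟨ρ₁, h1, h2, -, h4, h5⟩ := Cmd.steps_compileEval l f M M' hM σ hσ Finset.univ.toList
      (fun x _ => (hle (fun x => (f x).depth) x).trans hD)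
      (fun x _ => hpow _ _ hM' ((hle (fun x => (f x).size) x).trans (Nat.le_succ _)))
      (Cmd.compileCopy l Finset.univ.toList :: K) ρ out hρ hb
    obtain ⟨ρ₂, -, g2, -, g4, g5⟩ := Cmd.steps_compileCopy l M' σ' Finset.univ.toList K ρ₁ out
      (fun x => by rw [h2 x (by simp), hf]) h4
    refine ⟨ρ₂, fun x => g2 x (by simp), g4, ?_⟩
    rw [List.append_nil]
    have hfirst := Steps.single (M := M') (c := ⟨(Cmd.upd f).compile l :: K, ρ, out⟩)
      (c' := ⟨Cmd.compileEval l f Finset.univ.toList ::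
        Cmd.compileCopy l Finset.univ.toList :: K, ρ, out⟩) rfl hb
    refine (hfirst.trans h5).trans_le g5 (le_trans ?_ (Nat.le_mul_of_pos_right κ (Nat.succ_pos t)))
    refine le_trans ?_ hκ
    simp only [Finset.length_toList, Finset.sum_map_toList, Finset.sum_add_distrib,
      Finset.sum_const, smul_eq_mul, Finset.card_univ]
    omega
  | emit ts e σ i a t he ha =>
    simp only [Cmd.cost] at hκ
    simp only [Cmd.depth] at hD
    simp only [Cmd.size] at hM'
    obtain ⟨ρ₁, h1, h2, h3, h4⟩ := e.evaluates_compile l M M' hM σ hσ 0 (by omega) hM'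
      (Cmd.compileEmit l ts :: K) ρ out hρ hb
    have hM1 : 1 ≤ M' := (Nat.one_le_pow _ _ (by omega)).trans hM'
    obtain ⟨ρ₂, g1, g2, g3⟩ := Cmd.steps_compileEmit l (by omega) M' hM1 σ ts i a ha K ρ₁ out
      (fun x => (h1.val x).trans (hρ x)) (h2.trans he) h3
    refine ⟨ρ₂, g1, g2, ?_⟩
    have hfirst := Steps.single (M := M') (c := ⟨(Cmd.emit ts e).compile l :: K, ρ, out⟩)
      (c' := ⟨e.compile l 0 :: Cmd.compileEmit l ts :: K, ρ, out⟩) rfl hb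
    refine (hfirst.trans h4).trans_le g3 (le_trans ?_ (Nat.le_mul_of_pos_right κ (Nat.succ_pos t)))
    omega
  | seq c d σ σ₁ σ₂ o₁ o₂ t₁ t₂ t h₁ h₂ ht ih₁ ih₂ =>
    simp only [Cmd.cost] at hκ
    simp only [Cmd.depth] at hD
    simp only [Cmd.size] at hM'
    obtain ⟨ρ₁, g1, g2, g3⟩ := ih₁ (by omega) (by omega) (hpow _ _ hM' (by omega)) hσ
      (d.compile l :: K) ρ out hρ hb
    obtain ⟨ρ₂, g4, g5, g6⟩ := ih₂ (by omega) (by omega) (hpow _ _ hM' (by omega)) (h₁.bdd hσ)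
      K ρ₁ (out ++ o₁) g1 g2
    refine ⟨ρ₂, g4, g5, ?_⟩
    rw [← List.append_assoc]
    have hfirst := Steps.single (M := M') (c := ⟨(c.seq d).compile l :: K, ρ, out⟩)
      (c' := ⟨c.compile l :: d.compile l :: K, ρ, out⟩) rfl hb
    exact (hfirst.trans g3).trans_le g6 (by nlinarith)
  | iteTrue e c d σ σ' o t he h ih =>
    simp only [Cmd.cost] at hκ
    simp only [Cmd.depth] at hD
    simp only [Cmd.size] at hM'
    obtain ⟨ρ₁, h1, h2, h3, h4⟩ := e.evaluates_compile l M M' hM σ hσ 0 (by omega)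
      (hpow _ _ hM' (by omega)) (.ifPos (l.tmp 0) (c.compile l) (d.compile l) :: K) ρ out hρ hb
    obtain ⟨ρ₂, g4, g5, g6⟩ := ih (by omega) (by omega) (hpow _ _ hM' (by omega)) hσ
      K ρ₁ out (fun x => (h1.val x).trans (hρ x)) h3
    refine ⟨ρ₂, g4, g5, ?_⟩
    have hfirst := Steps.single (M := M') (c := ⟨(Cmd.ite e c d).compile l :: K, ρ, out⟩)
      (c' := ⟨e.compile l 0 :: .ifPos (l.tmp 0) (c.compile l) (d.compile l) :: K, ρ, out⟩) rfl hb
    have hif := Steps.single (M := M')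
      (c := ⟨.ifPos (l.tmp 0) (c.compile l) (d.compile l) :: K, ρ₁, out⟩)
      (c' := ⟨c.compile l :: K, ρ₁, out⟩) (by simp [step, h2, he]) h3
    exact ((hfirst.trans h4).trans hif).trans_le g6 (by nlinarith)
  | iteFalse e c d σ σ' o t he h ih =>
    simp only [Cmd.cost] at hκ
    simp only [Cmd.depth] at hD
    simp only [Cmd.size] at hM'
    obtain ⟨ρ₁, h1, h2, h3, h4⟩ := e.evaluates_compile l M M' hM σ hσ 0 (by omega)
      (hpow _ _ hM' (by omega)) (.ifPos (l.tmp 0) (c.compile l) (d.compile l) :: K) ρ out hρ hb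
    obtain ⟨ρ₂, g4, g5, g6⟩ := ih (by omega) (by omega) (hpow _ _ hM' (by omega)) hσ
      K ρ₁ out (fun x => (h1.val x).trans (hρ x)) h3
    refine ⟨ρ₂, g4, g5, ?_⟩
    have hfirst := Steps.single (M := M') (c := ⟨(Cmd.ite e c d).compile l :: K, ρ, out⟩)
      (c' := ⟨e.compile l 0 :: .ifPos (l.tmp 0) (c.compile l) (d.compile l) :: K, ρ, out⟩) rfl hb
    have hif := Steps.single (M := M')
      (c := ⟨.ifPos (l.tmp 0) (c.compile l) (d.compile l) :: K, ρ₁, out⟩)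
      (c' := ⟨d.compile l :: K, ρ₁, out⟩) (by simp [step, h2, not_lt.mpr he]) h3
    exact ((hfirst.trans h4).trans hif).trans_le g6 (by nlinarith)
  | loopFalse e c σ t he =>
    simp only [Cmd.cost] at hκ
    simp only [Cmd.depth] at hD
    simp only [Cmd.size] at hM'
    set W : Prog T R := .whilePos (l.tmp 0) (.seq (c.compile l) (e.compile l 0)) with hW
    obtain ⟨ρ₁, h1, h2, h3, h4⟩ := e.evaluates_compile l M M' hM σ hσ 0 (by omega)
      (hpow _ _ hM' (by omega)) (W :: K) ρ out hρ hb
    refine ⟨ρ₁, fun x => (h1.val x).trans (hρ x), h3, ?_⟩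
    rw [List.append_nil]
    have hfirst := Steps.single (M := M') (c := ⟨(Cmd.loop e c).compile l :: K, ρ, out⟩)
      (c' := ⟨e.compile l 0 :: W :: K, ρ, out⟩) rfl hb
    have hw := Steps.single (M := M') (c := ⟨W :: K, ρ₁, out⟩)
      (c' := ⟨K, ρ₁, out⟩) (by simp [step, W, h2, not_lt.mpr he]) h3
    exact (hfirst.trans h4).trans_le hw (by nlinarith)
  | loopTrue e c σ σ₁ σ₂ o₁ o₂ t₁ t₂ t he h₁ h₂ ht ih₁ ih₂ =>
    simp only [Cmd.cost] at hκ
    simp only [Cmd.depth] at hD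
    simp only [Cmd.size] at hM'
    set W : Prog T R := .whilePos (l.tmp 0) (.seq (c.compile l) (e.compile l 0)) with hW
    obtain ⟨ρ₁, h1, h2, h3, h4⟩ := e.evaluates_compile l M M' hM σ hσ 0 (by omega)
      (hpow _ _ hM' (by omega)) (W :: K) ρ out hρ hb
    obtain ⟨ρ₂, g1, g2, g3⟩ := ih₁ (by omega) (by omega) (hpow _ _ hM' (by omega)) hσ
      (e.compile l 0 :: W :: K) ρ₁ out (fun x => (h1.val x).trans (hρ x)) h3
    obtain ⟨ρ₃, g4, g5, g6⟩ := ih₂ hκ hD hM' (h₁.bdd hσ) K ρ₂ (out ++ o₁) g1 g2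
    refine ⟨ρ₃, g4, g5, ?_⟩
    rw [← List.append_assoc]
    have hfirst := Steps.single (M := M') (c := ⟨(Cmd.loop e c).compile l :: K, ρ, out⟩)
      (c' := ⟨e.compile l 0 :: W :: K, ρ, out⟩) rfl hb
    have hw := Steps.single (M := M') (c := ⟨W :: K, ρ₁, out⟩)
      (c' := ⟨.seq (c.compile l) (e.compile l 0) :: W :: K, ρ₁, out⟩)
      (by simp [step, W, h2, he]) h3
    have hs := Steps.single (M := M')
      (c := ⟨.seq (c.compile l) (e.compile l 0) :: W :: K, ρ₁, out⟩)
      (c' := ⟨c.compile l :: e.compile l 0 :: W :: K, ρ₁, out⟩) rfl h3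
    -- The compiled loop evaluates its condition before the `while` and again at the end of each
    -- round, so a round leads to the evaluation. The induction hypothesis starts one step earlier,
    -- at the unfolding of the sequence; that step is removed.
    obtain ⟨s, hs', hrest⟩ := g6.tail_of_ne (c₁ := ⟨e.compile l 0 :: W :: K, ρ₂, out ++ o₁⟩)
      (by
        intro h
        have := congrArg (fun c => c.todo.length) h
        simp at this) rfl
    have hall := (((hfirst.trans h4).trans (hw.trans hs)).trans g3).trans hrest
    refine hall.mono ?_
    have h6 : κ * (t₁ + t₂ + 1) ≤ κ * t := Nat.mul_le_mul_left _ ht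
    nlinarith

end HalfPlane

namespace HalfPlane

/-! ### Enumeration of the words of a binary grammar -/

/-- The concatenations of the words of two lists, in one of the two orders. -/
def concatWords {T : Type} (left : Bool) (us vs : List (List T)) : List (List T) :=
  us.flatMap fun u => vs.map fun v => if left then u ++ v else v ++ u

theorem length_concatWords {T : Type} (left : Bool) (us vs : List (List T)) :
    (concatWords left us vs).length = us.length * vs.length := by
  simp [concatWords, List.length_flatMap]

/-- Ranks in the product are pairs of ranks in lexicographic order, the second varying fastest,
whatever the order of concatenation. Division with remainder by `vs.length` therefore recovers the
two ranks. -/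
theorem getElem?_concatWords {T : Type} (left : Bool) (us vs : List (List T)) (r : ℕ) (w : List T)
    (h : (concatWords left us vs)[r]? = some w) :
    ∃ u v, us[r / vs.length]? = some u ∧ vs[r % vs.length]? = some v ∧
      w = if left then u ++ v else v ++ u := by
  induction us generalizing r with
  | nil => simp [concatWords] at h
  | cons x us ih =>
    have hc : concatWords left (x :: us) vs =
      (vs.map fun v => if left then x ++ v else v ++ x) ++ concatWords left us vs := rfl
    rw [hc] at h
    rcases lt_or_ge r vs.length with hr | hr
    · rw [List.getElem?_append_left (by simpa using hr), List.getElem?_map,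
        Option.map_eq_some_iff] at h
      obtain ⟨v, hv, rfl⟩ := h
      exact ⟨x, v, by rw [Nat.div_eq_of_lt hr]; rfl, by rwa [Nat.mod_eq_of_lt hr], rfl⟩
    · rw [List.getElem?_append_right (by simpa using hr), List.length_map] at h
      obtain ⟨u, v, hu, hv, hw⟩ := ih _ h
      have hpos : 0 < vs.length := by
        rcases Nat.eq_zero_or_pos vs.length with h0 | h0
        · rw [List.length_eq_zero_iff] at h0
          subst h0; simp at hv
        · exact h0
      refine ⟨u, v, ?_, ?_, hw⟩
      · rw [Nat.div_eq_sub_div hpos hr, List.getElem?_cons_succ]; exact hu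
      · rw [Nat.mod_eq_sub_mod hr]; exact hv

theorem mem_concatWords {T : Type} {left : Bool} {us vs : List (List T)} {w : List T} :
    w ∈ concatWords left us vs ↔
      ∃ u ∈ us, ∃ v ∈ vs, w = if left then u ++ v else v ++ u := by
  simp [concatWords, eq_comm]

/-- A grammar with rules `X → a` and `X → Y Z`. -/
structure BinaryGrammar (T I : Type) : Type where
  letters : I → List T
  rules : Finset (I × I × I)

/-- The application of a rule `head → small big`, if `left`, or `head → big small`, if not `left`,
where the word derived from `small` is not longer than the word derived from `big`. -/
structure Choice (I : Type) : Type where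
  head : I
  small : I
  big : I
  left : Bool

namespace BinaryGrammar

variable {T I : Type} [DecidableEq I] (g : BinaryGrammar T I)

/-- All choices. -/
noncomputable def choices : List (Choice I) :=
  (g.rules.toList.map fun ρ => ⟨ρ.1, ρ.2.1, ρ.2.2, true⟩) ++
    g.rules.toList.map fun ρ => ⟨ρ.1, ρ.2.2, ρ.2.1, false⟩

/-- The words of length `s` derived from `X`. -/
noncomputable def words (X : I) (s : ℕ) : List (List T) :=
  if s = 1 then (g.letters X).map fun a => [a] else
    (List.range' 1 (s / 2)).flatMap fun j => g.choices.flatMap fun ω =>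
      if _h : (ω.head = X ∧ (ω.left = true ∨ 2 * j < s)) ∧ 0 < j ∧ j < s then
        concatWords ω.left (words ω.small j) (words ω.big (s - j)) else []
  termination_by s

/-- The words of length `s` derived from `X` by a given choice for a short part of length `j`. -/
noncomputable def choiceWords (X : I) (s j : ℕ) (ω : Choice I) : List (List T) :=
  if ω.head = X ∧ (ω.left = true ∨ 2 * j < s) then
    concatWords ω.left (g.words ω.small j) (g.words ω.big (s - j)) else []

/-- The words of length `s` derived from `X` whose short part has length at least `j`. -/
noncomputable def wordsFrom (X : I) (s j : ℕ) : List (List T) :=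
  (List.range' j (s / 2 + 1 - j)).flatMap fun j => g.choices.flatMap (g.choiceWords X s j)

/-- The number of words of length `s` derived from `X`. -/
noncomputable def count (X : I) (s : ℕ) : ℕ := (g.words X s).length

theorem words_one (X : I) : g.words X 1 = (g.letters X).map fun a => [a] := by
  rw [words]; simp

theorem words_eq_wordsFrom (X : I) (s : ℕ) (hs : s ≠ 1) : g.words X s = g.wordsFrom X s 1 := by
  rw [words, if_neg hs, wordsFrom, Nat.add_sub_cancel]
  refine List.flatMap_congr fun j hj => List.flatMap_congr fun ω _ => ?_
  have hj' : 1 ≤ j ∧ j < 1 + s / 2 := List.mem_range'_1.mp hj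
  have : 0 < j ∧ j < s := by omega
  simp [choiceWords, this]

theorem words_zero (X : I) : g.words X 0 = [] := by
  rw [words_eq_wordsFrom _ _ _ (by norm_num)]; simp [wordsFrom]

theorem count_zero (X : I) : g.count X 0 = 0 := by simp [count, words_zero]

theorem wordsFrom_of_le (X : I) (s j : ℕ) (hj : j ≤ s / 2) :
    g.wordsFrom X s j = g.choices.flatMap (g.choiceWords X s j) ++ g.wordsFrom X s (j + 1) := by
  rw [wordsFrom, show s / 2 + 1 - j = (s / 2 + 1 - (j + 1)) + 1 by omega, List.range'_succ,
    List.flatMap_cons, wordsFrom]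

theorem wordsFrom_of_lt (X : I) (s j : ℕ) (hj : s / 2 < j) : g.wordsFrom X s j = [] := by
  rw [wordsFrom, show s / 2 + 1 - j = 0 by omega]; simp

/-- Each `i` with `0 < i < s` is either `j` or `s - j` for the shorter length `j`. The condition `2
* j < s` counts the middle term once. -/
theorem sum_split (s : ℕ) (f : ℕ → ℕ) (h0 : f 0 = 0) (hs : f s = 0) :
    ((List.range' 1 (s / 2)).map fun j => f j + if 2 * j < s then f (s - j) else 0).sum =
      ∑ i ∈ Finset.range (s + 1), f i := by
  have hl : ∀ (h : ℕ → ℕ) (m a : ℕ), ((List.range' a m).map h).sum =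
      ∑ j ∈ Finset.Ico a (a + m), h j := by
    intro h m
    induction m with
    | zero => simp
    | succ m ih =>
      intro a
      rw [List.range'_succ, List.map_cons, List.sum_cons, ih,
        Finset.sum_eq_sum_Ico_succ_bot (show a < a + (m + 1) by omega) h,
        show a + 1 + m = a + (m + 1) by ring]
  rw [hl, Finset.sum_add_distrib, ← Finset.sum_filter]
  have h1 : ∑ j ∈ (Finset.Ico 1 (1 + s / 2)).filter (fun j => 2 * j < s), f (s - j) =
      ∑ i ∈ Finset.Ico (1 + s / 2) s, f i := by
    refine Finset.sum_nbij' (fun j => s - j) (fun j => s - j) ?_ ?_ ?_ ?_ ?_ <;>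
      simp only [Finset.mem_filter, Finset.mem_Ico, implies_true] <;> omega
  rw [h1, Finset.sum_range_succ, hs, add_zero]
  rcases Nat.eq_zero_or_pos s with rfl | hpos
  · simp
  · rw [Finset.sum_Ico_consecutive _ (by omega) (by omega), Finset.range_eq_Ico,
      Finset.sum_eq_sum_Ico_succ_bot hpos, h0, zero_add]

/-- The enumeration by the shorter factor is regrouped by the length of the left factor, which turns
the counts into a convolution. -/
theorem count_eq_sum [Fintype I] (X : I) (s : ℕ) (hs : s ≠ 1) :
    g.count X s = ∑ Y, ∑ Z, if (X, Y, Z) ∈ g.rules then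
      ∑ i ∈ Finset.range (s + 1), g.count Y i * g.count Z (s - i) else 0 := by
  set f : ℕ → ℕ := fun i => ∑ ρ ∈ g.rules, if ρ.1 = X then
    g.count ρ.2.1 i * g.count ρ.2.2 (s - i) else 0 with hf
  have h1 : g.count X s = ∑ i ∈ Finset.range (s + 1), f i := by
    rw [← sum_split s f (by simp [hf, count_zero]) (by simp [hf, count_zero]), count,
      g.words_eq_wordsFrom X s hs, wordsFrom, List.length_flatMap, Nat.add_sub_cancel]
    congr 1
    refine List.map_congr_left fun j hj => ?_
    have hj' : 1 ≤ j ∧ j < 1 + s / 2 := List.mem_range'_1.mp hj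
    rw [List.length_flatMap]
    have h2 : ∀ ω : Choice I, (g.choiceWords X s j ω).length =
        if ω.head = X ∧ (ω.left = true ∨ 2 * j < s) then
          g.count ω.small j * g.count ω.big (s - j) else 0 := by
      intro ω
      rw [choiceWords]
      split_ifs
      · rw [length_concatWords]; rfl
      · rfl
    simp only [h2, choices, List.map_append, List.sum_append, List.map_map, hf]
    congr 1
    · rw [← Finset.sum_map_toList]
      simp [Function.comp_def]
    · by_cases h3 : 2 * j < s
      · rw [if_pos h3, ← Finset.sum_map_toList]
        have h4 : s - (s - j) = j := by omega
        simp only [Function.comp_def, h3, h4, or_true, and_true]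
        simp only [mul_comm]
      · rw [if_neg h3]
        simp [Function.comp_def, h3]
  rw [h1, hf, Finset.sum_comm]
  have h5 : ∀ ρ : I × I × I, (∑ i ∈ Finset.range (s + 1), if ρ.1 = X then
      g.count ρ.2.1 i * g.count ρ.2.2 (s - i) else 0) = if ρ.1 = X then
      ∑ i ∈ Finset.range (s + 1), g.count ρ.2.1 i * g.count ρ.2.2 (s - i) else 0 := by
    intro ρ; split_ifs <;> simp
  simp only [h5]
  rw [← Finset.sum_filter, ← Finset.sum_product' Finset.univ Finset.univ fun Y Z =>
    if (X, Y, Z) ∈ g.rules then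
      ∑ i ∈ Finset.range (s + 1), g.count Y i * g.count Z (s - i) else 0, ← Finset.sum_filter]
  refine Finset.sum_nbij' (fun ρ => ρ.2) (fun p => (X, p)) ?_ ?_ ?_ ?_ ?_
  · rintro ⟨X', Y, Z⟩; simp only [Finset.mem_filter]; rintro ⟨h, rfl⟩; simpa using h
  · rintro ⟨Y, Z⟩; simp
  · rintro ⟨X', Y, Z⟩; simp only [Finset.mem_filter]; rintro ⟨h, rfl⟩; rfl
  · rintro ⟨Y, Z⟩ _; rfl
  · rintro ⟨X', Y, Z⟩ _; rfl

/-- The generating series of the numbers of words solve a quadratic system. -/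
theorem generatingSeries_eq [Fintype I] (X : I) :
    PowerSeries.mk (fun n => ((g.count X n : ℤ) : ℚ)) =
      ((g.letters X).length : ℚ) • PowerSeries.X + ∑ Y, ∑ Z,
        (if (X, Y, Z) ∈ g.rules then (1 : ℚ) else 0) •
          (PowerSeries.mk (fun n => ((g.count Y n : ℤ) : ℚ)) *
            PowerSeries.mk (fun n => ((g.count Z n : ℤ) : ℚ))) := by
  ext s
  simp only [PowerSeries.coeff_mk, map_add, map_sum, map_smul, PowerSeries.coeff_mul,
    PowerSeries.coeff_X, smul_eq_mul]
  have h1 : ∀ Y Z, ∑ p ∈ Finset.HasAntidiagonal.antidiagonal s,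
      (((g.count Y p.1 : ℤ) : ℚ) * ((g.count Z p.2 : ℤ) : ℚ)) =
      ((∑ i ∈ Finset.range (s + 1), g.count Y i * g.count Z (s - i) : ℕ) : ℚ) := by
    intro Y Z
    rw [Finset.Nat.sum_antidiagonal_eq_sum_range_succ
      (fun i j => ((g.count Y i : ℤ) : ℚ) * ((g.count Z j : ℤ) : ℚ))]
    push_cast; rfl
  simp only [h1]
  by_cases hs : s = 1
  · subst hs
    simp [count, words_one, Finset.sum_range_succ, words_zero]
  · rw [if_neg hs, g.count_eq_sum X s hs]
    push_cast
    simp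

theorem exists_isPRecursive_count [Fintype I] :
    ∃ r n₀, ∀ X, IsPRecursive r n₀ fun n => (g.count X n : ℤ) :=
  exists_isPRecursive_of_quadratic _ _ _ (fun X => by simp [count_zero]) g.generatingSeries_eq

section Language

variable (L : I → Set (List T))

/-- The sets `L X` are generated by the grammar without ambiguity. -/
structure Generates : Prop where
  nodup : ∀ X, (g.letters X).Nodup
  nil : ∀ X, [] ∉ L X
  single : ∀ X a, [a] ∈ L X ↔ a ∈ g.letters X
  rule : ∀ X Y Z, (X, Y, Z) ∈ g.rules → ∀ u ∈ L Y, ∀ v ∈ L Z, u ++ v ∈ L X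
  split : ∀ X, ∀ w ∈ L X, 2 ≤ w.length →
    ∃ Y Z, (X, Y, Z) ∈ g.rules ∧ ∃ u ∈ L Y, ∃ v ∈ L Z, w = u ++ v
  unique : ∀ X Y Z Y' Z', (X, Y, Z) ∈ g.rules → (X, Y', Z') ∈ g.rules →
    ∀ u ∈ L Y, ∀ v ∈ L Z, ∀ u' ∈ L Y', ∀ v' ∈ L Z', u ++ v = u' ++ v' → u = u' ∧ Y = Y' ∧ Z = Z'

variable {g L}

omit [DecidableEq I] in
theorem nodup_choices : g.choices.Nodup := by
  refine List.Nodup.append ?_ ?_ ?_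
  · refine List.Nodup.map ?_ g.rules.nodup_toList
    rintro ⟨a, b, c⟩ ⟨a', b', c'⟩ h
    simpa using h
  · refine List.Nodup.map ?_ g.rules.nodup_toList
    rintro ⟨a, b, c⟩ ⟨a', b', c'⟩ h
    simp only [Choice.mk.injEq, and_true] at h
    obtain ⟨rfl, rfl, rfl⟩ := h
    rfl
  · intro x hx hx'
    simp only [List.mem_map] at hx hx'
    obtain ⟨_, _, rfl⟩ := hx
    obtain ⟨_, _, h⟩ := hx'
    simp at h

omit [DecidableEq I] in
theorem mem_choices {ω : Choice I} : ω ∈ g.choices ↔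
    (ω.left = true ∧ (ω.head, ω.small, ω.big) ∈ g.rules) ∨
      (ω.left = false ∧ (ω.head, ω.big, ω.small) ∈ g.rules) := by
  obtain ⟨h, s, b, d⟩ := ω
  cases d <;> simp [choices]

/-- Strong induction on the length: unambiguity makes the blocks of the enumeration disjoint, and
the existence of a split makes them exhaustive. -/
theorem Generates.words_spec (hg : g.Generates L) (s : ℕ) :
    ∀ X, (g.words X s).Nodup ∧ ∀ w, w ∈ g.words X s ↔ w ∈ L X ∧ w.length = s := by
  induction s using Nat.strong_induction_on with
  | _ s ih =>
    intro X
    rcases eq_or_ne s 1 with rfl | hs1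
    · rw [words_one]
      refine ⟨(hg.nodup X).map fun a b h => by simpa using h, fun w => ?_⟩
      simp only [List.mem_map, List.length_eq_one_iff]
      constructor
      · rintro ⟨a, ha, rfl⟩; exact ⟨(hg.single X a).mpr ha, a, rfl⟩
      · rintro ⟨h, a, rfl⟩; exact ⟨a, (hg.single X a).mp h, rfl⟩
    rcases eq_or_ne s 0 with rfl | hs0
    · rw [words_zero]
      refine ⟨List.nodup_nil, fun w => ?_⟩
      simp only [List.not_mem_nil, false_iff, List.length_eq_zero_iff, not_and]
      rintro h rfl; exact hg.nil X h
    have hmem : ∀ j, 1 ≤ j → j ≤ s / 2 → ∀ ω ∈ g.choices, ∀ w ∈ g.choiceWords X s j ω,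
        (ω.left = true ∨ 2 * j < s) ∧ ∃ u v Y Z, (X, Y, Z) ∈ g.rules ∧ u ∈ L Y ∧ v ∈ L Z ∧
          w = u ++ v ∧ w.length = s ∧
          ω = ⟨X, if ω.left then Y else Z, if ω.left then Z else Y, ω.left⟩ ∧
          u.length = if ω.left then j else s - j := by
      intro j hj1 hj2 ω hω w hw
      rw [choiceWords] at hw
      split_ifs at hw with hc
      · refine ⟨hc.2, ?_⟩
        obtain ⟨u, hu, v, hv, hw⟩ := mem_concatWords.mp hw
        obtain ⟨hu1, hu2⟩ := ((ih j (by omega) ω.small).2 u).mp hu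
        obtain ⟨hv1, hv2⟩ := ((ih (s - j) (by omega) ω.big).2 v).mp hv
        obtain ⟨hd, sm, bg, lf⟩ := ω
        obtain ⟨rfl, -⟩ := hc
        simp only at hu1 hv1 hw
        rcases mem_choices.mp hω with ⟨rfl, hr⟩ | ⟨rfl, hr⟩
        · refine ⟨u, v, sm, bg, hr, hu1, hv1, by simpa using hw, ?_, by simp, by simpa using hu2⟩
          rw [hw]; simp; omega
        · refine ⟨v, u, bg, sm, hr, hv1, hu1, by simpa using hw, ?_, by simp, by simpa using hv2⟩
          rw [hw]; simp; omega
      · simp at hw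
    -- The word determines its left factor. The length of this factor is `j ≤ s / 2` for a left
    -- choice, and `s - j > s / 2` for a right choice, where equal halves are excluded; so it
    -- determines the side and `j`.
    have huniq : ∀ j, 1 ≤ j → j ≤ s / 2 → ∀ ω ∈ g.choices, ∀ j', 1 ≤ j' → j' ≤ s / 2 →
        ∀ ω' ∈ g.choices, ∀ w ∈ g.choiceWords X s j ω, w ∈ g.choiceWords X s j' ω' →
        j = j' ∧ ω = ω' := by
      intro j h1 h2 ω hω j' h1' h2' ω' hω' w hw hw'
      obtain ⟨hd, u, v, Y, Z, hr, hu, hv, rfl, hlen, hωe, hl⟩ := hmem j h1 h2 ω hω w hw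
      obtain ⟨hd', u', v', Y', Z', hr', hu', hv', he, -, hωe', hl'⟩ :=
        hmem j' h1' h2' ω' hω' _ hw'
      obtain ⟨rfl, rfl, rfl⟩ := hg.unique X Y Z Y' Z' hr hr' u hu v hv u' hu' v' hv' he
      rw [hωe, hωe']
      rw [hl] at hl'
      cases hb : ω.left <;> cases hb' : ω'.left <;> simp [hb, hb'] at hd hd' hl' ⊢ <;> omega
    rw [g.words_eq_wordsFrom X s hs1, wordsFrom, Nat.add_sub_cancel]
    constructor
    · rw [List.nodup_flatMap]
      constructor
      · intro j hj
        have hj' : 1 ≤ j ∧ j < 1 + s / 2 := List.mem_range'_1.mp hj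
        rw [List.nodup_flatMap]
        constructor
        · intro ω hω
          rw [choiceWords]
          split_ifs with hc
          · rw [concatWords, List.nodup_flatMap]
            -- The short parts all have the same length, so concatenations can be cancelled.
            have hcanc : ∀ u ∈ g.words ω.small j, ∀ u' ∈ g.words ω.small j, ∀ v v',
                (if ω.left then u ++ v else v ++ u) = (if ω.left then u' ++ v' else v' ++ u') →
                u = u' ∧ v = v' := by
              intro u hu u' hu' v v' h
              have hlen : u.length = u'.length := by
                rw [(((ih j (by omega) _).2 u).mp hu).2, (((ih j (by omega) _).2 u').mp hu').2]
              split_ifs at h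
              · exact List.append_inj h hlen
              · exact (List.append_inj' h hlen).symm
            constructor
            · intro u hu
              refine List.Nodup.map_on ?_ (ih (s - j) (by omega) ω.big).1
              intro v _ v' _ h
              exact (hcanc u hu u hu v v' h).2
            · refine List.Nodup.pairwise_of_forall_ne (ih j (by omega) ω.small).1 ?_
              intro u hu u' hu' hne w hw hw'
              simp only [List.mem_map] at hw hw'
              obtain ⟨v, _, rfl⟩ := hw
              obtain ⟨v', _, h⟩ := hw'
              exact hne (hcanc u' hu' u hu v' v h).1.symm
          · exact List.nodup_nil
        · refine List.Nodup.pairwise_of_forall_ne nodup_choices ?_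
          intro ω hω ω' hω' hne w hw hw'
          exact hne (huniq j hj'.1 (by omega) ω hω j hj'.1 (by omega) ω' hω' w hw hw').2
      · refine List.Nodup.pairwise_of_forall_ne List.nodup_range' ?_
        intro j hj j' hj' hne w hw hw'
        have h1 : 1 ≤ j ∧ j < 1 + s / 2 := List.mem_range'_1.mp hj
        have h2 : 1 ≤ j' ∧ j' < 1 + s / 2 := List.mem_range'_1.mp hj'
        obtain ⟨ω, hω, hw⟩ := List.mem_flatMap.mp hw
        obtain ⟨ω', hω', hw'⟩ := List.mem_flatMap.mp hw'
        exact hne (huniq j h1.1 (by omega) ω hω j' h2.1 (by omega) ω' hω' w hw hw').1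
    · intro w
      simp only [List.mem_flatMap]
      constructor
      · rintro ⟨j, hj, ω, hω, hw⟩
        have h1 : 1 ≤ j ∧ j < 1 + s / 2 := List.mem_range'_1.mp hj
        obtain ⟨-, u, v, Y, Z, hr, hu, hv, rfl, hlen, -⟩ := hmem j h1.1 (by omega) ω hω w hw
        exact ⟨hg.rule X Y Z hr u hu v hv, hlen⟩
      · rintro ⟨hw, hlen⟩
        obtain ⟨Y, Z, hr, u, hu, v, hv, rfl⟩ := hg.split X w hw (by omega)
        have hu0 : 0 < u.length := List.length_pos_iff.mpr fun h => hg.nil Y (h ▸ hu)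
        have hv0 : 0 < v.length := List.length_pos_iff.mpr fun h => hg.nil Z (h ▸ hv)
        rw [List.length_append] at hlen
        -- A split into equal halves is listed with its short part on the left.
        by_cases hc : 2 * u.length ≤ s
        · refine ⟨u.length, List.mem_range'_1.mpr (by omega), ⟨X, Y, Z, true⟩,
            mem_choices.mpr (Or.inl ⟨rfl, hr⟩), ?_⟩
          rw [choiceWords, if_pos (by simp)]
          refine mem_concatWords.mpr ⟨u, ((ih _ (by omega) Y).2 u).mpr ⟨hu, rfl⟩, v,
            ((ih _ (by omega) Z).2 v).mpr ⟨hv, by omega⟩, by simp⟩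
        · refine ⟨v.length, List.mem_range'_1.mpr (by omega), ⟨X, Z, Y, false⟩,
            mem_choices.mpr (Or.inr ⟨rfl, hr⟩), ?_⟩
          rw [choiceWords, if_pos (by simp; omega)]
          refine mem_concatWords.mpr ⟨v, ((ih _ (by omega) Z).2 v).mpr ⟨hv, rfl⟩, u,
            ((ih _ (by omega) Y).2 u).mpr ⟨hu, by omega⟩, by simp⟩

end Language

end BinaryGrammar

end HalfPlane

namespace HalfPlane

open scoped Polynomial

/-! ### Moving along recursive sequences -/

namespace Expr

variable {V : Type}

theorem exists_eval_polynomial (p : ℤ[X]) (e : Expr V) :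
    ∃ e' : Expr V, ∀ σ, e'.eval σ = p.eval (e.eval σ) := by
  induction p using Polynomial.induction_on with
  | C a => exact ⟨const a, fun σ => by simp⟩
  | add p q hp hq =>
    obtain ⟨e₁, h₁⟩ := hp
    obtain ⟨e₂, h₂⟩ := hq
    exact ⟨e₁ + e₂, fun σ => by simp [h₁, h₂]⟩
  | monomial n a h =>
    obtain ⟨e₁, h₁⟩ := h
    exact ⟨e₁ * e, fun σ => by rw [eval_mul, h₁]; simp [pow_succ]; ring⟩

/-- The value of a polynomial. -/
noncomputable def poly (p : ℤ[X]) (e : Expr V) : Expr V := (exists_eval_polynomial p e).choose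

@[simp] theorem eval_poly (p : ℤ[X]) (e : Expr V) (σ : V → ℤ) :
    (poly p e).eval σ = p.eval (e.eval σ) := (exists_eval_polynomial p e).choose_spec σ

/-- The sum of the first `k` terms of a sequence. -/
def sum (f : ℕ → Expr V) : ℕ → Expr V
  | 0 => const 0
  | k + 1 => sum f k + f k

@[simp] theorem eval_sum (f : ℕ → Expr V) (k : ℕ) (σ : V → ℤ) :
    (sum f k).eval σ = ∑ i ∈ Finset.range k, (f i).eval σ := by
  induction k with
  | zero => simp [sum]
  | succ k ih => rw [sum, eval_add, ih, Finset.sum_range_succ]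

/-- The `n`-th term of a sequence if `n < N`, and a default value otherwise. -/
def table (a : ℕ → ℤ) (n d : Expr V) : ℕ → Expr V
  | 0 => d
  | N + 1 => ite (n - const N) d (ite (const N - n) (table a n d N) (const (a N)))

theorem eval_table (a : ℕ → ℤ) (n d : Expr V) (N : ℕ) (σ : V → ℤ) (k : ℕ) (hk : n.eval σ = k) :
    (table a n d N).eval σ = if k < N then a k else d.eval σ := by
  induction N with
  | zero => simp [table]
  | succ N ih =>
    simp only [table, eval_ite, eval_sub, eval_const, hk, ih]
    rcases lt_trichotomy k N with h | rfl | h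
    · rw [if_neg (by omega), if_pos (by omega), if_pos h, if_pos (by omega)]
    · simp
    · rw [if_pos (by omega), if_neg (by omega)]

end Expr

/-- A window of as many consecutive terms as the order of the recurrence determines the next term,
by division by the last coefficient, and the previous term, by division by the first. Below the
threshold `n₀`, where these may vanish, the terms are read from a finite table. -/
theorem exists_step_expr {I : Type} (a : I → ℕ → ℤ) {r n₀ : ℕ}
    (h : ∀ X, IsPRecursive r n₀ (a X)) :
    ∃ (R : ℕ) (fwd bwd : I × Fin (R + 1) → Expr (Option (I × Fin (R + 1)))), ∀ (n : ℕ) p,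
      (fwd p).eval (fun x => x.elim (n : ℤ) fun q => a q.1 (n + q.2)) = a p.1 (n + 1 + p.2) ∧
      (bwd p).eval (fun x => x.elim (n : ℤ) fun q => a q.1 (n + 1 + q.2)) = a p.1 (n + p.2) := by
  -- The order is raised to `r + 1`, so that the window has at least one entry even if `r = 0`.
  choose q hq using fun X => (h X).succ_order
  let V := Option (I × Fin (r + 1))
  let N : Expr V := .var none
  let x : I → ℕ → Expr V := fun X i => if hi : i < r + 1 then .var (some (X, ⟨i, hi⟩)) else 0
  refine ⟨r, fun p => if p.2.val + 1 < r + 1 then x p.1 (p.2.val + 1) else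
      Expr.table (fun n => a p.1 (n + (r + 1)))
        N (((Expr.const 0) - Expr.sum (fun i => Expr.poly (q p.1 i) N * x p.1 i) (r + 1)) /
          Expr.poly (q p.1 (r + 1)) N) n₀,
    fun p => if p.2.val = 0 then Expr.table (a p.1) N
        (((Expr.const 0) - Expr.sum (fun i => Expr.poly (q p.1 (i + 1)) N * x p.1 i) (r + 1)) /
          Expr.poly (q p.1 0) N) n₀ else x p.1 (p.2.val - 1), fun n p => ⟨?_, ?_⟩⟩
  · set σ : V → ℤ := fun x => x.elim (n : ℤ) fun q => a q.1 (n + q.2) with hσ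
    have hx : ∀ X i, i < r + 1 → (x X i).eval σ = a X (n + i) := by
      intro X i hi; simp only [x, dif_pos hi, Expr.eval_var, hσ, Option.elim]
    have hN : N.eval σ = n := rfl
    obtain ⟨X, i, hi⟩ := p
    simp only
    split_ifs with hc
    · rw [hx _ _ hc]; congr 1; omega
    · obtain rfl : i = r := by omega
      rw [Expr.eval_table _ _ _ _ _ n hN]
      split_ifs with hn
      · congr 1; omega
      · obtain ⟨-, h2, h3⟩ := hq X n (by omega)
        simp only [Expr.eval_div, Expr.eval_sub, Expr.eval_const, Expr.eval_sum, Expr.eval_mul,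
          Expr.eval_poly, hN]
        rw [Finset.sum_range_succ] at h3
        rw [Finset.sum_congr rfl fun j hj => by rw [hx X j (Finset.mem_range.mp hj)]]
        -- The quotient is an integer by the recurrence, so the division is exact.
        refine Int.ediv_eq_of_eq_mul_right h2 ?_
        rw [show n + 1 + i = n + (i + 1) by omega]
        linarith
  · set σ : V → ℤ := fun x => x.elim (n : ℤ) fun q => a q.1 (n + 1 + q.2) with hσ
    have hx : ∀ X i, i < r + 1 → (x X i).eval σ = a X (n + 1 + i) := by
      intro X i hi; simp only [x, dif_pos hi, Expr.eval_var, hσ, Option.elim]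
    have hN : N.eval σ = n := rfl
    obtain ⟨X, i, hi⟩ := p
    simp only
    split_ifs with hc
    · subst hc
      rw [Expr.eval_table _ _ _ _ _ n hN]
      split_ifs with hn
      · rfl
      · obtain ⟨h1, -, h3⟩ := hq X n (by omega)
        simp only [Expr.eval_div, Expr.eval_sub, Expr.eval_const, Expr.eval_sum, Expr.eval_mul,
          Expr.eval_poly, hN]
        rw [Finset.sum_range_succ'] at h3
        rw [Finset.sum_congr rfl fun j hj => by rw [hx X j (Finset.mem_range.mp hj),
          show n + 1 + j = n + (j + 1) by omega]]
        refine Int.ediv_eq_of_eq_mul_right h1 ?_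
        linarith
    · rw [hx _ _ (by omega)]; congr 1; omega

end HalfPlane

namespace HalfPlane

/-! ### The sampling commands -/

/-- The variables of the sampling commands. -/
inductive Var (J : Type) : Type
  | n | k | u | w | v | x | s | r | g | wl | vl | pl | j | found
  | near (q : J)
  | far (q : J)

namespace Var

/-- A numbering of the variables. -/
def index {J : Type} : Var J → Fin 14 ⊕ J ⊕ J
  | n => .inl 0 | k => .inl 1 | u => .inl 2 | w => .inl 3 | v => .inl 4 | x => .inl 5 | s => .inl 6
  | r => .inl 7 | g => .inl 8 | wl => .inl 9 | vl => .inl 10 | pl => .inl 11 | j => .inl 12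
  | found => .inl 13
  | near q => .inr (.inl q)
  | far q => .inr (.inr q)

theorem index_injective {J : Type} : Function.Injective (index (J := J)) := by
  intro y z h
  cases y <;> cases z <;> simp [index] at h ⊢ <;> exact h

noncomputable instance {J : Type} [Fintype J] : Fintype (Var J) :=
  Fintype.ofInjective index index_injective

end Var

/-- The values of the variables of the sampling commands. -/
structure Store (J : Type) : Type where
  n : ℤ
  k : ℤ
  u : ℤ
  w : ℤ
  v : ℤ
  x : ℤ
  s : ℤ
  r : ℤ
  g : ℤ
  wl : ℤ
  vl : ℤ
  pl : ℤ
  j : ℤ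
  found : ℤ
  near : J → ℤ
  far : J → ℤ

/-- The value of a variable. -/
def Store.get {J : Type} (σ : Store J) : Var J → ℤ
  | .n => σ.n | .k => σ.k | .u => σ.u | .w => σ.w | .v => σ.v | .x => σ.x | .s => σ.s
  | .r => σ.r | .g => σ.g | .wl => σ.wl | .vl => σ.vl | .pl => σ.pl | .j => σ.j
  | .found => σ.found
  | .near q => σ.near q
  | .far q => σ.far q

/-- A binary grammar with the data needed for the sampling of its words. -/
structure Sampler (T I : Type) [DecidableEq I] : Type where
  g : BinaryGrammar T I
  start : I
  order : ℕ
  fwd : I × Fin (order + 1) → Expr (Option (I × Fin (order + 1)))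
  bwd : I × Fin (order + 1) → Expr (Option (I × Fin (order + 1)))
  fwd_spec : ∀ (n : ℕ) p,
    (fwd p).eval (fun x => x.elim (n : ℤ) fun q => (g.count q.1 (n + q.2) : ℤ)) =
      g.count p.1 (n + 1 + p.2)
  bwd_spec : ∀ (n : ℕ) p,
    (bwd p).eval (fun x => x.elim (n : ℤ) fun q => (g.count q.1 (n + 1 + q.2) : ℤ)) =
      g.count p.1 (n + p.2)
  base : ℕ
  code : I → ℕ
  code_inj : Function.Injective code
  code_pos : ∀ X, 0 < code X
  code_lt : ∀ X, code X < base
  two_le_base : 2 ≤ base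
  count_le : ∀ X s, g.count X s ≤ base ^ s

namespace Sampler

variable {T I : Type} [DecidableEq I] (S : Sampler T I)

/-- The indices of the entries of the windows. -/
abbrev J : Type := I × Fin (S.order + 1)

/-- The window of the counting sequences at index `m`. -/
noncomputable def window (m : ℕ) (q : S.J) : ℤ := S.g.count q.1 (m + q.2)

/-- The window at `m + 1` from the window at `m`. -/
def next (m : ℤ) (y : S.J → ℤ) (q : S.J) : ℤ := (S.fwd q).eval fun x => x.elim m y

/-- The window at `m` from the window at `m + 1`. -/
def prev (m : ℤ) (y : S.J → ℤ) (q : S.J) : ℤ := (S.bwd q).eval fun x => x.elim m y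

theorem next_window (m : ℕ) : S.next m (S.window m) = S.window (m + 1) := by
  funext q; exact S.fwd_spec m q

theorem prev_window (m : ℕ) : S.prev m (S.window (m + 1)) = S.window m := by
  funext q; exact S.bwd_spec m q

open HalfPlane.Expr (var const)

/-- An expression for `next`. -/
def nextExpr (m : Expr (Var S.J)) (y : S.J → Var S.J) (q : S.J) : Expr (Var S.J) :=
  (S.fwd q).subst fun x => x.elim m fun q => var (y q)

/-- An expression for `prev`. -/
def prevExpr (m : Expr (Var S.J)) (y : S.J → Var S.J) (q : S.J) : Expr (Var S.J) :=
  (S.bwd q).subst fun x => x.elim m fun q => var (y q)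

theorem eval_nextExpr (m : Expr (Var S.J)) (y : S.J → Var S.J) (q : S.J) (σ : Var S.J → ℤ) :
    (S.nextExpr m y q).eval σ = S.next (m.eval σ) (fun q => σ (y q)) q := by
  rw [nextExpr, Expr.eval_subst, next]
  congr 1; funext x; cases x <;> rfl

theorem eval_prevExpr (m : Expr (Var S.J)) (y : S.J → Var S.J) (q : S.J) (σ : Var S.J → ℤ) :
    (S.prevExpr m y q).eval σ = S.prev (m.eval σ) (fun q => σ (y q)) q := by
  rw [prevExpr, Expr.eval_subst, prev]
  congr 1; funext x; cases x <;> rfl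

/-- The base of the encoding, as an expression. -/
def baseExpr : Expr (Var S.J) := const S.base

@[simp] theorem eval_baseExpr (σ : Var S.J → ℤ) : S.baseExpr.eval σ = S.base := rfl

/-- A simultaneous assignment, as a map on stores. -/
structure Assignment where
  expr : Var S.J → Expr (Var S.J)
  map : Store S.J → Store S.J
  spec : ∀ σ y, (expr y).eval σ.get = (map σ).get y

variable {S} in
theorem Assignment.runs (a : S.Assignment) {M : ℕ} (σ : Store S.J) (hb : Bdd M (a.map σ).get)
    (t : ℕ) : Runs M (.upd a.expr : Cmd T (Var S.J)) σ.get (a.map σ).get [] (t + 1) :=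
  .upd _ _ _ t (a.spec σ) hb

/-- Start of the computation of the window at `n`. -/
noncomputable def initNear : S.Assignment where
  expr
    | .j => const 0
    | .g => const 1
    | .near q => const (S.window 0 q)
    | y => var y
  map σ := { σ with j := 0, g := 1, near := S.window 0 }
  spec σ y := by cases y <;> rfl

/-- Advance of the window at `j`. -/
def stepNear : S.Assignment where
  expr
    | .j => var .j + const 1
    | .g => var .g * S.baseExpr
    | .near q => S.nextExpr (var .j) .near q
    | y => var y
  map σ := { σ with j := σ.j + 1, g := σ.g * S.base, near := S.next σ.j σ.near }
  spec σ y := by cases y <;> first | rfl | exact S.eval_nextExpr _ _ _ _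

/-- Write the initial tapes. -/
def initTape : S.Assignment where
  expr
    | .w => Expr.ite (var .n) (const (S.code S.start) + var .g) (const 1)
    | .v => var .u
    | y => var y
  map σ := { σ with w := if 0 < σ.n then S.code S.start + σ.g else 1, v := σ.u }
  spec σ y := by cases y <;> rfl

/-- Read the symbol at the front of the tape. -/
def initFront : S.Assignment where
  expr
    | .x => var .w - S.baseExpr * (var .w / S.baseExpr)
    | .s => const 1
    | .g => S.baseExpr
    | .w => var .w / S.baseExpr
    | y => var y
  map σ := { σ with
    x := σ.w - S.base * (σ.w / S.base)
    s := 1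
    g := S.base
    w := σ.w / S.base }
  spec σ y := by cases y <;> rfl

/-- Remove a blank symbol. -/
def stepFront : S.Assignment where
  expr
    | .s => var .s + const 1
    | .g => var .g * S.baseExpr
    | .w => var .w / S.baseExpr
    | y => var y
  map σ := { σ with
    s := σ.s + 1
    g := σ.g * S.base
    w := σ.w / S.base }
  spec σ y := by cases y <;> rfl

/-- Read the rank of the item at the front, and initialize the left tapes. -/
noncomputable def initItem : S.Assignment where
  expr
    | .r => var .v - var .g * (var .v / var .g)
    | .v => var .v / var .g
    | .wl => const 0
    | .vl => const 0
    | .pl => const 1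
    | .j => const 0
    | .far q => const (S.window 0 q)
    | y => var y
  map σ := { σ with
    r := σ.v - σ.g * (σ.v / σ.g)
    v := σ.v / σ.g
    wl := 0
    vl := 0
    pl := 1
    j := 0
    far := S.window 0 }
  spec σ y := by cases y <;> rfl

/-- Advance of the far window. -/
def stepFar : S.Assignment where
  expr
    | .j => var .j + const 1
    | .far q => S.nextExpr (var .j) .far q
    | y => var y
  map σ := { σ with j := σ.j + 1, far := S.next σ.j σ.far }
  spec σ y := by cases y <;> first | rfl | exact S.eval_nextExpr _ _ _ _

/-- Start of the search for a choice. -/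
noncomputable def initSearch : S.Assignment where
  expr
    | .j => const 1
    | .g => S.baseExpr
    | .near q => const (S.window 1 q)
    | .far q => S.prevExpr (var .s - const 1) .far q
    | .found => const 0
    | y => var y
  map σ := { σ with
    j := 1
    g := S.base
    near := S.window 1
    far := S.prev (σ.s - 1) σ.far
    found := 0 }
  spec σ y := by cases y <;> first | rfl | exact S.eval_prevExpr _ _ _ _

/-- Next length of the short part. -/
def stepSearch : S.Assignment where
  expr
    | .j => var .j + const 1
    | .g => var .g * S.baseExpr
    | .near q => S.nextExpr (var .j) .near q
    | .far q => S.prevExpr (var .s - var .j - const 1) .far q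
    | y => var y
  map σ := { σ with
    j := σ.j + 1
    g := σ.g * S.base
    near := S.next σ.j σ.near
    far := S.prev (σ.s - σ.j - 1) σ.far }
  spec σ y := by
    cases y <;> first | rfl | exact S.eval_nextExpr _ _ _ _ | exact S.eval_prevExpr _ _ _ _

/-- Apply a choice whose short part is on the left. -/
def selectLeft (Y Z : I) : S.Assignment where
  expr
    | .wl => var .wl + var .pl * const (S.code Y)
    | .vl => var .vl + var .pl * (var .r / var (.far (Z, 0)))
    | .pl => var .pl * var .g
    | .x => const (S.code Z)
    | .s => var .s - var .j
    | .r => var .r - var (.far (Z, 0)) * (var .r / var (.far (Z, 0)))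
    | .found => const 1
    | y => var y
  map σ := { σ with
    wl := σ.wl + σ.pl * S.code Y
    vl := σ.vl + σ.pl * (σ.r / σ.far (Z, 0))
    pl := σ.pl * σ.g
    x := S.code Z
    s := σ.s - σ.j
    r := σ.r - σ.far (Z, 0) * (σ.r / σ.far (Z, 0))
    found := 1 }
  spec σ y := by cases y <;> rfl

/-- Apply a choice whose short part is on the right. -/
def selectRight (Y Z : I) : S.Assignment where
  expr
    | .w => const (S.code Y) + var .g * var .w
    | .v => var .r / var (.far (Z, 0)) + var .g * var .v
    | .x => const (S.code Z)
    | .s => var .s - var .j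
    | .r => var .r - var (.far (Z, 0)) * (var .r / var (.far (Z, 0)))
    | .found => const 1
    | y => var y
  map σ := { σ with
    w := S.code Y + σ.g * σ.w
    v := σ.r / σ.far (Z, 0) + σ.g * σ.v
    x := S.code Z
    s := σ.s - σ.j
    r := σ.r - σ.far (Z, 0) * (σ.r / σ.far (Z, 0))
    found := 1 }
  spec σ y := by cases y <;> rfl

/-- Skip a choice. -/
def reject (Y Z : I) : S.Assignment where
  expr
    | .r => var .r - var (.near (Y, 0)) * var (.far (Z, 0))
    | y => var y
  map σ := { σ with r := σ.r - σ.near (Y, 0) * σ.far (Z, 0) }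
  spec σ y := by cases y <;> rfl

/-- Join the left tapes, the current item, and the right tapes. -/
def joinTapes : S.Assignment where
  expr
    | .w => var .wl + var .pl * (var .x + S.baseExpr * var .w)
    | .v => var .vl + var .pl * (var .r + S.baseExpr * var .v)
    | y => var y
  map σ := { σ with
    w := σ.wl + σ.pl * (σ.x + S.base * σ.w)
    v := σ.vl + σ.pl * (σ.r + S.base * σ.v) }
  spec σ y := by cases y <;> rfl

/-- Decrease the number of words still to be written. -/
def countDown : S.Assignment where
  expr
    | .k => var .k - const 1
    | y => var y
  map σ := { σ with k := σ.k - 1 }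
  spec σ y := by cases y <;> rfl

/-- Positive if the variable `x` holds the code of `X` and no choice was found yet. -/
def matchExpr (X : I) : Expr (Var S.J) :=
  const 1 - var .found - (var .x - const (S.code X)) * (var .x - const (S.code X))

/-- Try a choice. -/
def tryChoice (ω : Choice I) : Cmd T (Var S.J) :=
  .ite (.ite (S.matchExpr ω.head) (if ω.left then const 1 else var .s - const 2 * var .j) (const 0))
    (.ite (var (.near (ω.small, 0)) * var (.far (ω.big, 0)) - var .r)
      (.upd (if ω.left then S.selectLeft ω.small ω.big else S.selectRight ω.small ω.big).expr)
      (.upd (S.reject ω.small ω.big).expr))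
    .skip

/-- Try the choices of a list. -/
def tryChoices : List (Choice I) → Cmd T (Var S.J)
  | [] => .skip
  | ω :: l => .seq (S.tryChoice ω) (tryChoices l)

/-- Try all choices for one length of the short part. -/
noncomputable def searchBody : Cmd T (Var S.J) :=
  .seq (S.tryChoices S.g.choices)
    (.ite (var .found) (.upd S.initSearch.expr) (.upd S.stepSearch.expr))

/-- Split the current item until its length is `1`. -/
noncomputable def splitItem : Cmd T (Var S.J) :=
  .seq (.loop (var .s - var .j) (.upd S.stepFar.expr))
    (.seq (.upd S.initSearch.expr)
      (.seq (.loop (var .s - const 1) S.searchBody) (.upd S.joinTapes.expr)))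

/-- Write the letter of the current item of length `1`. -/
def writeLetter : List I → Cmd T (Var S.J)
  | [] => .skip
  | X :: Xs => .ite (const 1 - (var .x - const (S.code X)) * (var .x - const (S.code X)))
      (.emit (S.g.letters X) (var .r)) (writeLetter Xs)

/-- Process the item at the front of the tape. -/
noncomputable def processFront [Fintype I] : Cmd T (Var S.J) :=
  .seq (.upd S.initFront.expr)
    (.seq (.loop (const 1 - (var .w - S.baseExpr * (var .w / S.baseExpr)))
        (.upd S.stepFront.expr))
      (.seq (.upd S.initItem.expr)
        (.ite (var .s - const 1) S.splitItem (S.writeLetter Finset.univ.toList))))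

/-- Compute the number of words of length `n`. -/
noncomputable def prepare : Cmd T (Var S.J) :=
  .seq (.upd S.initNear.expr) (.loop (var .n - var .j) (.upd S.stepNear.expr))

/-- Write the word of rank `u`. -/
noncomputable def generate [Fintype I] : Cmd T (Var S.J) :=
  .seq (.upd S.initTape.expr)
    (.seq (.loop (var .w - const 1) S.processFront) (.upd S.countDown.expr))

end Sampler

end HalfPlane

/-! ### Items on tapes and the effect of one choice -/

namespace HalfPlane

/-- A word given by a symbol, a length, and a rank among the words of this length. -/
structure Item (I : Type) : Type where
  X : I
  s : ℕ
  r : ℕ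

theorem natAbs_le_of_eq {z : ℤ} {m M : ℕ} (h : z = m) (hm : m ≤ M) : z.natAbs ≤ M := by
  rw [h, Int.natAbs_natCast]; exact hm

theorem Store.bdd_of {J : Type} {M : ℕ} {σ τ : Store J} (hb : Bdd M σ.get)
    (h : ∀ y, τ.get y = σ.get y ∨ (τ.get y).natAbs ≤ M) : Bdd M τ.get := by
  intro y
  rcases h y with h | h
  · rw [h]; exact hb y
  · exact h

namespace Sampler

variable {T I : Type} [DecidableEq I] (S : Sampler T I)

/-- The rank of an item is in the range allowed. -/
def Valid (it : Item I) : Prop := 1 ≤ it.s ∧ it.r < S.g.count it.X it.s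

/-- The word of an item. -/
noncomputable def word (it : Item I) : List T := ((S.g.words it.X it.s)[it.r]?).getD []

/-- The concatenation of the words of a list of items. -/
noncomputable def wordsOf (l : List (Item I)) : List T := (l.map S.word).flatten

/-- The total length of a list of items. -/
def total (l : List (Item I)) : ℕ := (l.map Item.s).sum

/-- The sum of the values of a function of the lengths of a list of items. -/
def potential (f : ℕ → ℕ) (l : List (Item I)) : ℕ := (l.map fun it => f it.s).sum

/-- The tape that holds the value `f` of each item in as many digits as the item has letters,
followed by `t`. -/
def enc (f : Item I → ℕ) (t : ℕ) : List (Item I) → ℕ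
  | [] => t
  | it :: l => f it + S.base ^ it.s * enc f t l

variable {S}

theorem getElem?_of_valid {X : I} {s r : ℕ} {w : List T}
    (h : (S.g.words X s)[r]? = some w) : r < S.g.count X s ∧ S.word ⟨X, s, r⟩ = w := by
  refine ⟨(List.getElem?_eq_some_iff.mp h).1, ?_⟩
  simp [word, h]

theorem base_pos : 0 < S.base := by have := S.two_le_base; omega

theorem enc_append (f : Item I → ℕ) (t : ℕ) (l l' : List (Item I)) :
    S.enc f t (l ++ l') = S.enc f (S.enc f t l') l := by
  induction l with
  | nil => rfl
  | cons it l ih => simp [enc, ih]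

omit [DecidableEq I] in
theorem total_append (l l' : List (Item I)) : total (l ++ l') = total l + total l' := by
  simp [total]

/-- A tape is a positional numeral: what follows the items of `l` is shifted by their total length.
Hence the power `pl` is all that is needed to append to a left tape, or to put it in front of
another tape. -/
theorem enc_eq (f : Item I → ℕ) (t : ℕ) (l : List (Item I)) :
    S.enc f t l = S.enc f 0 l + S.base ^ total l * t := by
  induction l with
  | nil => simp [enc, total]
  | cons it l ih =>
    simp only [enc, total, List.map_cons, List.sum_cons, pow_add] at ih ⊢
    rw [ih]; ring

/-- A value that fits into the digits of its item never carries into the next item. A tape therefore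
has as many digits as its items have letters, which keeps the registers linear in `n`. -/
theorem enc_lt (f : Item I → ℕ) (t c : ℕ) (ht : t < S.base ^ c) (l : List (Item I))
    (h : ∀ it ∈ l, f it < S.base ^ it.s) : S.enc f t l < S.base ^ (total l + c) := by
  induction l with
  | nil => simpa [enc, total] using ht
  | cons it l ih =>
    have h1 := h it (by simp)
    have h2 := ih fun it hit => h it (by simp [hit])
    simp only [enc, total, List.map_cons, List.sum_cons] at h2 ⊢
    have h3 : S.base ^ (it.s + (l.map Item.s).sum + c) =
      S.base ^ it.s * S.base ^ ((l.map Item.s).sum + c) := by rw [← pow_add]; ring_nf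
    rw [h3]
    calc _ < S.base ^ it.s + S.base ^ it.s * S.enc f t l := by omega
      _ = S.base ^ it.s * (S.enc f t l + 1) := by ring
      _ ≤ _ := Nat.mul_le_mul_left _ h2

theorem Valid.code_lt {it : Item I} (h : S.Valid it) : S.code it.X < S.base ^ it.s :=
  (S.code_lt _).trans_le (Nat.le_self_pow (by have := h.1; omega) _)

theorem Valid.rank_lt {it : Item I} (h : S.Valid it) : it.r < S.base ^ it.s :=
  h.2.trans_le (S.count_le _ _)

/-- The bound `M` is large enough for words of length `n`. -/
def Fits (S : Sampler T I) (M n : ℕ) : Prop := S.base ^ (n + S.order + 2) ≤ M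

theorem Fits.pow_le {M n : ℕ} (h : S.Fits M n) {m : ℕ} (hm : m ≤ n + S.order + 2) :
    S.base ^ m ≤ M :=
  (Nat.pow_le_pow_right base_pos hm).trans h

theorem Fits.le {M n : ℕ} (h : S.Fits M n) {m : ℕ} (hm : m ≤ n + S.order + 2) : m ≤ M :=
  (Nat.lt_pow_self S.two_le_base).le.trans (h.pow_le hm)

/-- The largest index in a window at `m ≤ n + 1` is `n + 1 + S.order`, within the exponent of
`Fits`. -/
theorem Fits.window_le {M n : ℕ} (h : S.Fits M n) {m : ℕ} (hm : m ≤ n + 1) (q : S.J) :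
    (S.window m q).natAbs ≤ M :=
  natAbs_le_of_eq rfl ((S.count_le _ _).trans (h.pow_le (by have := q.2.2; omega)))

/-- The stores that represent the current item `⟨X, s, r⟩` between the items `lp` and `rp`. -/
structure Holds (S : Sampler T I) (M n k : ℕ) (σ : Store S.J) (lp : List (Item I)) (X : I)
    (s r : ℕ) (rp : List (Item I)) : Prop where
  n_eq : σ.n = n
  k_eq : σ.k = k
  x_eq : σ.x = S.code X
  s_eq : σ.s = s
  r_eq : σ.r = r
  wl_eq : σ.wl = S.enc (fun it => S.code it.X) 0 lp
  vl_eq : σ.vl = S.enc (fun it => it.r) 0 lp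
  pl_eq : σ.pl = (S.base ^ total lp : ℕ)
  w_eq : σ.w = S.enc (fun it => S.code it.X) 1 rp
  v_eq : σ.v = S.enc (fun it => it.r) 0 rp
  lp_valid : ∀ it ∈ lp, S.Valid it
  rp_valid : ∀ it ∈ rp, S.Valid it
  total_le : total lp + s + total rp ≤ n
  one_le : 1 ≤ s
  bdd : Bdd M σ.get

/-- The stores during the search for a choice. -/
structure Searching (S : Sampler T I) (M n k : ℕ) (σ : Store S.J) (lp : List (Item I)) (X : I)
    (s r j : ℕ) (rp : List (Item I)) : Prop extends Holds S M n k σ lp X s r rp where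
  found_eq : σ.found = 0
  j_eq : σ.j = j
  g_eq : σ.g = (S.base ^ j : ℕ)
  near_eq : σ.near = S.window j
  far_eq : σ.far = S.window (s - j)
  one_le_j : 1 ≤ j
  j_le : j ≤ s

/-- The stores after a choice was found. -/
structure Selected (S : Sampler T I) (M n k : ℕ) (σ : Store S.J) (lp : List (Item I)) (X : I)
    (s r : ℕ) (rp : List (Item I)) : Prop extends Holds S M n k σ lp X s r rp where
  found_eq : σ.found = 1
  far_eq : σ.far = S.window s
  rank_lt : r < S.g.count X s

theorem wordsOf_append (l l' : List (Item I)) :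
    S.wordsOf (l ++ l') = S.wordsOf l ++ S.wordsOf l' := by
  simp [wordsOf]

theorem wordsOf_cons (it : Item I) (l : List (Item I)) :
    S.wordsOf (it :: l) = S.word it ++ S.wordsOf l := by
  simp [wordsOf]

theorem natCast_sub_mul_div (a b : ℕ) : (a : ℤ) - b * ((a : ℤ) / b) = ((a % b : ℕ) : ℤ) := by
  rw [← Int.emod_def]; rfl

variable {M n k : ℕ} {σ : Store S.J} {lp rp : List (Item I)} {X : I} {s r j : ℕ}

/-- The block of the skipped choice has `near * far` words; without them, the rank refers to the
rest of the enumeration. -/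
theorem Searching.reject (h : Searching S M n k σ lp X s r j rp) {Y Z : I}
    (hr : S.g.count Y j * S.g.count Z (s - j) ≤ r) :
    Searching S M n k ((S.reject Y Z).map σ) lp X s (r - S.g.count Y j * S.g.count Z (s - j)) j
      rp := by
  have h1 : ((S.reject Y Z).map σ).r =
      ((r - S.g.count Y j * S.g.count Z (s - j) : ℕ) : ℤ) := by
    simp only [Sampler.reject, h.near_eq, h.far_eq, h.r_eq, window]
    rw [Nat.cast_sub hr]
    push_cast
    simp
  have hrM : r ≤ M := by
    have := h.bdd .r
    rw [Store.get, h.r_eq, Int.natAbs_natCast] at this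
    exact this
  have hb : Bdd M ((S.reject Y Z).map σ).get := Store.bdd_of h.bdd fun y => by
    cases y <;> first | exact Or.inl rfl |
      exact Or.inr (natAbs_le_of_eq h1 ((Nat.sub_le _ _).trans hrM))
  exact { h with r_eq := h1, bdd := hb }

/-- The short part is stored at the end of the left tapes, and the long part becomes the current
item. The far window is already at its length `s - j`, so that it need not be computed again. -/
theorem Searching.selectLeft (hM : S.Fits M n) (h : Searching S M n k σ lp X s r j rp) {Y Z : I}
    (hj : j < s) (hY : r / S.g.count Z (s - j) < S.g.count Y j)
    (hZ : r % S.g.count Z (s - j) < S.g.count Z (s - j)) :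
    Selected S M n k ((S.selectLeft Y Z).map σ)
      (lp ++ [⟨Y, j, r / S.g.count Z (s - j)⟩]) Z (s - j) (r % S.g.count Z (s - j)) rp := by
  set it : Item I := ⟨Y, j, r / S.g.count Z (s - j)⟩ with hit
  have hvalid : S.Valid it := ⟨h.one_le_j, hY⟩
  have hlp : ∀ it' ∈ lp ++ [it], S.Valid it' := by
    intro it' h'
    rcases List.mem_append.mp h' with h' | h'
    · exact h.lp_valid it' h'
    · rw [List.mem_singleton.mp h']; exact hvalid
  have htot : total (lp ++ [it]) = total lp + j := by rw [total_append]; simp [total, hit]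
  have hle := h.total_le
  have hfar : σ.far (Z, 0) = (S.g.count Z (s - j) : ℤ) := by simp [h.far_eq, window]
  have hwl : ((S.selectLeft Y Z).map σ).wl =
      (S.enc (fun it => S.code it.X) 0 (lp ++ [it]) : ℕ) := by
    simp only [Sampler.selectLeft, h.wl_eq, h.pl_eq]
    rw [enc_append, enc_eq _ (S.enc _ _ _)]
    simp [enc, hit]
  have hvl : ((S.selectLeft Y Z).map σ).vl =
      (S.enc (fun it => it.r) 0 (lp ++ [it]) : ℕ) := by
    simp only [Sampler.selectLeft, h.vl_eq, h.pl_eq, h.r_eq, hfar]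
    rw [enc_append, enc_eq _ (S.enc _ _ _)]
    simp [enc, hit]
  have hpl : ((S.selectLeft Y Z).map σ).pl = (S.base ^ total (lp ++ [it]) : ℕ) := by
    simp only [Sampler.selectLeft, h.pl_eq, h.g_eq]
    rw [htot, pow_add]; push_cast; rfl
  have hs : ((S.selectLeft Y Z).map σ).s = ((s - j : ℕ) : ℤ) := by
    simp only [Sampler.selectLeft, h.s_eq, h.j_eq]
    rw [Nat.cast_sub hj.le]
  have hr : ((S.selectLeft Y Z).map σ).r = ((r % S.g.count Z (s - j) : ℕ) : ℤ) := by
    simp only [Sampler.selectLeft, hfar, h.r_eq]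
    exact natCast_sub_mul_div _ _
  have b1 := natAbs_le_of_eq hwl ((enc_lt _ 0 0 (by simp) _ fun it' h' =>
    (hlp it' h').code_lt).le.trans (hM.pow_le (by omega)))
  have b2 := natAbs_le_of_eq hvl ((enc_lt _ 0 0 (by simp) _ fun it' h' =>
    (hlp it' h').rank_lt).le.trans (hM.pow_le (by omega)))
  have b3 := natAbs_le_of_eq hpl (hM.pow_le (by omega))
  have b4 := natAbs_le_of_eq hs (hM.le (by omega))
  have b5 := natAbs_le_of_eq hr (hZ.le.trans ((S.count_le _ _).trans (hM.pow_le (by omega))))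
  have b6 : ((S.selectLeft Y Z).map σ).x.natAbs ≤ M := natAbs_le_of_eq (m := S.code Z) rfl
    ((S.code_lt Z).le.trans ((Nat.le_self_pow (n := 1) (by omega) _).trans
      (hM.pow_le (by omega))))
  have b7 : ((S.selectLeft Y Z).map σ).found.natAbs ≤ M :=
    natAbs_le_of_eq (m := 1) rfl (hM.le (by omega))
  have hb : Bdd M ((S.selectLeft Y Z).map σ).get := Store.bdd_of h.bdd fun y => by
    cases y <;> first | exact Or.inl rfl | exact Or.inr b1 | exact Or.inr b2 | exact Or.inr b3 |
      exact Or.inr b4 | exact Or.inr b5 | exact Or.inr b6 | exact Or.inr b7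
  exact { n_eq := h.n_eq, k_eq := h.k_eq, x_eq := rfl, s_eq := hs, r_eq := hr, wl_eq := hwl,
          vl_eq := hvl, pl_eq := hpl, w_eq := h.w_eq, v_eq := h.v_eq, lp_valid := hlp,
          rp_valid := h.rp_valid, total_le := by omega, one_le := by omega, bdd := hb,
          found_eq := rfl, far_eq := h.far_eq, rank_lt := hZ }

/-- As for a left choice, but the short part is put in front of the right tapes, by a shift by `g =
base ^ j`. -/
theorem Searching.selectRight (hM : S.Fits M n) (h : Searching S M n k σ lp X s r j rp) {Y Z : I}
    (hj : j < s) (hY : r / S.g.count Z (s - j) < S.g.count Y j)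
    (hZ : r % S.g.count Z (s - j) < S.g.count Z (s - j)) :
    Selected S M n k ((S.selectRight Y Z).map σ) lp Z (s - j) (r % S.g.count Z (s - j))
      (⟨Y, j, r / S.g.count Z (s - j)⟩ :: rp) := by
  set it : Item I := ⟨Y, j, r / S.g.count Z (s - j)⟩ with hit
  have hvalid : S.Valid it := ⟨h.one_le_j, hY⟩
  have hrp : ∀ it' ∈ it :: rp, S.Valid it' := by
    intro it' h'
    rcases List.mem_cons.mp h' with rfl | h'
    · exact hvalid
    · exact h.rp_valid it' h'
  have htot : total (it :: rp) = j + total rp := by simp [total, hit]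
  have hle := h.total_le
  have hfar : σ.far (Z, 0) = (S.g.count Z (s - j) : ℤ) := by simp [h.far_eq, window]
  have hw : ((S.selectRight Y Z).map σ).w =
      (S.enc (fun it => S.code it.X) 1 (it :: rp) : ℕ) := by
    simp only [Sampler.selectRight, h.w_eq, h.g_eq]
    simp [enc, hit]
  have hv : ((S.selectRight Y Z).map σ).v =
      (S.enc (fun it => it.r) 0 (it :: rp) : ℕ) := by
    simp only [Sampler.selectRight, h.v_eq, h.g_eq, h.r_eq, hfar]
    simp [enc, hit]
  have hs : ((S.selectRight Y Z).map σ).s = ((s - j : ℕ) : ℤ) := by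
    simp only [Sampler.selectRight, h.s_eq, h.j_eq]
    rw [Nat.cast_sub hj.le]
  have hr : ((S.selectRight Y Z).map σ).r = ((r % S.g.count Z (s - j) : ℕ) : ℤ) := by
    simp only [Sampler.selectRight, hfar, h.r_eq]
    exact natCast_sub_mul_div _ _
  have b1 := natAbs_le_of_eq hw ((enc_lt _ 1 1 (by have := S.two_le_base; simp; omega) _
    fun it' h' => (hrp it' h').code_lt).le.trans (hM.pow_le (by omega)))
  have b2 := natAbs_le_of_eq hv ((enc_lt _ 0 0 (by simp) _ fun it' h' =>
    (hrp it' h').rank_lt).le.trans (hM.pow_le (by omega)))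
  have b4 := natAbs_le_of_eq hs (hM.le (by omega))
  have b5 := natAbs_le_of_eq hr (hZ.le.trans ((S.count_le _ _).trans (hM.pow_le (by omega))))
  have b6 : ((S.selectRight Y Z).map σ).x.natAbs ≤ M := natAbs_le_of_eq (m := S.code Z) rfl
    ((S.code_lt Z).le.trans ((Nat.le_self_pow (n := 1) (by omega) _).trans
      (hM.pow_le (by omega))))
  have b7 : ((S.selectRight Y Z).map σ).found.natAbs ≤ M :=
    natAbs_le_of_eq (m := 1) rfl (hM.le (by omega))
  have hb : Bdd M ((S.selectRight Y Z).map σ).get := Store.bdd_of h.bdd fun y => by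
    cases y <;> first | exact Or.inl rfl | exact Or.inr b1 | exact Or.inr b2 |
      exact Or.inr b4 | exact Or.inr b5 | exact Or.inr b6 | exact Or.inr b7
  exact { n_eq := h.n_eq, k_eq := h.k_eq, x_eq := rfl, s_eq := hs, r_eq := hr, wl_eq := h.wl_eq,
          vl_eq := h.vl_eq, pl_eq := h.pl_eq, w_eq := hw, v_eq := hv, lp_valid := h.lp_valid,
          rp_valid := hrp, total_le := by omega, one_le := by omega, bdd := hb,
          found_eq := rfl, far_eq := h.far_eq, rank_lt := hZ }

/-- The result of the choice of a split. -/
def Splits (S : Sampler T I) (M n k : ℕ) (f : ℕ → ℕ) (lp : List (Item I)) (s j : ℕ)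
    (rp : List (Item I)) (w : List T) (σ' : Store S.J) : Prop :=
  ∃ lp' X' r' rp', Selected S M n k σ' lp' X' (s - j) r' rp' ∧
    S.wordsOf lp' ++ S.word ⟨X', s - j, r'⟩ ++ S.wordsOf rp' =
      S.wordsOf lp ++ w ++ S.wordsOf rp ∧
    total lp' + total rp' = total lp + j + total rp ∧
    potential f lp' + potential f rp' = potential f lp + f j + potential f rp

/-- With `found = 1` the guard is the negative of a square. -/
theorem tryChoice_of_found (ω : Choice I) (h : σ.found = 1) :
    Runs M (S.tryChoice ω) σ.get σ.get [] 3 := by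
  refine .iteFalse _ _ _ _ _ _ 2 ?_ (.skip _ 1)
  simp only [Expr.eval_ite, matchExpr, Expr.eval_sub, Expr.eval_mul, Expr.eval_const,
    Expr.eval_var, Store.get, h]
  rw [if_neg]
  nlinarith [mul_self_nonneg (σ.x - S.code ω.head)]

/-- The rank is compared with the number of words of the choice. If it is smaller, its quotient and
remainder by the count of the long part are the ranks of the two parts; otherwise the search goes on
in `tail` with the reduced rank. -/
theorem Searching.tryChoice (hM : S.Fits M n) (h : Searching S M n k σ lp X s r j rp)
    (hj : 2 * j ≤ s) (f : ℕ → ℕ) (ω : Choice I) (w : List T) (tail : List (List T))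
    (hw : (S.g.choiceWords X s j ω ++ tail)[r]? = some w) :
    ∃ σ' : Store S.J, Runs M (S.tryChoice ω) σ.get σ'.get [] 3 ∧
      ((∃ r', Searching S M n k σ' lp X s r' j rp ∧ tail[r']? = some w) ∨
        Splits S M n k f lp s j rp w σ') := by
  -- For integers, `1 - (x - c) ^ 2` is positive exactly if `x = c`.
  have hmatch : 0 < (S.matchExpr ω.head).eval σ.get ↔ ω.head = X := by
    simp only [matchExpr, Expr.eval_sub, Expr.eval_mul, Expr.eval_const,
      Expr.eval_var, Store.get, h.found_eq, h.x_eq]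
    constructor
    · intro h1
      by_contra hne
      have h2 : ((S.code X : ℤ) - S.code ω.head) ≠ 0 := by
        rw [sub_ne_zero]
        exact fun h3 => hne (S.code_inj (by exact_mod_cast h3)).symm
      have h3 : 0 < ((S.code X : ℤ) - S.code ω.head) * ((S.code X : ℤ) - S.code ω.head) :=
        mul_self_pos.mpr h2
      omega
    · rintro rfl; simp
  have hcond : 0 < (Expr.ite (S.matchExpr ω.head)
      (if ω.left then Expr.const 1 else .var .s - .const 2 * .var .j)
      (.const 0)).eval σ.get ↔ (ω.head = X ∧ (ω.left = true ∨ 2 * j < s)) := by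
    rw [Expr.eval_ite]
    by_cases h1 : ω.head = X
    · rw [if_pos (hmatch.mpr h1)]
      cases hl : ω.left
      · simp [h1, Store.get, h.s_eq, h.j_eq]; omega
      · simp [h1]
    · rw [if_neg (fun h2 => h1 (hmatch.mp h2))]
      simp [h1]
  by_cases hc : ω.head = X ∧ (ω.left = true ∨ 2 * j < s)
  swap
  · refine ⟨σ, .iteFalse _ _ _ _ _ _ 2 (not_lt.mp fun h1 => hc (hcond.mp h1)) (.skip _ 1),
      Or.inl ⟨r, h, ?_⟩⟩
    rwa [BinaryGrammar.choiceWords, if_neg hc, List.nil_append] at hw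
  rw [BinaryGrammar.choiceWords, if_pos hc] at hw
  have hlen := length_concatWords ω.left (S.g.words ω.small j) (S.g.words ω.big (s - j))
  have hm : (Expr.var (.near (ω.small, 0)) * Expr.var (.far (ω.big, 0)) - Expr.var .r :
      Expr (Var S.J)).eval σ.get =
      (S.g.count ω.small j * S.g.count ω.big (s - j) : ℕ) - (r : ℤ) := by
    simp [Store.get, h.near_eq, h.far_eq, h.r_eq, window]
  have hjpos := h.one_le_j
  by_cases hr : r < S.g.count ω.small j * S.g.count ω.big (s - j)
  · rw [List.getElem?_append_left (by rw [hlen]; exact hr)] at hw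
    obtain ⟨a, b, ha, hb, hab⟩ := getElem?_concatWords _ _ _ _ _ hw
    obtain ⟨ha1, ha2⟩ := getElem?_of_valid ha
    obtain ⟨hb1, hb2⟩ := getElem?_of_valid hb
    have hrun : ∀ a : S.Assignment,
        a = (if ω.left then S.selectLeft ω.small ω.big else S.selectRight ω.small ω.big) →
        Bdd M (a.map σ).get → Runs M (S.tryChoice ω) σ.get (a.map σ).get [] 3 := by
      rintro a rfl hbd
      refine .iteTrue _ _ _ _ _ _ 2 (hcond.mpr hc) (.iteTrue _ _ _ _ _ _ 1 ?_
        (Assignment.runs _ σ hbd 0))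
      rw [hm]; omega
    cases hl : ω.left
    · have hs := h.selectRight hM (Y := ω.small) (Z := ω.big) (by omega) ha1 hb1
      refine ⟨_, hrun _ (by simp [hl]) hs.bdd, Or.inr ⟨_, _, _, _, hs, ?_, ?_, ?_⟩⟩
      · rw [wordsOf_cons]
        simp only [hl] at hab
        rw [hab]
        simp only [BinaryGrammar.count, ha2, hb2]
        simp
      · simp only [total, List.map_cons, List.sum_cons]; omega
      · simp only [potential, List.map_cons, List.sum_cons]; omega
    · have hs := h.selectLeft hM (Y := ω.small) (Z := ω.big) (by omega) ha1 hb1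
      refine ⟨_, hrun _ (by simp [hl]) hs.bdd, Or.inr ⟨_, _, _, _, hs, ?_, ?_, ?_⟩⟩
      · rw [wordsOf_append, wordsOf_cons]
        simp only [hl] at hab
        rw [hab]
        simp only [BinaryGrammar.count, ha2, hb2]
        simp [wordsOf]
      · simp only [total, List.map_append, List.sum_append, List.map_cons, List.sum_cons,
          List.map_nil, List.sum_nil]
        omega
      · simp only [potential, List.map_append, List.sum_append, List.map_cons, List.sum_cons,
          List.map_nil, List.sum_nil]
        omega
  · have hs := h.reject (not_lt.mp hr)
    refine ⟨_, .iteTrue _ _ _ _ _ _ 2 (hcond.mpr hc) (.iteFalse _ _ _ _ _ _ 1 ?_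
      (Assignment.runs _ σ hs.bdd 0)), Or.inl ⟨_, hs, ?_⟩⟩
    · rw [hm]; omega
    · rw [List.getElem?_append_right (by rw [hlen]; exact not_lt.mp hr), hlen] at hw
      exact hw

theorem tryChoices_of_found (l : List (Choice I)) (h : σ.found = 1) :
    Runs M (S.tryChoices l) σ.get σ.get [] (4 * l.length + 1) := by
  induction l with
  | nil => exact .skip _ 0
  | cons ω l ih =>
    exact .seq _ _ _ _ _ [] [] _ _ _ (tryChoice_of_found ω h) ih
      (by simp only [List.length_cons]; omega)

/-- After a successful choice the others of the list have no effect, so a full pass takes bounded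
time in either case. -/
theorem Searching.tryChoices (hM : S.Fits M n) (hj : 2 * j ≤ s) (f : ℕ → ℕ) (w : List T)
    (tail : List (List T)) (l : List (Choice I)) (h : Searching S M n k σ lp X s r j rp)
    (hw : (l.flatMap (S.g.choiceWords X s j) ++ tail)[r]? = some w) :
    ∃ σ' : Store S.J, Runs M (S.tryChoices l) σ.get σ'.get [] (4 * l.length + 1) ∧
      ((∃ r', Searching S M n k σ' lp X s r' j rp ∧ tail[r']? = some w) ∨
        Splits S M n k f lp s j rp w σ') := by
  induction l generalizing σ r with
  | nil => exact ⟨σ, .skip _ 0, Or.inl ⟨r, h, by simpa using hw⟩⟩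
  | cons ω l ih =>
    rw [List.flatMap_cons, List.append_assoc] at hw
    obtain ⟨σ₁, h1, h2⟩ := h.tryChoice hM hj f ω w _ hw
    rcases h2 with ⟨r', h2, h3⟩ | h2
    · obtain ⟨σ₂, h4, h5⟩ := ih h2 h3
      exact ⟨σ₂, .seq _ _ _ _ _ [] [] _ _ _ h1 h4 (by simp only [List.length_cons]; omega), h5⟩
    · refine ⟨σ₁, .seq _ _ _ _ _ [] [] _ _ _ h1 (tryChoices_of_found l ?_)
        (by simp only [List.length_cons]; omega), Or.inr h2⟩
      obtain ⟨_, _, _, _, h3, _⟩ := h2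
      exact h3.found_eq

end Sampler

end HalfPlane

/-! ### The search for splits and its amortized cost -/

namespace HalfPlane

namespace Sampler

variable {T I : Type} [DecidableEq I] {S : Sampler T I}
variable {M n k : ℕ} {σ : Store S.J} {lp rp : List (Item I)} {X : I} {s r j : ℕ}

theorem Fits.natAbs_le (hM : S.Fits M n) {z : ℤ} {m : ℕ} (h : z = m) (hm : m ≤ n + S.order + 2) :
    z.natAbs ≤ M :=
  natAbs_le_of_eq h (hM.le hm)

theorem Fits.natAbs_le_pow (hM : S.Fits M n) {z : ℤ} {m : ℕ} (h : z = (S.base ^ m : ℕ))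
    (hm : m ≤ n + S.order + 2) : z.natAbs ≤ M :=
  natAbs_le_of_eq h (hM.pow_le hm)

theorem Fits.window_bdd (hM : S.Fits M n) {y : S.J → ℤ} {m : ℕ} (h : y = S.window m)
    (hm : m ≤ n + 1) (q : S.J) : (y q).natAbs ≤ M := by
  rw [h]; exact hM.window_le hm q

theorem Holds.initSearch (hM : S.Fits M n) (h : Holds S M n k σ lp X s r rp)
    (hf : σ.far = S.window s) : Searching S M n k (S.initSearch.map σ) lp X s r 1 rp := by
  have hs := h.one_le
  have hle := h.total_le
  -- A search begins at `j = 1`, so the far window moves one step back, from `s` to `s - 1`.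
  have h1 : (S.initSearch.map σ).far = S.window (s - 1) := by
    simp only [Sampler.initSearch, h.s_eq, hf]
    obtain ⟨m, rfl⟩ : ∃ m, s = m + 1 := ⟨s - 1, by omega⟩
    rw [Nat.add_sub_cancel, ← S.prev_window m]
    push_cast
    rw [add_sub_cancel_right]
  have h2 : (S.initSearch.map σ).g = (S.base ^ 1 : ℕ) := by simp [Sampler.initSearch]
  have b1 : (S.initSearch.map σ).j.natAbs ≤ M := hM.natAbs_le (m := 1) rfl (by omega)
  have b2 := hM.natAbs_le_pow h2 (by omega)
  have b3 := hM.window_bdd (y := (S.initSearch.map σ).near) (m := 1) rfl (by omega)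
  have b4 := hM.window_bdd h1 (by omega)
  have b5 : (S.initSearch.map σ).found.natAbs ≤ M := hM.natAbs_le (m := 0) rfl (by omega)
  have hb : Bdd M (S.initSearch.map σ).get := Store.bdd_of h.bdd fun y => by
    cases y <;> first | exact Or.inl rfl | exact Or.inr b1 | exact Or.inr b2 | exact Or.inr b5 |
      exact Or.inr (b3 _) | exact Or.inr (b4 _)
  exact { h with
    bdd := hb, found_eq := rfl, j_eq := rfl, g_eq := h2, near_eq := rfl, far_eq := h1,
    one_le_j := le_rfl, j_le := hs }

theorem Searching.stepSearch (hM : S.Fits M n) (h : Searching S M n k σ lp X s r j rp)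
    (hj : j < s) : Searching S M n k (S.stepSearch.map σ) lp X s r (j + 1) rp := by
  have hle := h.total_le
  have h1 : (S.stepSearch.map σ).far = S.window (s - (j + 1)) := by
    simp only [Sampler.stepSearch, h.s_eq, h.j_eq, h.far_eq]
    obtain ⟨m, rfl⟩ : ∃ m, s = j + 1 + m := ⟨s - (j + 1), by omega⟩
    rw [show j + 1 + m - j = m + 1 by omega, show j + 1 + m - (j + 1) = m by omega,
      ← S.prev_window m]
    push_cast
    rw [show (j : ℤ) + 1 + m - j - 1 = m by ring]
  have h2 : (S.stepSearch.map σ).g = (S.base ^ (j + 1) : ℕ) := by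
    simp only [Sampler.stepSearch, h.g_eq, pow_succ]; push_cast; rfl
  have h3 : (S.stepSearch.map σ).near = S.window (j + 1) := by
    simp only [Sampler.stepSearch, h.near_eq, h.j_eq]; exact S.next_window j
  have h4 : (S.stepSearch.map σ).j = (j + 1 : ℕ) := by
    simp [Sampler.stepSearch, h.j_eq]
  have b1 := hM.natAbs_le h4 (by omega)
  have b2 := hM.natAbs_le_pow h2 (by omega)
  have b3 := hM.window_bdd h3 (by omega)
  have b4 := hM.window_bdd h1 (by omega)
  have hb : Bdd M (S.stepSearch.map σ).get := Store.bdd_of h.bdd fun y => by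
    cases y <;> first | exact Or.inl rfl | exact Or.inr b1 | exact Or.inr b2 |
      exact Or.inr (b3 _) | exact Or.inr (b4 _)
  exact { h with
    bdd := hb, j_eq := h4, g_eq := h2, near_eq := h3, far_eq := h1,
    one_le_j := by omega, j_le := hj }

/-- The time for one iteration of the search. -/
noncomputable def searchTime (S : Sampler T I) : ℕ := 4 * S.g.choices.length + 5

/-- Either the pass fails and both windows move to the next `j`, or a split is found and a new
search begins at once for the long part. The function `f` is the time that will be charged for the
items put on the tapes. -/
theorem Searching.searchBody (hM : S.Fits M n) (h : Searching S M n k σ lp X s r j rp)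
    (hs : 2 ≤ s) (f : ℕ → ℕ) (w : List T) (hw : (S.g.wordsFrom X s j)[r]? = some w) :
    2 * j ≤ s ∧ ∃ σ' : Store S.J, Runs M S.searchBody σ.get σ'.get [] (4 * S.g.choices.length + 4) ∧
      ((∃ r', Searching S M n k σ' lp X s r' (j + 1) rp ∧
        (S.g.wordsFrom X s (j + 1))[r']? = some w) ∨
      ∃ lp' X' r' rp', Searching S M n k σ' lp' X' (s - j) r' 1 rp' ∧
        r' < S.g.count X' (s - j) ∧
        S.wordsOf lp' ++ S.word ⟨X', s - j, r'⟩ ++ S.wordsOf rp' =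
          S.wordsOf lp ++ w ++ S.wordsOf rp ∧
        total lp' + total rp' = total lp + j + total rp ∧
        potential f lp' + potential f rp' = potential f lp + f j + potential f rp) := by
  -- A valid rank cannot point beyond the last short length, so the search never overruns.
  have hj : 2 * j ≤ s := by
    by_contra hc
    rw [S.g.wordsFrom_of_lt X s j (by omega)] at hw
    simp at hw
  refine ⟨hj, ?_⟩
  rw [S.g.wordsFrom_of_le X s j (by omega)] at hw
  obtain ⟨σ₁, h1, h2⟩ := h.tryChoices hM hj f w _ _ hw
  rcases h2 with ⟨r', h2, h3⟩ | ⟨lp', X', r', rp', h2, h3, h4, h5⟩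
  · have h4 := h2.stepSearch hM (by omega)
    refine ⟨_, .seq _ _ _ _ _ [] [] _ _ _ h1 (.iteFalse _ _ _ _ _ _ 1 ?_
      (Assignment.runs _ σ₁ h4.bdd 0)) (by omega), Or.inl ⟨r', h4, h3⟩⟩
    simp [Store.get, h2.found_eq]
  · have h6 := h2.toHolds.initSearch hM h2.far_eq
    refine ⟨_, .seq _ _ _ _ _ [] [] _ _ _ h1 (.iteTrue _ _ _ _ _ _ 1 ?_
      (Assignment.runs _ σ₁ h6.bdd 0)) (by omega), Or.inr ⟨lp', X', r', rp', h6, h2.rank_lt,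
        h3, h4, h5⟩⟩
    simp [Store.get, h2.found_eq]

/-- The words still to be considered by the search. -/
noncomputable def remaining (S : Sampler T I) (X : I) (s j : ℕ) : List (List T) :=
  if s = 1 then S.g.words X 1 else S.g.wordsFrom X s j

theorem remaining_one (X : I) (s : ℕ) : S.remaining X s 1 = S.g.words X s := by
  rw [remaining]
  split_ifs with h
  · rw [h]
  · rw [S.g.words_eq_wordsFrom X s h]

theorem getElem?_words {it : Item I} (h : it.r < S.g.count it.X it.s) :
    (S.g.words it.X it.s)[it.r]? = some (S.word it) := by
  rw [word, List.getElem?_eq_getElem h]; rfl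

/-- Amortization: `f` is the budget of a stored item and `G` that of the current item. By `h2`, the
budget `G s` pays for the `j` passes that find a short part of length `j`, for the budget `f j` of
this part, and for the budget `G (s - j)` of the long part. The term `S.searchTime * (j - 1)` is
what the search under way has already used. -/
theorem Searching.loop (hM : S.Fits M n) (f G : ℕ → ℕ) (h1 : f 1 + 1 ≤ G 1)
    (h2 : ∀ s j, 1 ≤ j → 2 * j ≤ s → S.searchTime * j + f j + G (s - j) ≤ G s) (w : List T)
    (h : Searching S M n k σ lp X s r j rp) (hw : (S.remaining X s j)[r]? = some w) :
    ∃ (σ' : Store S.J) (lp' : List (Item I)) (X' : I) (r' : ℕ) (rp' : List (Item I)) (t : ℕ),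
      Runs M (.loop (.var .s - .const 1) S.searchBody) σ.get σ'.get [] t ∧
      Holds S M n k σ' lp' X' 1 r' rp' ∧ r' < S.g.count X' 1 ∧
      S.wordsOf lp' ++ S.word ⟨X', 1, r'⟩ ++ S.wordsOf rp' =
        S.wordsOf lp ++ w ++ S.wordsOf rp ∧
      t + S.searchTime * (j - 1) + potential f lp' + f 1 + potential f rp' ≤
        potential f lp + potential f rp + G s := by
  -- This measure decreases when `j` grows by one and also when `(s, j)` becomes `(s - j, 1)`.
  induction hm : 2 * s - j using Nat.strong_induction_on generalizing σ lp X s r j rp w with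
  | _ m ih =>
  have hj1 := h.one_le_j
  have hj2 := h.j_le
  rcases eq_or_ne s 1 with rfl | hs
  · obtain rfl : j = 1 := by omega
    rw [remaining_one] at hw
    obtain ⟨hv, hw'⟩ := getElem?_of_valid hw
    refine ⟨σ, lp, X, r, rp, 1, .loopFalse _ _ _ 0 ?_, h.toHolds, hv, by rw [hw'], ?_⟩
    · simp [Store.get, h.s_eq]
    · simp only [Nat.sub_self, Nat.mul_zero]; omega
  have hw' := hw
  rw [remaining, if_neg hs] at hw'
  obtain ⟨hj, σ₁, hr, hc⟩ := h.searchBody hM (by omega) f w hw'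
  have hcond : 0 < (Expr.var .s - .const 1 : Expr (Var S.J)).eval σ.get := by
    simp only [Expr.eval_sub, Expr.eval_var, Expr.eval_const, Store.get, h.s_eq]; omega
  rcases hc with ⟨r', hc1, hc2⟩ | ⟨lp₁, X₁, r₁, rp₁, hc1, hc2, hc3, hc4, hc5⟩
  · obtain ⟨σ', lp', X', r'', rp', t, g1, g2, g3, g4, g5⟩ := ih (2 * s - (j + 1)) (by omega) w hc1
      (by rw [remaining, if_neg hs]; exact hc2) rfl
    refine ⟨σ', lp', X', r'', rp', S.searchTime + t,
      .loopTrue _ _ _ _ _ [] [] _ _ _ hcond hr g1 (by unfold searchTime; omega), g2, g3, g4, ?_⟩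
    have : S.searchTime * (j + 1 - 1) = S.searchTime * (j - 1) + S.searchTime := by
      rw [← Nat.mul_succ]; congr 1; omega
    omega
  · obtain ⟨σ', lp', X', r'', rp', t, g1, g2, g3, g4, g5⟩ := ih (2 * (s - j) - 1) (by omega)
      (S.word ⟨X₁, s - j, r₁⟩) hc1
      (by rw [remaining_one]; exact getElem?_words (it := ⟨X₁, s - j, r₁⟩) hc2) rfl
    refine ⟨σ', lp', X', r'', rp', S.searchTime + t,
      .loopTrue _ _ _ _ _ [] [] _ _ _ hcond hr g1 (by unfold searchTime; omega), g2, g3,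
      g4.trans hc3, ?_⟩
    have h3 := h2 s j hj1 hj
    have : S.searchTime * j = S.searchTime * (j - 1) + S.searchTime := by
      rw [← Nat.mul_succ]; congr 1; omega
    simp only [Nat.sub_self, Nat.mul_zero] at g5
    omega

/-- The stores that represent a list of items. -/
structure Tape (S : Sampler T I) (M n k : ℕ) (σ : Store S.J) (l : List (Item I)) : Prop where
  n_eq : σ.n = n
  k_eq : σ.k = k
  w_eq : σ.w = S.enc (fun it => S.code it.X) 1 l
  v_eq : σ.v = S.enc (fun it => it.r) 0 l
  valid : ∀ it ∈ l, S.Valid it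
  total_le : total l ≤ n
  bdd : Bdd M σ.get

/-- The current item has length `1`, so it takes one digit between the left and the right tapes. -/
theorem Holds.joinTapes (hM : S.Fits M n) (h : Holds S M n k σ lp X 1 r rp)
    (hr : r < S.g.count X 1) :
    Tape S M n k (S.joinTapes.map σ) (lp ++ ⟨X, 1, r⟩ :: rp) := by
  have hle := h.total_le
  have hv : ∀ it ∈ lp ++ ⟨X, 1, r⟩ :: rp, S.Valid it := by
    intro it hit
    rcases List.mem_append.mp hit with hit | hit
    · exact h.lp_valid it hit
    · rcases List.mem_cons.mp hit with rfl | hit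
      · exact ⟨le_rfl, hr⟩
      · exact h.rp_valid it hit
  have htot : total (lp ++ ⟨X, 1, r⟩ :: rp) = total lp + 1 + total rp := by
    rw [total_append]; simp [total]; ring
  have hw : (S.joinTapes.map σ).w =
      (S.enc (fun it => S.code it.X) 1 (lp ++ ⟨X, 1, r⟩ :: rp) : ℕ) := by
    simp only [Sampler.joinTapes, h.wl_eq, h.pl_eq, h.x_eq, h.w_eq]
    rw [enc_append, enc_eq _ (S.enc _ _ _)]
    simp [enc]
  have hv' : (S.joinTapes.map σ).v =
      (S.enc (fun it => it.r) 0 (lp ++ ⟨X, 1, r⟩ :: rp) : ℕ) := by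
    simp only [Sampler.joinTapes, h.vl_eq, h.pl_eq, h.r_eq, h.v_eq]
    rw [enc_append, enc_eq _ (S.enc _ _ _)]
    simp [enc]
  have b1 := natAbs_le_of_eq hw ((enc_lt _ 1 1 (by have := S.two_le_base; simp; omega) _
    fun it' h' => (hv it' h').code_lt).le.trans (hM.pow_le (by omega)))
  have b2 := natAbs_le_of_eq hv' ((enc_lt _ 0 0 (by simp) _ fun it' h' =>
    (hv it' h').rank_lt).le.trans (hM.pow_le (by omega)))
  exact { n_eq := h.n_eq, k_eq := h.k_eq, w_eq := hw, v_eq := hv', valid := hv,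
          total_le := by omega
          bdd := Store.bdd_of h.bdd fun y => by
            cases y <;> first | exact Or.inl rfl | exact Or.inr b1 | exact Or.inr b2 }

/-- This linear cost arises once for each item read from the tape. Later splits of the item only
move the far window back. -/
theorem Holds.loop_stepFar (hM : S.Fits M n) (i : ℕ) (h : Holds S M n k σ lp X s r rp)
    (hj : σ.j = j) (hf : σ.far = S.window j) (hi : j + i = s) :
    ∃ σ' : Store S.J, Runs M (.loop (.var .s - .var .j) (.upd S.stepFar.expr) : Cmd T _)
      σ.get σ'.get [] (2 * i + 1) ∧ Holds S M n k σ' lp X s r rp ∧ σ'.far = S.window s := by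
  induction i generalizing σ j with
  | zero =>
    refine ⟨σ, .loopFalse _ _ _ 0 ?_, h, by rw [hf, ← hi]; rfl⟩
    simp only [Expr.eval_sub, Expr.eval_var, Store.get, h.s_eq, hj]; omega
  | succ i ih =>
    have hle := h.total_le
    have h1 : (S.stepFar.map σ).j = (j + 1 : ℕ) := by simp [Sampler.stepFar, hj]
    have h2 : (S.stepFar.map σ).far = S.window (j + 1) := by
      simp only [Sampler.stepFar, hj, hf]; exact S.next_window j
    have b1 := hM.natAbs_le h1 (by omega)
    have b2 := hM.window_bdd h2 (by omega)
    have hb : Bdd M (S.stepFar.map σ).get := Store.bdd_of h.bdd fun y => by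
      cases y <;> first | exact Or.inl rfl | exact Or.inr b1 | exact Or.inr (b2 _)
    obtain ⟨σ', g1, g2⟩ := ih (σ := S.stepFar.map σ) { h with bdd := hb } h1 h2 (by omega)
    refine ⟨σ', .loopTrue _ _ _ _ _ [] [] _ _ _ ?_ (Assignment.runs _ σ hb 0) g1 (by omega), g2⟩
    simp only [Expr.eval_sub, Expr.eval_var, Store.get, h.s_eq, hj]; omega

/-- The item is split repeatedly, always continuing with the long part, until one letter is left.
The short parts go to both sides of it and wait on the tape for their turn. -/
theorem Holds.splitItem (hM : S.Fits M n) (f G : ℕ → ℕ) (h1 : f 1 + 1 ≤ G 1)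
    (h2 : ∀ s j, 1 ≤ j → 2 * j ≤ s → S.searchTime * j + f j + G (s - j) ≤ G s)
    (h : Holds S M n k σ [] X s r rp) (hr : r < S.g.count X s)
    (hj : σ.j = 0) (hf : σ.far = S.window 0) :
    ∃ (σ' : Store S.J) (l' : List (Item I)) (t : ℕ),
      Runs M S.splitItem σ.get σ'.get [] t ∧ Tape S M n k σ' l' ∧
      S.wordsOf l' = S.word ⟨X, s, r⟩ ++ S.wordsOf rp ∧
      t + potential f l' ≤ potential f rp + G s + 2 * s + 6 := by
  obtain ⟨σ₁, g1, g2, g3⟩ := h.loop_stepFar hM (j := 0) s hj hf (by omega)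
  have g4 := g2.initSearch hM g3
  obtain ⟨σ₂, lp', X', r', rp', t, e1, e2, e3, e4, e5⟩ := g4.loop hM f G h1 h2 _
    (by rw [remaining_one]; exact getElem?_words (it := ⟨X, s, r⟩) hr)
  have e6 := e2.joinTapes hM e3
  refine ⟨_, _, 2 * s + t + 6, .seq _ _ _ _ _ [] [] _ _ _ g1
    (.seq _ _ _ _ _ [] [] _ _ (t + 4) (Assignment.runs _ _ g4.bdd 0)
      (.seq _ _ _ _ _ [] [] _ _ _ e1 (Assignment.runs _ _ e6.bdd 0) le_rfl) (by omega))
    (by omega), e6, ?_, ?_⟩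
  · rw [wordsOf_append, wordsOf_cons, ← List.append_assoc, e4]; simp [wordsOf]
  · simp only [potential, List.map_append, List.sum_append, List.map_cons, List.sum_cons,
      List.map_nil, List.sum_nil, Nat.sub_self, Nat.mul_zero] at e5 ⊢
    omega

theorem Holds.writeLetter (h : Holds S M n k σ lp X 1 r rp) (hr : r < S.g.count X 1)
    (Xs : List I) (hX : X ∈ Xs) :
    Runs M (S.writeLetter Xs) σ.get σ.get (S.word ⟨X, 1, r⟩) (Xs.length + 1) := by
  induction Xs with
  | nil => simp at hX
  | cons Y Xs ih =>
    have hev : (Expr.const 1 - (.var .x - .const (S.code Y)) * (.var .x - .const (S.code Y)) :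
        Expr (Var S.J)).eval σ.get =
        1 - ((S.code X : ℤ) - S.code Y) * ((S.code X : ℤ) - S.code Y) := by
      simp [Store.get, h.x_eq]
    rcases eq_or_ne X Y with rfl | hne
    · have hr' : r < (S.g.letters X).length := by
        simpa [BinaryGrammar.count, BinaryGrammar.words_one] using hr
      have hw : S.word ⟨X, 1, r⟩ = [(S.g.letters X)[r]] := by
        simp [word, BinaryGrammar.words_one, hr']
      rw [hw]
      refine .iteTrue _ _ _ _ _ _ _ ?_ (.emit _ _ _ r _ _ ?_ (List.getElem?_eq_getElem hr'))
      · rw [hev]; simp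
      · simp [Store.get, h.r_eq]
    · refine .iteFalse _ _ _ _ _ _ _ ?_ (ih ((List.mem_cons.mp hX).resolve_left hne))
      rw [hev]
      have h2 : ((S.code X : ℤ) - S.code Y) ≠ 0 := by
        rw [sub_ne_zero]
        exact fun h3 => hne (S.code_inj (by exact_mod_cast h3))
      have h3 : 0 < ((S.code X : ℤ) - S.code Y) * ((S.code X : ℤ) - S.code Y) :=
        mul_self_pos.mpr h2
      omega

end Sampler

end HalfPlane

/-! ### Processing the tape and writing a word -/

namespace HalfPlane

namespace Sampler

variable {T I : Type} [DecidableEq I] {S : Sampler T I}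
variable {M n k : ℕ} {σ : Store S.J} {l : List (Item I)} {X : I} {s : ℕ}

/-- The stores during the reading of the first item. -/
structure Front (S : Sampler T I) (M n k : ℕ) (σ : Store S.J) (X : I) (s w v : ℕ) : Prop where
  n_eq : σ.n = n
  k_eq : σ.k = k
  x_eq : σ.x = S.code X
  s_eq : σ.s = s
  g_eq : σ.g = (S.base ^ s : ℕ)
  w_eq : σ.w = w
  v_eq : σ.v = v
  bdd : Bdd M σ.get

/-- The length of an item is not stored: it is one plus the number of zero digits after its code,
and these are counted off here. -/
theorem Front.loop_stepFront (hM : S.Fits M n) {m w v : ℕ}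
    (h : Front S M n k σ X s (S.base ^ m * w) v) (hw : w % S.base ≠ 0) (hs : s + m ≤ n) :
    ∃ σ' : Store S.J, Runs M (.loop (.const 1 - (.var .w - S.baseExpr * (.var .w / S.baseExpr)))
      (.upd S.stepFront.expr) : Cmd T _) σ.get σ'.get [] (2 * m + 1) ∧
      Front S M n k σ' X (s + m) w v := by
  have hev : ∀ (σ : Store S.J) (w : ℕ), σ.w = w →
      (Expr.const 1 - (.var .w - S.baseExpr * (.var .w / S.baseExpr)) :
        Expr (Var S.J)).eval σ.get = 1 - ((w % S.base : ℕ) : ℤ) := by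
    intro σ w h
    rw [← natCast_sub_mul_div]
    simp [Store.get, h]
  induction m generalizing σ s with
  | zero =>
    rw [pow_zero, one_mul] at h
    refine ⟨σ, .loopFalse _ _ _ 0 ?_, h⟩
    rw [hev _ _ h.w_eq]; omega
  | succ m ih =>
    have h1 : (S.stepFront.map σ).s = (s + 1 : ℕ) := by simp [stepFront, h.s_eq]
    have h2 : (S.stepFront.map σ).g = (S.base ^ (s + 1) : ℕ) := by
      simp only [stepFront, h.g_eq, pow_succ]; push_cast; rfl
    have hdiv : S.base ^ (m + 1) * w / S.base = S.base ^ m * w := by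
      rw [pow_succ, mul_right_comm, Nat.mul_div_cancel _ base_pos]
    have h3 : (S.stepFront.map σ).w = (S.base ^ m * w : ℕ) := by
      simp only [stepFront, h.w_eq]; rw [← hdiv]; rfl
    have b1 := hM.natAbs_le h1 (by omega)
    have b2 := hM.natAbs_le_pow h2 (by omega)
    have b3 : (S.stepFront.map σ).w.natAbs ≤ M := by
      have := h.bdd .w
      rw [Store.get, h.w_eq, Int.natAbs_natCast] at this
      exact natAbs_le_of_eq h3 (hdiv ▸ (Nat.div_le_self _ _).trans this)
    have hb : Bdd M (S.stepFront.map σ).get := Store.bdd_of h.bdd fun y => by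
      cases y <;> first | exact Or.inl rfl | exact Or.inr b1 | exact Or.inr b2 | exact Or.inr b3
    obtain ⟨σ', g1, g2⟩ := ih (σ := S.stepFront.map σ) (s := s + 1)
      ⟨h.n_eq, h.k_eq, h.x_eq, h1, h2, h3, h.v_eq, hb⟩ (by omega)
    refine ⟨σ', .loopTrue _ _ _ _ _ [] [] _ _ _ ?_ (Assignment.runs _ σ hb 0) g1 (by omega), ?_⟩
    · rw [hev _ _ h.w_eq, pow_succ, mul_right_comm, Nat.mul_mod_left]; simp
    · rwa [show s + (m + 1) = s + 1 + m by omega]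

/-- Codes are positive and the end of the tape is marked by the digit `1`, so a nonzero digit always
ends a run of blanks. -/
theorem enc_code_mod_ne_zero (l : List (Item I)) (h : ∀ it ∈ l, S.Valid it) :
    S.enc (fun it => S.code it.X) 1 l % S.base ≠ 0 := by
  have hb := S.two_le_base
  cases l with
  | nil => rw [enc, Nat.mod_eq_of_lt (by omega)]; omega
  | cons it l =>
    obtain ⟨m, hm⟩ : ∃ m, it.s = m + 1 := ⟨it.s - 1, by have := (h it (by simp)).1; omega⟩
    rw [enc, hm, pow_succ', mul_assoc, Nat.add_mul_mod_self_left,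
      Nat.mod_eq_of_lt (S.code_lt _)]
    exact (S.code_pos _).ne'

theorem Tape.initFront (hM : S.Fits M n) {it : Item I} {m : ℕ} (hm : it.s = m + 1)
    (h : Tape S M n k σ (it :: l)) :
    Front S M n k (S.initFront.map σ) it.X 1 (S.base ^ m * S.enc (fun it => S.code it.X) 1 l)
      (S.enc (fun it => it.r) 0 (it :: l)) := by
  have hw : σ.w = (S.code it.X + S.base * (S.base ^ m * S.enc (fun it => S.code it.X) 1 l) : ℕ) := by
    rw [h.w_eq, enc, hm, pow_succ', mul_assoc]
  have hlt := S.code_lt it.X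
  have h1 : (S.initFront.map σ).x = S.code it.X := by
    simp only [Sampler.initFront, hw]
    rw [natCast_sub_mul_div, Nat.add_mul_mod_self_left, Nat.mod_eq_of_lt hlt]
  have h2 : (S.initFront.map σ).w = (S.base ^ m * S.enc (fun it => S.code it.X) 1 l : ℕ) := by
    simp only [Sampler.initFront, hw]
    rw [← Int.natCast_div, Nat.add_mul_div_left _ _ base_pos, Nat.div_eq_of_lt hlt, zero_add]
  have h3 : (S.initFront.map σ).g = (S.base ^ 1 : ℕ) := by simp [Sampler.initFront]
  have b1 := natAbs_le_of_eq h1 (hlt.le.trans ((Nat.le_self_pow one_ne_zero _).trans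
    (hM.pow_le (by omega))))
  have b2 : (S.initFront.map σ).s.natAbs ≤ M := hM.natAbs_le (m := 1) rfl (by omega)
  have b3 := hM.natAbs_le_pow h3 (by omega)
  have b4 : (S.initFront.map σ).w.natAbs ≤ M := by
    have := h.bdd .w
    rw [Store.get, hw, Int.natAbs_natCast] at this
    exact natAbs_le_of_eq h2 (((Nat.le_mul_of_pos_left _ base_pos).trans
      (Nat.le_add_left _ _)).trans this)
  exact ⟨h.n_eq, h.k_eq, h1, rfl, h3, h2, h.v_eq, Store.bdd_of h.bdd fun y => by
    cases y <;> first | exact Or.inl rfl | exact Or.inr b1 | exact Or.inr b2 | exact Or.inr b3 |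
      exact Or.inr b4⟩

theorem Front.initItem (hM : S.Fits M n) {it : Item I}
    (h : Front S M n k σ it.X it.s (S.enc (fun it => S.code it.X) 1 l)
      (S.enc (fun it => it.r) 0 (it :: l)))
    (hv : ∀ it' ∈ it :: l, S.Valid it') (hn : total (it :: l) ≤ n) :
    Holds S M n k (S.initItem.map σ) [] it.X it.s it.r l := by
  have hlt := (hv it (by simp)).rank_lt
  have hn' : it.s + total l ≤ n := by simpa [total] using hn
  have h1 : (S.initItem.map σ).r = it.r := by
    simp only [Sampler.initItem, h.v_eq, h.g_eq]
    rw [natCast_sub_mul_div, enc, Nat.add_mul_mod_self_left, Nat.mod_eq_of_lt hlt]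
  have h2 : (S.initItem.map σ).v = (S.enc (fun it => it.r) 0 l : ℕ) := by
    simp only [Sampler.initItem, h.v_eq, h.g_eq]
    rw [← Int.natCast_div, enc, Nat.add_mul_div_left _ _ (Nat.pow_pos base_pos),
      Nat.div_eq_of_lt hlt, zero_add]
  have b1 := natAbs_le_of_eq h1 (hlt.le.trans (hM.pow_le (by omega)))
  have b2 := natAbs_le_of_eq h2 ((enc_lt _ 0 0 (by simp) _ fun it' h' =>
    (hv it' (by simp [h'])).rank_lt).le.trans (hM.pow_le (by omega)))
  have b3 : ((0 : ℕ) : ℤ).natAbs ≤ M := hM.natAbs_le rfl (by omega)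
  have b4 : ((1 : ℕ) : ℤ).natAbs ≤ M := hM.natAbs_le rfl (by omega)
  have b5 := hM.window_le (m := 0) (by omega)
  exact { n_eq := h.n_eq, k_eq := h.k_eq, x_eq := h.x_eq, s_eq := h.s_eq, r_eq := h1,
          wl_eq := rfl, vl_eq := rfl, pl_eq := by simp [Sampler.initItem, total],
          w_eq := h.w_eq, v_eq := h2, lp_valid := by simp,
          rp_valid := fun it' h' => hv it' (by simp [h']), total_le := by simpa [total] using hn
          one_le := (hv it (by simp)).1
          bdd := Store.bdd_of h.bdd fun y => by
            cases y <;> first | exact Or.inl rfl | exact Or.inr b1 | exact Or.inr b2 |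
              exact Or.inr b3 | exact Or.inr b4 | exact Or.inr (b5 _) }

/-- A bound on the time for an item of length `1`. -/
noncomputable def letterTime (_S : Sampler T I) [Fintype I] : ℕ := Fintype.card I + 30

/-- A bound on the time for an item of length `s`. -/
noncomputable def itemTime (S : Sampler T I) [Fintype I] (s : ℕ) : ℕ :=
  (S.searchTime + S.letterTime) * (s * Nat.log 2 s) + S.letterTime * s

/-- As `2 * j ≤ s`, the logarithm of the short length is smaller by at least one; the `j` units
gained pay for the search. -/
theorem mul_log_split {s j : ℕ} (h1 : 1 ≤ j) (h2 : 2 * j ≤ s) :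
    j + j * Nat.log 2 j + (s - j) * Nat.log 2 (s - j) ≤ s * Nat.log 2 s := by
  have h3 : Nat.log 2 j + 1 ≤ Nat.log 2 s := by
    rw [← Nat.log_mul_base one_lt_two (by omega)]
    exact Nat.log_mono_right (by omega)
  have h4 : Nat.log 2 (s - j) ≤ Nat.log 2 s := Nat.log_mono_right (by omega)
  obtain ⟨m, rfl⟩ : ∃ m, s = j + m := ⟨s - j, by omega⟩
  rw [Nat.add_sub_cancel_left] at h4 ⊢
  nlinarith

theorem splits_le [Fintype I] {s j : ℕ} (h1 : 1 ≤ j) (h2 : 2 * j ≤ s) :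
    S.searchTime * j + S.itemTime j +
      ((S.searchTime + S.letterTime) * ((s - j) * Nat.log 2 (s - j)) + S.letterTime + 1) ≤
      (S.searchTime + S.letterTime) * (s * Nat.log 2 s) + S.letterTime + 1 := by
  have := Nat.mul_le_mul_left (S.searchTime + S.letterTime) (mul_log_split h1 h2)
  simp only [itemTime]
  nlinarith

/-- An item of length `1` is written. A longer one is replaced by its parts, and the drop of the
potential pays for reading the item, for computing the far window, and for the splits. -/
theorem Tape.processFront [Fintype I] (hM : S.Fits M n) {it : Item I}
    (h : Tape S M n k σ (it :: l)) :
    ∃ (σ' : Store S.J) (l' : List (Item I)) (o : List T) (t : ℕ),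
      Runs M S.processFront σ.get σ'.get o t ∧ Tape S M n k σ' l' ∧
      o ++ S.wordsOf l' = S.wordsOf (it :: l) ∧
      t + 1 + potential S.itemTime l' ≤ potential S.itemTime (it :: l) := by
  obtain ⟨X, s, r⟩ := it
  have hv := h.valid ⟨X, s, r⟩ (by simp)
  have hs : 1 ≤ s := hv.1
  have htot := h.total_le
  have hsn : s ≤ n := (Nat.le_add_right _ _).trans ((by simp [total] : s + total l = _).trans_le htot)
  obtain ⟨m, hm⟩ : ∃ m, s = m + 1 := ⟨s - 1, by omega⟩
  have h1 := h.initFront hM (m := m) hm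
  obtain ⟨σ₁, g1, g2⟩ := h1.loop_stepFront hM
    (enc_code_mod_ne_zero l fun it hit => h.valid it (by simp [hit])) (by omega)
  rw [show 1 + m = s by omega] at g2
  have g3 := Front.initItem (it := ⟨X, s, r⟩) hM g2 h.valid htot
  have hpot : potential S.itemTime (⟨X, s, r⟩ :: l) = S.itemTime s + potential S.itemTime l := by
    simp [potential]
  have hD : 30 ≤ S.letterTime := Nat.le_add_left _ _
  rcases eq_or_ne s 1 with rfl | hs1
  · have g4 := g3.writeLetter hv.2 Finset.univ.toList (by simp)
    have hlen : (Finset.univ.toList : List I).length = Fintype.card I := by simp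
    refine ⟨_, l, _, Fintype.card I + 11, .seq _ _ _ _ _ [] _ _ _ _
      (Assignment.runs _ _ h1.bdd 0) (.seq _ _ _ _ _ [] _ _ _ (Fintype.card I + 9) g1
        (.seq _ _ _ _ _ [] _ _ _ (Fintype.card I + 5) (Assignment.runs _ _ g3.bdd 0)
          (.iteFalse _ _ _ _ _ _ _ ?_ g4) ?_) ?_) ?_, ?_, ?_, ?_⟩
    · simp [Store.get, g3.s_eq]
    · rw [hlen]; omega
    · omega
    · omega
    · exact ⟨g3.n_eq, g3.k_eq, g3.w_eq, g3.v_eq, g3.rp_valid,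
        by simp [total] at htot ⊢; omega, g3.bdd⟩
    · simp [wordsOf]
    · rw [hpot, itemTime]
      simp [letterTime]
  · obtain ⟨σ', l', t, e1, e2, e3, e4⟩ := g3.splitItem hM S.itemTime
      -- The budget of the current item has only one `letterTime` instead of `letterTime * s`; a
      -- stored part of length `j` gets its linear term from the `j` units of `mul_log_split`. What
      -- is saved pays for the linear costs.
      (fun s => (S.searchTime + S.letterTime) * (s * Nat.log 2 s) + S.letterTime + 1)
      (by simp [itemTime]) (fun s j => splits_le) hv.2 rfl rfl
    refine ⟨σ', l', [], t + 2 * m + 8, .seq _ _ _ _ _ [] [] _ _ _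
      (Assignment.runs _ _ h1.bdd 0) (.seq _ _ _ _ _ [] [] _ _ (t + 2 * m + 5) g1
        (.seq _ _ _ _ _ [] [] _ _ (t + 3) (Assignment.runs _ _ g3.bdd 0)
          (.iteTrue _ _ _ _ _ _ _ ?_ e1) ?_) ?_) ?_, e2, ?_, ?_⟩
    · simp [Store.get, g3.s_eq]; omega
    · omega
    · omega
    · omega
    · rw [List.nil_append, e3, wordsOf_cons]
    · rw [hpot, itemTime]
      dsimp only at e4 ⊢
      -- The margin `letterTime * (s - 1)` covers the blanks, the far window, and constants, because
      -- `letterTime ≥ 30`.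
      have : 4 * s + S.letterTime + 16 ≤ S.letterTime * s := by nlinarith [show 2 ≤ s by omega]
      omega

/-- The potential drops by more than the time used for each item, so it bounds the total time. The
loop stops when only the end marker `1` is left in `w`. -/
theorem Tape.loop_processFront [Fintype I] (hM : S.Fits M n) (h : Tape S M n k σ l) :
    ∃ σ' : Store S.J, Runs M (.loop (.var .w - .const 1) S.processFront) σ.get σ'.get
      (S.wordsOf l) (potential S.itemTime l + 1) ∧ Tape S M n k σ' [] := by
  induction hp : potential S.itemTime l using Nat.strong_induction_on generalizing σ l with
  | _ p ih =>
  cases l with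
  | nil =>
    refine ⟨σ, .loopFalse _ _ _ _ ?_, h⟩
    simp [Store.get, h.w_eq, enc]
  | cons it l =>
    obtain ⟨σ₁, l₁, o, t, g1, g2, g3, g4⟩ := h.processFront hM
    obtain ⟨σ₂, e1, e2⟩ := ih (potential S.itemTime l₁) (by omega) g2 rfl
    refine ⟨σ₂, g3 ▸ .loopTrue _ _ _ _ _ _ _ _ _ _ ?_ g1 e1 (by omega), e2⟩
    have h1 : 1 ≤ S.code it.X := S.code_pos _
    have h2 : S.enc (fun it => S.code it.X) 1 l ≠ 0 := fun h0 =>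
      enc_code_mod_ne_zero (S := S) l (fun it hit => h.valid it (by simp [hit])) (by rw [h0]; simp)
    have h3 : 0 < S.base ^ it.s * S.enc (fun it => S.code it.X) 1 l :=
      Nat.mul_pos (Nat.pow_pos base_pos) (Nat.pos_of_ne_zero h2)
    simp only [Expr.eval_sub, Expr.eval_var, Expr.eval_const, Store.get, h.w_eq, enc]
    omega

/-- The stores after the computation of the window at `n`. -/
structure Ready (S : Sampler T I) (M n k : ℕ) (σ : Store S.J) : Prop where
  n_eq : σ.n = n
  k_eq : σ.k = k
  g_eq : σ.g = (S.base ^ n : ℕ)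
  near_eq : σ.near = S.window n
  bdd : Bdd M σ.get

theorem loop_stepNear (hM : S.Fits M n) (hn : σ.n = n) (hk : σ.k = k) (i j : ℕ) (hj : σ.j = j)
    (hg : σ.g = (S.base ^ j : ℕ)) (hy : σ.near = S.window j) (hb : Bdd M σ.get) (hi : j + i = n) :
    ∃ σ' : Store S.J, Runs M (.loop (.var .n - .var .j) (.upd S.stepNear.expr) : Cmd T _)
      σ.get σ'.get [] (2 * i + 1) ∧ Ready S M n k σ' := by
  induction i generalizing σ j with
  | zero =>
    obtain rfl : j = n := by omega
    refine ⟨σ, .loopFalse _ _ _ 0 ?_, hn, hk, hg, hy, hb⟩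
    simp only [Expr.eval_sub, Expr.eval_var, Store.get, hn, hj]; omega
  | succ i ih =>
    have h1 : (S.stepNear.map σ).j = (j + 1 : ℕ) := by simp [Sampler.stepNear, hj]
    have h2 : (S.stepNear.map σ).near = S.window (j + 1) := by
      simp only [Sampler.stepNear, hj, hy]; exact S.next_window j
    have h3 : (S.stepNear.map σ).g = (S.base ^ (j + 1) : ℕ) := by
      simp only [Sampler.stepNear, hg, pow_succ]; push_cast; rfl
    have b1 := hM.natAbs_le h1 (by omega)
    have b2 := hM.window_bdd h2 (by omega)
    have b3 := hM.natAbs_le_pow h3 (by omega)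
    have hb' : Bdd M (S.stepNear.map σ).get := Store.bdd_of hb fun y => by
      cases y <;> first | exact Or.inl rfl | exact Or.inr b1 | exact Or.inr b3 |
        exact Or.inr (b2 _)
    obtain ⟨σ', g1, g2⟩ := ih (σ := S.stepNear.map σ) hn hk (j + 1) h1 h3 h2 hb' (by omega)
    refine ⟨σ', .loopTrue _ _ _ _ _ [] [] _ _ _ ?_ (Assignment.runs _ σ hb' 0) g1 (by omega), g2⟩
    simp only [Expr.eval_sub, Expr.eval_var, Store.get, hn, hj]; omega

theorem runs_prepare (hM : S.Fits M n) (hn : σ.n = n) (hk : σ.k = k) (hb : Bdd M σ.get) :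
    ∃ σ' : Store S.J, Runs M (S.prepare : Cmd T _) σ.get σ'.get [] (2 * n + 3) ∧
      Ready S M n k σ' := by
  have b3 : ((0 : ℕ) : ℤ).natAbs ≤ M := hM.natAbs_le rfl (by omega)
  have b4 : ((1 : ℕ) : ℤ).natAbs ≤ M := hM.natAbs_le rfl (by omega)
  have b5 := hM.window_le (m := 0) (by omega)
  have hb' : Bdd M (S.initNear.map σ).get := Store.bdd_of hb fun y => by
    cases y <;> first | exact Or.inl rfl | exact Or.inr b3 | exact Or.inr b4 |
      exact Or.inr (b5 _)
  obtain ⟨σ', g1, g2⟩ := loop_stepNear (σ := S.initNear.map σ) hM hn hk n 0 rfl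
    (by simp [initNear]) rfl hb' (by omega)
  exact ⟨σ', .seq _ _ _ _ _ [] [] _ _ _ (Assignment.runs _ σ hb' 0) g1 (by omega), g2⟩

/-- The words written by the program: those derived from the initial symbol, and the empty
word. -/
noncomputable def outputs (S : Sampler T I) (n : ℕ) : List (List T) :=
  if n = 0 then [[]] else S.g.words S.start n

/-- The tape begins with the single item of the drawn rank, or empty for `n = 0`, since no symbol
derives the empty word. -/
theorem Ready.generate [Fintype I] (hM : S.Fits M n) (h : Ready S M n (k + 1) σ) {u : ℕ}
    (hu : σ.u = u) {w : List T} (hw : (S.outputs n)[u]? = some w) :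
    ∃ σ' : Store S.J, Runs M S.generate σ.get σ'.get w (S.itemTime n + 5) ∧ σ'.n = n ∧
      σ'.k = k ∧ Bdd M σ'.get := by
  obtain ⟨l, hl1, hl2, hl3, hl4, hl5, hl6⟩ : ∃ l : List (Item I),
      (∀ it ∈ l, S.Valid it) ∧ total l ≤ n ∧ S.wordsOf l = w ∧
      potential S.itemTime l ≤ S.itemTime n ∧
      (S.initTape.map σ).w = (S.enc (fun it => S.code it.X) 1 l : ℕ) ∧
      (S.initTape.map σ).v = (S.enc (fun it => it.r) 0 l : ℕ) := by
    rcases Nat.eq_zero_or_pos n with rfl | hn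
    · rw [outputs, if_pos rfl] at hw
      obtain ⟨h1, h2⟩ := List.getElem?_eq_some_iff.mp hw
      obtain rfl : u = 0 := by simpa using h1
      refine ⟨[], by simp, by simp [total], by simpa [wordsOf] using h2, by simp [potential], ?_, ?_⟩
      · simp [initTape, h.n_eq, enc]
      · simp [initTape, hu, enc]
    · rw [outputs, if_neg hn.ne'] at hw
      obtain ⟨h1, h2⟩ := getElem?_of_valid hw
      refine ⟨[⟨S.start, n, u⟩], by simpa [Valid] using ⟨hn, h1⟩, by simp [total],
        by simpa [wordsOf] using h2, by simp [potential], ?_, ?_⟩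
      · simp [initTape, h.n_eq, hn, enc, h.g_eq]
      · simp [initTape, hu, enc]
  have b1 := natAbs_le_of_eq hl5 ((enc_lt _ 1 1 (by have := S.two_le_base; simp; omega) _
    fun it' h' => (hl1 it' h').code_lt).le.trans (hM.pow_le (by omega)))
  have b2 := natAbs_le_of_eq hl6 ((enc_lt _ 0 0 (by simp) _ fun it' h' =>
    (hl1 it' h').rank_lt).le.trans (hM.pow_le (by omega)))
  have hb : Bdd M (S.initTape.map σ).get := Store.bdd_of h.bdd fun y => by
    cases y <;> first | exact Or.inl rfl | exact Or.inr b1 | exact Or.inr b2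
  have h1 : Tape S M n (k + 1) (S.initTape.map σ) l :=
    ⟨h.n_eq, h.k_eq, hl5, hl6, hl1, hl2, hb⟩
  obtain ⟨σ₁, g1, g2⟩ := h1.loop_processFront hM
  have hk : (S.countDown.map σ₁).k = k := by simp [countDown, g2.k_eq]
  have b3 : (S.countDown.map σ₁).k.natAbs ≤ M := by
    have := g2.bdd .k
    rw [Store.get, g2.k_eq, Int.natAbs_natCast] at this
    exact natAbs_le_of_eq hk (by omega)
  have hb' : Bdd M (S.countDown.map σ₁).get := Store.bdd_of g2.bdd fun y => by
    cases y <;> first | exact Or.inl rfl | exact Or.inr b3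
  refine ⟨S.countDown.map σ₁, ?_, g2.n_eq, hk, hb'⟩
  have := Runs.seq _ _ _ _ _ [] _ _ _ (S.itemTime n + 5) (Assignment.runs _ _ hb 0)
    (Runs.seq _ _ _ _ _ _ [] _ _ _ g1 (Assignment.runs _ _ hb' 0) le_rfl) (by omega)
  rw [List.nil_append, List.append_nil, hl3] at this
  exact this

end Sampler

end HalfPlane

namespace HalfPlane

/-! ### Random executions -/

section Execution

variable {T : Type} {R : ℕ}

theorem run_succ (c : Config T R) (t : ℕ) : run c (t + 1) = (step c).bind fun c₁ => run c₁ t := by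
  induction t with
  | zero => simp [run]
  | succ t ih =>
    rw [run, ih, PMF.bind_bind]
    rfl

/-- Whatever the random draws are, the execution started from `c` has all registers bounded by
`M` at any time and halts after at most `t` steps; the law of its output is `μ`. -/
structure Good (M t : ℕ) (c : Config T R) (μ : PMF (List T)) : Prop where
  bdd : ∀ s, ∀ c' ∈ (run c s).support, Bdd M c'.regs
  halts : ∀ c' ∈ (run c t).support, c'.todo = []
  law : (run c t).map Config.out = μ

theorem step_of_todo_eq_nil {c : Config T R} (h : c.todo = []) : step c = PMF.pure c := by
  obtain ⟨K, ρ, o⟩ := c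
  obtain rfl : K = [] := h
  rfl

theorem run_of_todo_eq_nil {c : Config T R} (h : c.todo = []) (t : ℕ) :
    run c t = PMF.pure c := by
  induction t with
  | zero => rfl
  | succ t ih => rw [run, ih, PMF.pure_bind, step_of_todo_eq_nil h]

theorem Good.of_todo_eq_nil {M : ℕ} {c : Config T R} (h : c.todo = []) (hb : Bdd M c.regs)
    (t : ℕ) : Good M t c (PMF.pure c.out) := by
  refine ⟨fun s c' hc' => ?_, fun c' hc' => ?_, ?_⟩
  · rw [run_of_todo_eq_nil h] at hc'
    simp only [PMF.support_pure, Set.mem_singleton_iff] at hc'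
    rwa [hc']
  · rw [run_of_todo_eq_nil h] at hc'
    simp only [PMF.support_pure, Set.mem_singleton_iff] at hc'
    rwa [hc']
  · rw [run_of_todo_eq_nil h, PMF.pure_map]

theorem bind_congr_support {α β : Type*} (p : PMF α) {f g : α → PMF β}
    (h : ∀ a ∈ p.support, f a = g a) : p.bind f = p.bind g := by
  ext b
  rw [PMF.bind_apply, PMF.bind_apply]
  refine tsum_congr fun a => ?_
  by_cases ha : a ∈ p.support
  · rw [h a ha]
  · rw [PMF.apply_eq_zero_iff _ _ |>.mpr ha, zero_mul, zero_mul]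

/-- A halted configuration is a fixed point of the execution. -/
theorem Good.mono {M t t' : ℕ} {c : Config T R} {μ : PMF (List T)} (h : Good M t c μ)
    (ht : t ≤ t') : Good M t' c μ := by
  suffices run c t' = run c t by
    exact ⟨h.bdd, by rw [this]; exact h.halts, by rw [this]; exact h.law⟩
  induction t', ht using Nat.le_induction with
  | base => rfl
  | succ s _ ih =>
    rw [run, ih, bind_congr_support _ fun a ha => step_of_todo_eq_nil (h.halts a ha), PMF.bind_pure]

/-- The execution is conditioned on its first step; the time and memory bounds hold for all
outcomes, and the laws are mixed by `ν`. -/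
theorem Good.bind {α : Type*} {M t : ℕ} {c : Config T R} (ν : PMF α) (F : α → Config T R)
    (μ : α → PMF (List T)) (hs : step c = ν.map F) (hb : Bdd M c.regs)
    (h : ∀ a ∈ ν.support, Good M t (F a) (μ a)) : Good M (t + 1) c (ν.bind μ) := by
  have hrun : ∀ s, run c (s + 1) = ν.bind fun a => run (F a) s := fun s => by
    rw [run_succ, hs, PMF.bind_map]; rfl
  refine ⟨fun s c' hc' => ?_, fun c' hc' => ?_, ?_⟩
  · cases s with
    | zero =>
      simp only [run, PMF.support_pure, Set.mem_singleton_iff] at hc'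
      rwa [hc']
    | succ s =>
      rw [hrun, PMF.mem_support_bind_iff] at hc'
      obtain ⟨a, ha, hc'⟩ := hc'
      exact (h a ha).bdd s c' hc'
  · rw [hrun, PMF.mem_support_bind_iff] at hc'
    obtain ⟨a, ha, hc'⟩ := hc'
    exact (h a ha).halts c' hc'
  · rw [hrun, PMF.map_bind]
    exact bind_congr_support _ fun a ha => (h a ha).law

theorem Good.step {M t : ℕ} {c c₁ : Config T R} {μ : PMF (List T)} (hs : step c = PMF.pure c₁)
    (hb : Bdd M c.regs) (h : Good M t c₁ μ) : Good M (t + 1) c μ := by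
  have := Good.bind (M := M) (t := t) (c := c) (PMF.pure c₁) id (fun _ => μ)
    (by rw [hs, PMF.map_id]) hb (fun a ha => by
      simp only [PMF.support_pure, Set.mem_singleton_iff] at ha
      rw [ha]; exact h)
  rwa [PMF.pure_bind] at this

theorem Good.steps {M s t : ℕ} {c c' : Config T R} {μ : PMF (List T)} (h : Steps M s c c')
    (hb : Bdd M c.regs) (hg : Good M t c' μ) : Good M (s + t) c μ := by
  induction h with
  | refl s c => exact hg.mono (by omega)
  | head s c c₁ c' hs hb₁ _ ih =>
    rw [add_right_comm]
    exact Good.step hs hb (ih hb₁ hg)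

end Execution

/-! ### The law of a sequence of independent words -/

section Law

variable {T : Type}

/-- The law of `out` followed by `k` independent uniform random elements of the list `l`
of length `N + 1`. -/
noncomputable def wordLaw (l : List (List T)) (N : ℕ) : ℕ → List T → PMF (List T)
  | 0, out => PMF.pure out
  | k + 1, out => (PMF.uniformOfFintype (Fin (N + 1))).bind fun i =>
      wordLaw l N k (out ++ (l[i.val]?).getD [])

-- All words of `l` have the same length and are distinct, so an output can be decoded: the first
-- draw is determined by the first `m` letters, and only one term of the sum over the first draw can
-- be nonzero.
open Classical in
theorem wordLaw_apply {l : List (List T)} {N m : ℕ} (hl : l.length = N + 1) (hnd : l.Nodup)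
    (hm : ∀ w ∈ l, w.length = m) (k : ℕ) (out o : List T) :
    wordLaw l N k out o =
      if ∃ ws : Fin k → List T, (∀ i, ws i ∈ l) ∧ o = out ++ (List.ofFn ws).flatten
      then (((N + 1 : ℕ) : ENNReal) ^ k)⁻¹ else 0 := by
  induction k generalizing out with
  | zero =>
    rw [wordLaw, PMF.pure_apply]
    simp
  | succ k ih =>
    have hget : ∀ i : Fin (N + 1), (l[i.val]?).getD [] = l[i.val]'(by omega) := fun i => by
      rw [List.getElem?_eq_getElem]; rfl
    rw [wordLaw, PMF.bind_apply, tsum_fintype]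
    simp only [PMF.uniformOfFintype_apply, Fintype.card_fin, ih, hget]
    by_cases hex : ∃ ws : Fin (k + 1) → List T, (∀ i, ws i ∈ l) ∧
        o = out ++ (List.ofFn ws).flatten
    · rw [if_pos hex]
      obtain ⟨ws, hws, rfl⟩ := hex
      obtain ⟨i, hi, hwi⟩ := List.mem_iff_getElem.mp (hws 0)
      rw [Finset.sum_eq_single ⟨i, by omega⟩]
      · rw [if_pos, pow_succ', ENNReal.mul_inv (by simp) (by simp)]
        refine ⟨fun j => ws j.succ, fun j => hws _, ?_⟩
        simp [List.ofFn_succ, hwi]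
      · intro j _ hj
        rw [if_neg, mul_zero]
        rintro ⟨ws', hws', he⟩
        rw [List.append_assoc, List.append_cancel_left_eq, List.ofFn_succ, List.flatten_cons] at he
        have h1 := List.append_inj_left he (by
          rw [hm _ (hws 0), hm _ (List.getElem_mem _)])
        rw [← hwi] at h1
        have h2 : i = j.val := (hnd.getElem_inj_iff).mp h1
        exact hj (Fin.ext h2.symm)
      · simp
    · rw [if_neg hex]
      refine Finset.sum_eq_zero fun i _ => ?_
      rw [if_neg, mul_zero]
      rintro ⟨ws, hws, he⟩
      refine hex ⟨Fin.cons (l[i.val]'(by omega)) ws, fun j => ?_, ?_⟩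
      · refine Fin.cases ?_ (fun j => ?_) j
        · exact List.getElem_mem _
        · exact hws j
      · rw [he]; simp [List.ofFn_succ]

end Law

/-- Two transpositions move `y` and `z` to the input registers `0` and `1`. The index of a temporary
is reduced modulo `D + 1` to make the map total. -/
theorem exists_layout {V : Type} [Fintype V] (D : ℕ) {y z : V} (hyz : y ≠ z) :
    ∃ (r : ℕ) (l : Layout V D (r + 2)), l.val y = 0 ∧ l.val z = 1 := by
  classical
  obtain ⟨r, hr⟩ : ∃ r, Fintype.card (V ⊕ V ⊕ Fin (D + 1)) = r + 2 := by
    have : 1 < Fintype.card V := Fintype.one_lt_card_iff.mpr ⟨y, z, hyz⟩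
    refine ⟨Fintype.card (V ⊕ V ⊕ Fin (D + 1)) - 2, ?_⟩
    simp only [Fintype.card_sum]; omega
  let e₀ : V ⊕ V ⊕ Fin (D + 1) ≃ Fin (r + 2) := Fintype.equivFinOfCardEq hr
  let e₁ := e₀.trans (Equiv.swap (e₀ (.inl y)) 0)
  let e := e₁.trans (Equiv.swap (e₁ (.inl z)) 1)
  have hy₁ : e₁ (.inl y) = 0 := by simp [e₁]
  have hz : e (.inl z) = 1 := by simp [e]
  have hy : e (.inl y) = 0 := by
    have h1 : e₁ (.inl z) ≠ 0 := by
      rw [← hy₁]; intro h; exact hyz (Sum.inl_injective (e₁.injective h)).symm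
    simp only [e, Equiv.trans_apply, hy₁]
    exact Equiv.swap_apply_of_ne_of_ne h1.symm (by simp)
  exact ⟨r, {
    val := fun x => e (.inl x)
    copy := fun x => e (.inr (.inl x))
    tmp := fun i => e (.inr (.inr ⟨i % (D + 1), Nat.mod_lt _ (Nat.succ_pos _)⟩))
    val_inj := fun a b h => Sum.inl_injective (e.injective h)
    copy_inj := fun a b h => Sum.inl_injective (Sum.inr_injective (e.injective h))
    tmp_inj := fun i hi j hj h => by
      have := Sum.inr_injective (Sum.inr_injective (e.injective h))
      rwa [Fin.mk.injEq, Nat.mod_eq_of_lt (by omega), Nat.mod_eq_of_lt (by omega)] at this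
    val_ne_copy := fun a b h => by simpa using e.injective h
    val_ne_tmp := fun a b h => by simpa using e.injective h
    copy_ne_tmp := fun a b h => by simpa using e.injective h }, hy, hz⟩

/-- The store with given values. -/
def Store.ofFun {J : Type} (f : Var J → ℤ) : Store J where
  n := f .n
  k := f .k
  u := f .u
  w := f .w
  v := f .v
  x := f .x
  s := f .s
  r := f .r
  g := f .g
  wl := f .wl
  vl := f .vl
  pl := f .pl
  j := f .j
  found := f .found
  near q := f (.near q)
  far q := f (.far q)

@[simp] theorem Store.get_ofFun {J : Type} (f : Var J → ℤ) : (Store.ofFun f).get = f := by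
  funext y; cases y <;> rfl

/-! ### The sampling program -/

namespace Sampler

variable {T I : Type} [DecidableEq I] [Fintype I] (S : Sampler T I) {D R : ℕ}

/-- The loop body of the sampling program. -/
noncomputable def drawWord (l : Layout (Var S.J) D R) : Prog T R :=
  .seq (S.prepare.compile l)
    (.seq (.rand (l.val .u) (l.val (.near (S.start, 0)))) (S.generate.compile l))

/-- The sampling program. -/
noncomputable def program (l : Layout (Var S.J) D R) : Prog T R :=
  .whilePos (l.val .k) (S.drawWord l)

/-- The number of instructions executed for each step of a command. -/
noncomputable def rate : ℕ :=
  (S.prepare : Cmd T (Var S.J)).cost + (S.generate : Cmd T (Var S.J)).cost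

/-- The number of temporary registers. -/
noncomputable def temporaries : ℕ :=
  (S.prepare : Cmd T (Var S.J)).depth + (S.generate : Cmd T (Var S.J)).depth

/-- The exponent of the bound on the numbers in the registers. -/
noncomputable def exponent : ℕ :=
  (S.prepare : Cmd T (Var S.J)).size + (S.generate : Cmd T (Var S.J)).size + 1

/-- The number of instructions executed for each word. -/
noncomputable def wordTime (n : ℕ) : ℕ := S.rate * (2 * n + 8 + S.itemTime n) + 4

variable {S}

/-- Induction on the number of words still to be written. The count of words of length `n` is
recomputed for every word, in linear time, because the search overwrites the near window. Variables
are bounded by `M`, and all registers by `M ^ S.exponent`. -/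
theorem good_program {M n : ℕ} (hM : S.Fits M n) (l : Layout (Var S.J) D R)
    (hD : S.temporaries ≤ D) (hne : S.outputs n ≠ []) (k : ℕ) (ρ : Fin R → ℤ) (out : List T)
    (hn : ρ (l.val .n) = n) (hk : ρ (l.val .k) = k) (hb : ∀ y, (ρ (l.val y)).natAbs ≤ M)
    (hb' : Bdd (M ^ S.exponent) ρ) :
    Good (M ^ S.exponent) (k * S.wordTime n + 1) ⟨[S.program l], ρ, out⟩
      (wordLaw (S.outputs n) (S.g.count S.start n - 1) k out) := by
  have hM2 : 2 ≤ M := hM.le (by omega)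
  have hMM : ∀ a, a ≤ S.exponent → M ^ a ≤ M ^ S.exponent := fun a h =>
    Nat.pow_le_pow_right (by omega) h
  induction k generalizing ρ out with
  | zero =>
    refine (Good.step (c₁ := ⟨[], ρ, out⟩) ?_ hb' (Good.of_todo_eq_nil rfl hb' 0)).mono (by omega)
    simp [program, HalfPlane.step, hk]
  | succ k ih =>
    obtain ⟨σ₁, h1, h2⟩ := runs_prepare (σ := Store.ofFun fun y => ρ (l.val y)) (k := k + 1) hM hn
      (by simpa [Store.ofFun] using hk) (by simpa [Bdd] using hb)
    have hσ₁ := h1.bdd (by simpa [Bdd] using hb)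
    obtain ⟨ρ₁, e1, e2, e3⟩ := h1.steps l S.rate (M ^ S.exponent) hM2 (Nat.le_add_right _ _)
      ((Nat.le_add_right _ _).trans hD) (hMM _ (by unfold exponent; omega))
      (by simpa [Bdd] using hb)
      (.seq (.rand (l.val .u) (l.val (.near (S.start, 0)))) (S.generate.compile l) ::
        [S.program l]) ρ out (by simp) hb'
    rw [List.append_nil] at e3
    have hcount : ρ₁ (l.val (.near (S.start, 0))) = (S.g.count S.start n : ℕ) := by
      rw [e1, Store.get, h2.near_eq]; rfl
    -- For `n = 0` the count is `0`, and the draw then gives `0`, the rank of the empty word.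
    have hlen : S.g.count S.start n - 1 + 1 = (S.outputs n).length := by
      rw [outputs] at hne ⊢
      split_ifs at hne ⊢ with h0
      · rw [h0, BinaryGrammar.count_zero]; simp
      · have := List.length_pos_iff.mpr hne
        rw [BinaryGrammar.count]; omega
    have hdraw : Good (M ^ S.exponent) (S.rate * (S.itemTime n + 5) + (k * S.wordTime n + 1) + 1)
        ⟨.rand (l.val .u) (l.val (.near (S.start, 0))) :: S.generate.compile l :: [S.program l],
          ρ₁, out⟩ (wordLaw (S.outputs n) (S.g.count S.start n - 1) (k + 1) out) := by
      rw [wordLaw]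
      refine Good.bind (PMF.uniformOfFintype (Fin (S.g.count S.start n - 1 + 1)))
        (fun i => ⟨S.generate.compile l :: [S.program l],
          Function.update ρ₁ (l.val .u) (i.val : ℤ), out⟩) _ ?_ e2 fun i _ => ?_
      · rw [HalfPlane.step, hcount, uniformBelow, PMF.map_comp]; rfl
      set σ₂ : Store S.J := { σ₁ with u := i.val } with hσ₂
      have hi : i.val ≤ M := by
        have h3 := i.isLt
        have h4 := S.count_le S.start n
        have h5 := hM.pow_le (m := n) (by omega)
        omega
      have hbσ₂ : Bdd M σ₂.get := Store.bdd_of hσ₁ fun y => by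
        cases y <;> first | exact Or.inl rfl | exact Or.inr (natAbs_le_of_eq rfl hi)
      have hr : Ready S M n (k + 1) σ₂ := ⟨h2.n_eq, h2.k_eq, h2.g_eq, h2.near_eq, hbσ₂⟩
      have hw : (S.outputs n)[i.val]? = some (((S.outputs n)[i.val]?).getD []) := by
        rw [List.getElem?_eq_getElem (by omega)]; rfl
      obtain ⟨σ₃, g1, g2, g3, g4⟩ := hr.generate hM rfl hw
      obtain ⟨ρ₃, d1, d2, d3⟩ := g1.steps l S.rate (M ^ S.exponent) hM2 (Nat.le_add_left _ _)
        ((Nat.le_add_left _ _).trans hD) (hMM _ (by unfold exponent; omega)) hbσ₂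
        [S.program l] (Function.update ρ₁ (l.val .u) (i.val : ℤ)) out
        (fun y => by
          by_cases hy : y = .u
          · rw [hy, Function.update_self]; rfl
          · rw [Function.update_of_ne (fun h => hy (l.val_inj h)), e1]
            cases y <;> first | rfl | exact absurd rfl hy)
        (fun y => by
          by_cases hy : y = l.val .u
          · rw [hy, Function.update_self, Int.natAbs_natCast]
            exact hi.trans (Nat.le_self_pow (by unfold exponent; omega) _)
          · rw [Function.update_of_ne hy]; exact e2 y)
      refine Good.steps d3 ?_ (ih ρ₃ _ (by rw [d1]; exact g2) (by rw [d1]; exact g3)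
        (fun y => by rw [d1]; exact g4 y) d2)
      intro y
      by_cases hy : y = l.val .u
      · simp only [hy, Function.update_self, Int.natAbs_natCast]
        exact hi.trans (Nat.le_self_pow (by unfold exponent; omega) _)
      · simp only [Function.update_of_ne hy]; exact e2 y
    have hseq := Good.steps e3 hb' (Good.step rfl e2 hdraw)
    refine (Good.step (c₁ := ⟨S.drawWord l :: [S.program l], ρ, out⟩) ?_ hb'
      (Good.step rfl hb' hseq)).mono (le_of_eq ?_)
    · simp [program, HalfPlane.step, hk]
    · simp only [wordTime]; ring

/-- A bound on the bit length of the numbers in the registers. -/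
noncomputable def bitBound (S : Sampler T I) (n k : ℕ) : ℕ :=
  S.exponent * (S.base * (n + S.order + 2) + Nat.log 2 k + 2)

theorem lt_two_pow_bitBound (n k : ℕ) :
    (S.base ^ (n + S.order + 2) + k) ^ S.exponent < 2 ^ S.bitBound n k := by
  rw [bitBound, mul_comm, pow_mul]
  refine Nat.pow_lt_pow_left ?_ (by unfold exponent; omega)
  have h1 : S.base ^ (n + S.order + 2) ≤ 2 ^ (S.base * (n + S.order + 2)) := by
    rw [pow_mul]
    exact Nat.pow_le_pow_left Nat.lt_two_pow_self.le _
  have h2 : k < 2 ^ (Nat.log 2 k + 1) := Nat.lt_pow_succ_log_self one_lt_two k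
  have h3 : 1 ≤ 2 ^ (S.base * (n + S.order + 2)) := Nat.one_le_two_pow
  have h4 : 1 ≤ 2 ^ (Nat.log 2 k + 1) := Nat.one_le_two_pow
  have h5 : 2 ^ (S.base * (n + S.order + 2) + Nat.log 2 k + 2) =
      2 ^ (S.base * (n + S.order + 2)) * 2 ^ (Nat.log 2 k + 1) * 2 := by
    rw [← pow_add, ← pow_succ]; rfl
  rw [h5]
  generalize 2 ^ (S.base * (n + S.order + 2)) = y at *
  generalize 2 ^ (Nat.log 2 k + 1) = z at *
  nlinarith

theorem natLog_le_real_log {n : ℕ} (hn : 1 ≤ n) : (Nat.log 2 n : ℝ) ≤ 2 * Real.log n := by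
  have h1 : (2 : ℝ) ^ Nat.log 2 n ≤ n := by
    exact_mod_cast Nat.pow_log_le_self 2 (by omega)
  have h2 := Real.log_le_log (by positivity) h1
  rw [Real.log_pow] at h2
  have h3 : (1 : ℝ) / 2 ≤ Real.log 2 := by linarith [Real.log_two_gt_d9]
  nlinarith [(Nat.cast_nonneg (Nat.log 2 n) : (0 : ℝ) ≤ _)]

/-- As `n ≥ 2`, the logarithm is at least `1` and absorbs linear and constant terms. -/
theorem wordTime_le {n k : ℕ} (hn : 2 ≤ n) (hk : 1 ≤ k) : k * S.wordTime n + 1 ≤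
    (S.rate * (6 + S.searchTime + 2 * S.letterTime) + 5) * (k * (n * Nat.log 2 n)) := by
  have h1 : 1 ≤ Nat.log 2 n := Nat.log_pos one_lt_two hn
  have h2 : n ≤ n * Nat.log 2 n := Nat.le_mul_of_pos_right _ h1
  have h3 : S.wordTime n ≤
      (S.rate * (6 + S.searchTime + 2 * S.letterTime) + 4) * (n * Nat.log 2 n) := by
    have h4 : 2 * n + 8 + S.itemTime n ≤
        (6 + S.searchTime + 2 * S.letterTime) * (n * Nat.log 2 n) := by
      simp only [itemTime]; nlinarith
    have h5 := Nat.mul_le_mul_left S.rate h4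
    simp only [wordTime]; nlinarith
  have h6 := Nat.mul_le_mul_left k h3
  nlinarith [Nat.mul_le_mul hk (h2.trans' hn)]

open Classical in
theorem exists_program (S : Sampler T I) (hne : ∀ n, S.outputs n ≠ [])
    (hnd : ∀ n, (S.outputs n).Nodup) (hlen : ∀ n, ∀ w ∈ S.outputs n, w.length = n) :
    ∃ (r : ℕ) (p : Prog T (r + 2)) (time bits : ℕ → ℕ → ℕ),
      (∀ n k : ℕ, HaltsWithin p n k (time n k) ∧
        (∀ o, outputDist p n k (time n k) o =
          if ∃ ws : Fin k → List T, (∀ i, ws i ∈ S.outputs n) ∧ o = (List.ofFn ws).flatten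
          then (((S.outputs n).length : ENNReal) ^ k)⁻¹ else 0) ∧
        StoresBits p n k (bits n k)) ∧
      ∃ C : ℝ, ∀ n k : ℕ, 2 ≤ n → 1 ≤ k →
        (time n k : ℝ) ≤ C * (k * (n * Real.log n)) ∧
        (bits n k : ℝ) ≤ C * (n + Real.log k) := by
  obtain ⟨r, l, hln, hlk⟩ := exists_layout S.temporaries (y := (.n : Var S.J)) (z := .k) (by simp)
  refine ⟨r, S.program l, fun n k => k * S.wordTime n + 1, S.bitBound, fun n k => ?_, ?_⟩
  -- The summand `k` is there because a register counts the words still to be written.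
  · set M := S.base ^ (n + S.order + 2) + k with hMdef
    have hM : S.Fits M n := Nat.le_add_right _ _
    have hnM : n ≤ M := hM.le (by omega)
    have hinit : ∀ x, ((init (S.program l) n k).regs x).natAbs ≤ M := by
      intro x
      simp only [init]
      split_ifs
      · simpa using hnM
      · rw [Int.natAbs_natCast]; exact Nat.le_add_left _ _
      · simp
    have hg := good_program hM l le_rfl (hne n) k (init (S.program l) n k).regs []
      (by rw [hln]; simp [init]) (by rw [hlk]; simp [init]) (fun y => hinit _)
      (fun y => (hinit y).trans (Nat.le_self_pow (by unfold exponent; omega) _))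
    have hlen' : (S.outputs n).length = S.g.count S.start n - 1 + 1 := by
      have := hne n
      rw [outputs] at this ⊢
      split_ifs at this ⊢ with h0
      · rw [h0, BinaryGrammar.count_zero]; simp
      · have := List.length_pos_iff.mpr this
        rw [BinaryGrammar.count]; omega
    refine ⟨hg.halts, fun o => ?_, fun t c hc x => ?_⟩
    · have h1 := congrArg (fun μ => μ o) hg.law
      refine Eq.trans h1 ?_
      rw [wordLaw_apply hlen' (hnd n) (hlen n), hlen']
      simp
    · exact Nat.size_le.mpr ((hg.bdd t c hc x).trans_lt (lt_two_pow_bitBound n k))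
  · set c₁ := S.rate * (6 + S.searchTime + 2 * S.letterTime) + 5
    set c₂ := S.exponent * (S.base * (S.order + 3) + 2)
    refine ⟨2 * (c₁ + c₂ : ℕ), fun n k hn hk => ⟨?_, ?_⟩⟩
    · have h1 : ((k * S.wordTime n + 1 : ℕ) : ℝ) ≤ (c₁ * (k * (n * Nat.log 2 n)) : ℕ) := by
        exact_mod_cast wordTime_le hn hk
      refine h1.trans ?_
      push_cast
      have h2 := natLog_le_real_log (n := n) (by omega)
      have h3 : (0 : ℝ) ≤ Real.log n := Real.log_natCast_nonneg n
      calc (c₁ : ℝ) * (k * (n * Nat.log 2 n)) ≤ c₁ * (k * (n * (2 * Real.log n))) := by gcongr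
        _ ≤ (c₁ + c₂) * (k * (n * (2 * Real.log n))) := by gcongr; simp
        _ = _ := by ring
    · have h2 := natLog_le_real_log hk
      have h3 : (0 : ℝ) ≤ Real.log k := Real.log_natCast_nonneg k
      have h4 : S.bitBound n k ≤ c₂ * (n + Nat.log 2 k) := by
        rw [bitBound, mul_assoc]
        refine Nat.mul_le_mul_left _ ?_
        nlinarith [Nat.zero_le (S.base * (S.order + 3) * Nat.log 2 k), Nat.zero_le (S.base * S.order),
          Nat.mul_le_mul_left (S.base * (S.order + 2)) (show 1 ≤ n by omega)]
      have h5 : (S.bitBound n k : ℝ) ≤ c₂ * (n + Nat.log 2 k) := by exact_mod_cast h4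
      refine h5.trans ?_
      push_cast
      calc (c₂ : ℝ) * (n + Nat.log 2 k) ≤ c₂ * (2 * n + 2 * Real.log k) := by
            gcongr
            have : (0 : ℝ) ≤ n := Nat.cast_nonneg n
            linarith
        _ ≤ (c₁ + c₂) * (2 * n + 2 * Real.log k) := by gcongr; simp
        _ = _ := by ring

end Sampler

end HalfPlane

namespace HalfPlane

/-! ### Prefixes -/

section Prefixes

variable {T : Type}

theorem prefix_append_iff {p u v : List T} :
    p <+: u ++ v ↔ p <+: u ∨ ∃ q, q ≠ [] ∧ q <+: v ∧ p = u ++ q := by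
  constructor
  · intro h
    rcases le_or_gt p.length u.length with hl | hl
    · exact Or.inl (List.prefix_of_prefix_length_le h (List.prefix_append u v) hl)
    · obtain ⟨q, rfl⟩ := List.prefix_of_prefix_length_le (List.prefix_append u v) h hl.le
      refine Or.inr ⟨q, ?_, (List.prefix_append_right_inj u).mp h, rfl⟩
      rintro rfl
      simp at hl
  · rintro (h | ⟨q, -, h, rfl⟩)
    · exact h.trans (List.prefix_append u v)
    · exact (List.prefix_append_right_inj u).mpr h

theorem length_lt_of_prefix {p u : List T} (h : p <+: u) (hne : p ≠ u) : p.length < u.length :=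
  lt_of_le_of_ne h.length_le fun he => hne (h.eq_of_length he)

/-- `u` is the shortest nonempty prefix of itself with the property `Q`. -/
structure IsFirst (Q : List T → Prop) (u : List T) : Prop where
  ne_nil : u ≠ []
  holds : Q u
  not_before : ∀ p, p <+: u → p ≠ [] → p ≠ u → ¬ Q p

theorem exists_isFirst {Q : List T → Prop} {w p : List T} (hp : p ≠ []) (hw : p <+: w)
    (hQ : Q p) : ∃ u v, w = u ++ v ∧ IsFirst Q u := by
  classical
  have hex : ∃ n, ∃ p : List T, p ≠ [] ∧ p <+: w ∧ Q p ∧ p.length = n := ⟨_, p, hp, hw, hQ, rfl⟩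
  obtain ⟨u, h1, h2, h3, h4⟩ := Nat.find_spec hex
  obtain ⟨v, hv⟩ := h2
  refine ⟨u, v, hv.symm, h1, h3, fun q hq hq0 hne hQq => ?_⟩
  exact Nat.find_min hex (m := q.length) (h4 ▸ length_lt_of_prefix hq hne)
    ⟨q, hq0, hq.trans ⟨v, hv⟩, hQq, rfl⟩

/-- Two prefixes of one word are comparable, and the shorter would contradict the minimality of the
longer. The uniqueness of factorizations below comes from this fact and its mirror image
`IsLast.eq`. -/
theorem IsFirst.eq {Q : List T → Prop} {u v u' v' : List T} (h : IsFirst Q u) (h' : IsFirst Q u')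
    (he : u ++ v = u' ++ v') : u = u' ∧ v = v' := by
  have : u = u' := by
    by_contra hne
    rcases List.prefix_or_prefix_of_prefix (List.prefix_append u v)
      (he ▸ List.prefix_append u' v') with hp | hp
    · exact h'.not_before u hp h.ne_nil hne h.holds
    · exact h.not_before u' hp h'.ne_nil (Ne.symm hne) h'.holds
  subst this
  exact ⟨rfl, List.append_cancel_left he⟩

/-- `u` is the longest prefix of `u ++ v` with the property `Q`. -/
structure IsLast (Q : List T → Prop) (u v : List T) : Prop where
  holds : Q u
  not_after : ∀ q, q <+: v → q ≠ [] → ¬ Q (u ++ q)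

theorem exists_isLast {Q : List T → Prop} {w p : List T} (hw : p <+: w) (hQ : Q p) :
    ∃ u v, w = u ++ v ∧ IsLast Q u v := by
  classical
  have hex : ∃ n, ∃ p : List T, p <+: w ∧ Q p ∧ w.length - p.length = n := ⟨_, p, hw, hQ, rfl⟩
  obtain ⟨u, h2, h3, h4⟩ := Nat.find_spec hex
  obtain ⟨v, rfl⟩ := h2
  refine ⟨u, v, rfl, h3, fun q hq hq0 hQq => ?_⟩
  have hl := hq.length_le
  have hl0 := List.length_pos_iff.mpr hq0
  refine Nat.find_min hex (m := (u ++ v).length - (u ++ q).length) ?_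
    ⟨u ++ q, (List.prefix_append_right_inj u).mpr hq, hQq, rfl⟩
  rw [← h4]
  simp only [List.length_append]
  omega

theorem IsLast.eq {Q : List T → Prop} {u v u' v' : List T} (h : IsLast Q u v)
    (h' : IsLast Q u' v') (he : u ++ v = u' ++ v') : u = u' ∧ v = v' := by
  have key : ∀ {u v u' v' : List T}, IsLast Q u v → IsLast Q u' v' → u ++ v = u' ++ v' →
      u <+: u' → u = u' := by
    rintro u v u' v' h h' he ⟨q, rfl⟩
    rw [List.append_assoc, List.append_cancel_left_eq] at he
    by_contra hne
    exact h.not_after q (he ▸ List.prefix_append q v') (fun h0 => hne (by simp [h0])) h'.holds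
  have : u = u' := by
    rcases List.prefix_or_prefix_of_prefix (List.prefix_append u v)
      (he ▸ List.prefix_append u' v') with hp | hp
    · exact key h h' he hp
    · exact (key h' h he.symm hp).symm
  subst this
  exact ⟨rfl, List.append_cancel_left he⟩

theorem exists_least {P : List T → Prop} {f : List T → ℤ} {b : ℤ} {p : List T} (hp : P p)
    (hb : ∀ p, P p → b ≤ f p) : ∃ p, P p ∧ ∀ q, P q → f p ≤ f q := by
  obtain ⟨m, ⟨q, hq, rfl⟩, hm⟩ := Int.exists_least_of_bdd (P := fun z => ∃ p, P p ∧ f p = z)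
    ⟨b, by rintro z ⟨q, hq, rfl⟩; exact hb q hq⟩ ⟨_, p, hp, rfl⟩
  exact ⟨q, hq, fun q' hq' => hm _ ⟨q', hq', rfl⟩⟩

end Prefixes

/-- The height at the end of a sequence of steps. -/
def height {A : Multiset ℤ} (w : List (Step A)) : ℤ := (w.map Step.weight).sum

section Height

variable {A : Multiset ℤ}

@[simp] theorem height_nil : height ([] : List (Step A)) = 0 := rfl

@[simp] theorem height_append (u v : List (Step A)) : height (u ++ v) = height u + height v := by
  simp [height]

@[simp] theorem height_singleton (a : Step A) : height [a] = a.weight := by simp [height]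

@[simp] theorem height_cons (a : Step A) (w : List (Step A)) :
    height (a :: w) = a.weight + height w := by simp [height]

end Height

end HalfPlane

namespace HalfPlane

/-! ### A binary grammar for the nonnegative walks -/

/-- The symbols of the binary grammar, for a strip of height `d`. -/
inductive Strip (d : ℕ) : Type
  /-- steps from the height `r` in the strip to the height `d + s` -/
  | up (r s : Fin d) : Strip d
  /-- walks from the height `r` in the strip to the height `s` in the strip, above the strip in
  between -/
  | arch (r s : Fin d) : Strip d
  /-- walks from the height `r` in the strip to the height `s - d`, nonnegative before the end -/
  | fall (r s : Fin d) : Strip d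
  /-- nonnegative walks from the height `r` in the strip -/
  | stay (r : Fin d) : Strip d

namespace Strip

variable {d : ℕ}

/-- A numbering of the symbols. -/
def index : Strip d → Fin 4 × Fin d × Fin d
  | up r s => (0, r, s)
  | arch r s => (1, r, s)
  | fall r s => (2, r, s)
  | stay r => (3, r, r)

theorem index_injective : Function.Injective (index (d := d)) := by
  intro y z h
  cases y <;> cases z <;> simp_all [index]

noncomputable instance : Fintype (Strip d) := Fintype.ofInjective index index_injective

noncomputable instance : DecidableEq (Strip d) := Classical.decEq _

/-- The rules of the binary grammar. -/
inductive Rule : Strip d → Strip d → Strip d → Prop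
  | arch (r q s : Fin d) : Rule (arch r s) (up r q) (fall q s)
  | fall (r q s : Fin d) : Rule (fall r s) (arch r q) (fall q s)
  | stayAbove (r q : Fin d) : Rule (stay r) (up r q) (stay q)
  | stayArch (r q s : Fin d) : Rule (stay r) (up r q) (fall q s)
  | stayReturn (r q : Fin d) : Rule (stay r) (arch r q) (stay q)

variable {A : Multiset ℤ}

/-- The walks described by the symbols. -/
def lang (A : Multiset ℤ) : Strip d → Set (List (Step A))
  | up r s => {w | ∃ a, w = [a] ∧ (r : ℤ) + a.weight = d + s}
  | arch r s => {w | w ≠ [] ∧ (∀ p, p <+: w → p ≠ [] → p ≠ w → (d : ℤ) ≤ r + height p) ∧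
      (r : ℤ) + height w = s}
  | fall r s => {w | w ≠ [] ∧ (∀ p, p <+: w → p ≠ w → (0 : ℤ) ≤ r + height p) ∧
      (r : ℤ) + height w = s - d}
  | stay r => {w | w ≠ [] ∧ ∀ p, p <+: w → (0 : ℤ) ≤ r + height p}

variable {r q s : Fin d} {u v w : List (Step A)}

theorem prefix_singleton {a : Step A} {p : List (Step A)} (h : p <+: [a]) : p = [] ∨ p = [a] := by
  rcases List.prefix_cons_iff.mp h with h | ⟨t, ht, h⟩
  · exact Or.inl h
  · right; rw [ht, List.prefix_nil.mp h]

/-- After the step up, heights are measured from the ground `d`: to be nonnegative there means to be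
above the strip, and the end `s - d` is the height `s` in the strip. -/
theorem up_fall_mem (hu : u ∈ lang A (up r q)) (hv : v ∈ lang A (fall q s)) :
    u ++ v ∈ lang A (arch r s) := by
  obtain ⟨a, rfl, ha⟩ := hu
  obtain ⟨hv0, hv1, hv2⟩ := hv
  refine ⟨by simp, fun p hp hp0 hpw => ?_, by simp; omega⟩
  rcases prefix_append_iff.mp hp with hp | ⟨p', -, hp', rfl⟩
  · rcases prefix_singleton hp with rfl | rfl
    · exact absurd rfl hp0
    · simp; omega
  · have := hv1 p' hp' (fun h => hpw (by rw [h]))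
    simp; omega

theorem up_stay_prefix (hu : u ∈ lang A (up r q)) (hv : v ∈ lang A (stay q))
    {p : List (Step A)} (hp : p <+: u ++ v) (hp0 : p ≠ []) : (d : ℤ) ≤ r + height p := by
  obtain ⟨a, rfl, ha⟩ := hu
  obtain ⟨hv0, hv1⟩ := hv
  rcases prefix_append_iff.mp hp with hp | ⟨p', -, hp', rfl⟩
  · rcases prefix_singleton hp with rfl | rfl
    · exact absurd rfl hp0
    · simp; omega
  · have := hv1 p' hp'
    simp; omega

theorem arch_append_prefix (hu : u ∈ lang A (arch r q)) {p : List (Step A)}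
    (hp : p <+: u ++ v) (hv : ∀ p', p' <+: v → p' ≠ [] → p ≠ u ++ v → p' ≠ v →
      (0 : ℤ) ≤ q + height p') (hp1 : p ≠ u ++ v) : (0 : ℤ) ≤ r + height p := by
  obtain ⟨hu0, hu1, hu2⟩ := hu
  rcases prefix_append_iff.mp hp with hp | ⟨p', hp0', hp', rfl⟩
  · by_cases h0 : p = []
    · simp [h0]
    · by_cases h1 : p = u
      · rw [h1, hu2]; simp
      · have := hu1 p hp h0 h1; omega
  · have := hv p' hp' hp0' hp1 (fun h => hp1 (by rw [h]))
    simp; omega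

/-- In the rules that begin with `up`, the second factor lives on the raised ground; in those that
begin with `arch`, it starts in the strip at the end of the arch. -/
theorem rule_mem {X Y Z : Strip d} (h : Rule X Y Z) (hu : u ∈ lang A Y) (hv : v ∈ lang A Z) :
    u ++ v ∈ lang A X := by
  cases h with
  | arch r q s => exact up_fall_mem hu hv
  | fall r q s =>
    refine ⟨by simp [hu.1], fun p hp hpw => arch_append_prefix hu hp
      (fun p' hp' _ _ hne => hv.2.1 p' hp' hne) hpw, ?_⟩
    have h1 := hu.2.2
    have h2 := hv.2.2
    simp; omega
  | stayAbove r q =>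
    refine ⟨fun h => hv.1 (List.append_eq_nil_iff.mp h).2, fun p hp => ?_⟩
    by_cases hp0 : p = []
    · simp [hp0]
    · have := up_stay_prefix hu hv hp hp0; omega
  | stayArch r q s =>
    have h := up_fall_mem hu hv
    refine ⟨h.1, fun p hp => ?_⟩
    by_cases hp0 : p = []
    · simp [hp0]
    · by_cases hp1 : p = u ++ v
      · rw [hp1, h.2.2]; simp
      · have := h.2.1 p hp hp0 hp1; omega
  | stayReturn r q =>
    refine ⟨by simp [hu.1], fun p hp => ?_⟩
    by_cases hp1 : p = u ++ v
    · rw [hp1]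
      have h1 := hu.2.2
      have h2 := hv.2 v List.prefix_rfl
      simp; omega
    · exact arch_append_prefix hu hp (fun p' hp' _ _ _ => hv.2 p' hp') hp1

theorem IsFirst.of_mem_arch (h : u ∈ lang A (arch r s)) :
    IsFirst (fun p => (r : ℤ) + height p < d) u :=
  ⟨h.1, by have := h.2.2; omega, fun p hp hp0 hp1 => not_lt.mpr (h.2.1 p hp hp0 hp1)⟩

theorem mem_arch_of_isFirst (h : IsFirst (fun p => (r : ℤ) + height p < d) u)
    (h0 : 0 ≤ (r : ℤ) + height u) : ∃ q : Fin d, u ∈ lang A (arch r q) := by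
  have h1 := h.holds
  refine ⟨⟨((r : ℤ) + height u).toNat, by omega⟩, h.ne_nil,
    fun p hp hp0 hp1 => not_lt.mp (h.not_before p hp hp0 hp1), ?_⟩
  simp; omega

theorem mem_up {a : Step A} (h : (d : ℤ) ≤ r + a.weight) (hd : a.weight ≤ d) :
    ∃ q : Fin d, [a] ∈ lang A (up r q) :=
  ⟨⟨((r : ℤ) + a.weight - d).toNat, by have := r.isLt; omega⟩, a, rfl, by simp; omega⟩

theorem exists_cons_of_two_le {T : Type} {w : List T} (h : 2 ≤ w.length) :
    ∃ a v, w = [a] ++ v ∧ v ≠ [] := by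
  match w, h with
  | a :: b :: v, _ => exact ⟨a, b :: v, rfl, by simp⟩

theorem arch_split (hd : ∀ a : Step A, a.weight ≤ d) (hw : w ∈ lang A (arch r s))
    (hl : 2 ≤ w.length) : ∃ q, ∃ u ∈ lang A (up r q), ∃ v ∈ lang A (fall q s), w = u ++ v := by
  obtain ⟨a, v, rfl, hv⟩ := exists_cons_of_two_le hl
  obtain ⟨-, h1, h2⟩ := hw
  have ha := h1 [a] (List.prefix_append _ _) (by simp) (by simpa using hv)
  rw [height_singleton] at ha
  obtain ⟨q, hq⟩ := mem_up ha (hd a)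
  obtain ⟨a', he, hq'⟩ := id hq
  obtain rfl : a = a' := by simpa using he
  refine ⟨q, [a], hq, v, ⟨hv, fun p hp hpv => ?_, ?_⟩, rfl⟩
  · have := h1 ([a] ++ p) ((List.prefix_append_right_inj _).mpr hp) (by simp) (by simpa using hpv)
    simp at this; omega
  · simp at h2; omega

/-- A walk is cut at the first nonempty prefix that ends below `d`. If there is none, or if the
whole walk is this prefix, its first step leaves the strip upwards and is split off. -/
theorem rule_split (hd : ∀ a : Step A, a.weight ≤ d) (hd' : ∀ a : Step A, -a.weight ≤ d)
    (X : Strip d) (hw : w ∈ lang A X) (hl : 2 ≤ w.length) :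
    ∃ Y Z, Rule X Y Z ∧ ∃ u ∈ lang A Y, ∃ v ∈ lang A Z, w = u ++ v := by
  cases X with
  | up r s => obtain ⟨a, rfl, -⟩ := hw; simp at hl
  | arch r s =>
    obtain ⟨q, u, hu, v, hv, he⟩ := arch_split hd hw hl
    exact ⟨_, _, .arch r q s, u, hu, v, hv, he⟩
  | fall r s =>
    obtain ⟨hw0, hw1, hw2⟩ := hw
    obtain ⟨u, v, rfl, hu⟩ := exists_isFirst (Q := fun p => (r : ℤ) + height p < d) hw0
      List.prefix_rfl (by have := s.isLt; omega)
    -- The first time below `d` cannot be the end of a walk of at least two steps: the last step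
    -- would go from a height at least `d` to a negative height, although steps go down by at most
    -- `d`.
    have hv : v ≠ [] := by
      rintro rfl
      rw [List.append_nil] at hl hw2
      obtain ⟨p, b, rfl⟩ := List.eq_nil_or_concat' u |>.resolve_left hu.ne_nil
      have hp := hu.not_before p (List.prefix_append _ _) (by rintro rfl; simp at hl) (by simp)
      have hb := hd' b
      simp at hw2 hp
      have := s.isLt
      omega
    obtain ⟨q, hq⟩ := mem_arch_of_isFirst hu (hw1 u (List.prefix_append _ _) (by simpa using hv))
    have hq2 := hq.2.2
    refine ⟨_, _, .fall r q s, u, hq, v, ⟨hv, fun p hp hpv => ?_, ?_⟩, rfl⟩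
    · have := hw1 (u ++ p) ((List.prefix_append_right_inj _).mpr hp) (by simpa using hpv)
      simp at this; omega
    · simp at hw2; omega
  | stay r =>
    obtain ⟨hw0, hw1⟩ := hw
    by_cases hex : ∃ p, p ≠ [] ∧ p <+: w ∧ (r : ℤ) + height p < d
    · obtain ⟨p, hp0, hp, hpd⟩ := hex
      obtain ⟨u, v, rfl, hu⟩ := exists_isFirst (Q := fun p => (r : ℤ) + height p < d) hp0 hp hpd
      obtain ⟨q, hq⟩ := mem_arch_of_isFirst hu (hw1 u (List.prefix_append _ _))
      by_cases hv : v = []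
      -- A single arch is split further, because a rule `stay → arch` would not be binary.
      · subst hv
        rw [List.append_nil] at hl ⊢
        obtain ⟨q', u', hu', v', hv', he⟩ := arch_split hd hq hl
        exact ⟨_, _, .stayArch r q' q, u', hu', v', hv', he⟩
      · have hq2 := hq.2.2
        refine ⟨_, _, .stayReturn r q, u, hq, v, ⟨hv, fun p hp => ?_⟩, rfl⟩
        have := hw1 (u ++ p) ((List.prefix_append_right_inj _).mpr hp)
        simp at this; omega
    · obtain ⟨a, v, rfl, hv⟩ := exists_cons_of_two_le hl
      have ha : (d : ℤ) ≤ r + a.weight := by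
        by_contra hc
        exact hex ⟨[a], by simp, List.prefix_append _ _, by simpa using hc⟩
      obtain ⟨q, hq⟩ := mem_up ha (hd a)
      obtain ⟨a', he, hq'⟩ := id hq
      obtain rfl : a = a' := by simpa using he
      refine ⟨_, _, .stayAbove r q, [a], hq, v, ⟨hv, fun p hp => ?_⟩, rfl⟩
      by_contra hc
      refine hex ⟨[a] ++ p, by simp, (List.prefix_append_right_inj _).mpr hp, ?_⟩
      simp; omega

theorem up_eq {q' : Fin d} {u' v' : List (Step A)} (hu : u ∈ lang A (up r q))
    (hu' : u' ∈ lang A (up r q')) (he : u ++ v = u' ++ v') : u = u' ∧ q = q' ∧ v = v' := by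
  obtain ⟨a, rfl, ha⟩ := hu
  obtain ⟨a', rfl, ha'⟩ := hu'
  obtain ⟨rfl, rfl⟩ : a = a' ∧ v = v' := by simpa using he
  exact ⟨rfl, Fin.ext (by omega), rfl⟩

theorem arch_eq {q' : Fin d} {u' v' : List (Step A)} (hu : u ∈ lang A (arch r q))
    (hu' : u' ∈ lang A (arch r q')) (he : u ++ v = u' ++ v') : u = u' ∧ q = q' := by
  obtain ⟨rfl, -⟩ := (IsFirst.of_mem_arch hu).eq (IsFirst.of_mem_arch hu') he
  have h1 := hu.2.2
  have h2 := hu'.2.2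
  exact ⟨rfl, Fin.ext (by omega)⟩

theorem not_up_stay_of_up_fall {q' : Fin d} {u' v' : List (Step A)} (hu : u ∈ lang A (up r q))
    (hv : v ∈ lang A (stay q)) (hu' : u' ∈ lang A (up r q')) (hv' : v' ∈ lang A (fall q' s))
    (he : u ++ v = u' ++ v') : False := by
  have h1 := up_stay_prefix hu hv (p := u ++ v) List.prefix_rfl (by simp [hv.1])
  have h2 := (up_fall_mem hu' hv').2.2
  rw [he] at h1
  omega

theorem not_up_stay_of_arch {q' : Fin d} {u' v' : List (Step A)} (hu : u ∈ lang A (up r q))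
    (hv : v ∈ lang A (stay q)) (hu' : u' ∈ lang A (arch r q')) (he : u ++ v = u' ++ v') :
    False := by
  have h1 := up_stay_prefix hu hv (he ▸ List.prefix_append u' v') hu'.1
  have h2 := hu'.2.2
  omega

theorem not_up_fall_of_arch {q' : Fin d} {u' v' : List (Step A)} (hu : u ∈ lang A (up r q))
    (hv : v ∈ lang A (fall q s)) (hu' : u' ∈ lang A (arch r q')) (hv' : v' ≠ [])
    (he : u ++ v = u' ++ v') : False := by
  have h1 := (up_fall_mem hu hv).2.1 u' (he ▸ List.prefix_append u' v') hu'.1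
    (by rw [he]; simpa using hv')
  have h2 := hu'.2.2
  omega

/-- Rules with the same head are told apart by where the walk first comes below `d`: never, only at
its end, or earlier. The position of the cut follows from the first step or from `IsFirst.eq`. -/
theorem rule_unique {X Y Z Y' Z' : Strip d} (h : Rule X Y Z) (h' : Rule X Y' Z')
    {u' v' : List (Step A)} (hu : u ∈ lang A Y) (hv : v ∈ lang A Z) (hu' : u' ∈ lang A Y')
    (hv' : v' ∈ lang A Z') (he : u ++ v = u' ++ v') : u = u' ∧ Y = Y' ∧ Z = Z' := by
  cases h with
  | arch r q s =>
    cases h' with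
    | arch _ q' => obtain ⟨rfl, rfl, rfl⟩ := up_eq hu hu' he; exact ⟨rfl, rfl, rfl⟩
  | fall r q s =>
    cases h' with
    | fall _ q' => obtain ⟨rfl, rfl⟩ := arch_eq hu hu' he; exact ⟨rfl, rfl, rfl⟩
  | stayAbove r q =>
    cases h' with
    | stayAbove _ q' => obtain ⟨rfl, rfl, rfl⟩ := up_eq hu hu' he; exact ⟨rfl, rfl, rfl⟩
    | stayArch => exact (not_up_stay_of_up_fall hu hv hu' hv' he).elim
    | stayReturn => exact (not_up_stay_of_arch hu hv hu' he).elim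
  | stayArch r q s =>
    cases h' with
    | stayAbove => exact (not_up_stay_of_up_fall hu' hv' hu hv he.symm).elim
    | stayArch _ q' s' =>
      obtain ⟨rfl, rfl, rfl⟩ := up_eq hu hu' he
      have h1 := hv.2.2
      have h2 := hv'.2.2
      obtain rfl : s = s' := Fin.ext (by omega)
      exact ⟨rfl, rfl, rfl⟩
    | stayReturn => exact (not_up_fall_of_arch hu hv hu' hv'.1 he).elim
  | stayReturn r q =>
    cases h' with
    | stayAbove => exact (not_up_stay_of_arch hu' hv' hu he.symm).elim
    | stayArch => exact (not_up_fall_of_arch hu' hv' hu hv.1 he.symm).elim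
    | stayReturn _ q' => obtain ⟨rfl, rfl⟩ := arch_eq hu hu' he; exact ⟨rfl, rfl, rfl⟩

open Classical in
/-- The binary grammar of the nonnegative walks. -/
noncomputable def binaryGrammar (A : Multiset ℤ) (d : ℕ) : BinaryGrammar (Step A) (Strip d) where
  letters X := (Finset.univ.filter fun a => [a] ∈ lang A X).toList
  rules := Finset.univ.filter fun ρ => Rule ρ.1 ρ.2.1 ρ.2.2

theorem generates (hd : ∀ a : Step A, a.weight ≤ d) (hd' : ∀ a : Step A, -a.weight ≤ d) :
    (binaryGrammar A d).Generates (lang A) where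
  nodup X := Finset.nodup_toList _
  nil X := by cases X <;> simp [lang]
  single X a := by simp [binaryGrammar]
  rule X Y Z h u hu v hv := rule_mem (by simpa [binaryGrammar] using h) hu hv
  split X w hw hl := by
    obtain ⟨Y, Z, h, h'⟩ := rule_split hd hd' X hw hl
    exact ⟨Y, Z, by simpa [binaryGrammar] using h, h'⟩
  unique X Y Z Y' Z' h h' u hu v hv u' hu' v' hv' he :=
    rule_unique (by simpa [binaryGrammar] using h) (by simpa [binaryGrammar] using h')
      hu hv hu' hv' he

end Strip

/-! ### The program for nonnegative walks -/

theorem BinaryGrammar.Generates.count_le {T I : Type} [Fintype T] [DecidableEq I]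
    {g : BinaryGrammar T I} {L : I → Set (List T)} (hg : g.Generates L) (X : I) (s : ℕ) :
    g.count X s ≤ Fintype.card T ^ s := by
  classical
  obtain ⟨h1, h2⟩ := hg.words_spec s X
  rw [count, ← List.toFinset_card_of_nodup h1]
  have h3 : (g.words X s).toFinset ⊆ (Finset.univ : Finset (Fin s → T)).image List.ofFn := by
    intro w hw
    obtain ⟨-, rfl⟩ := (h2 w).mp (List.mem_toFinset.mp hw)
    exact Finset.mem_image.mpr ⟨w.get, Finset.mem_univ _, List.ofFn_get w⟩
  refine (Finset.card_le_card h3).trans (Finset.card_image_le.trans ?_)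
  simp

theorem exists_sampler {T I : Type} [Fintype T] [Fintype I] [DecidableEq I]
    {g : BinaryGrammar T I} {L : I → Set (List T)} (hg : g.Generates L) (X : I) :
    ∃ S : Sampler T I, S.g = g ∧ S.start = X := by
  obtain ⟨r, n₀, h⟩ := g.exists_isPRecursive_count
  obtain ⟨R, fwd, bwd, hf⟩ := exists_step_expr _ h
  refine ⟨{
    g := g
    start := X
    order := R
    fwd := fwd
    bwd := bwd
    fwd_spec := fun n p => (hf n p).1
    bwd_spec := fun n p => (hf n p).2
    -- Large enough for the codes of all symbols to be digits and for the number of words of length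
    -- `s` to be at most `base ^ s`.
    base := Fintype.card I + Fintype.card T + 2
    code := fun X => (Fintype.equivFin I X : ℕ) + 1
    code_inj := fun X Y h => (Fintype.equivFin I).injective (Fin.ext (by simpa using h))
    code_pos := fun X => Nat.succ_pos _
    code_lt := fun X => by have := (Fintype.equivFin I X).isLt; omega
    two_le_base := by omega
    count_le := fun X s => (hg.count_le X s).trans (Nat.pow_le_pow_left (by omega) s) }, rfl, rfl⟩

open Classical in
theorem exists_walk_program {A : Multiset ℤ} (hA : Nontriv A) :
    ∃ (r : ℕ) (p : Prog (Step A) (r + 2)) (time bits : ℕ → ℕ → ℕ),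
      (∀ n k : ℕ, HaltsWithin p n k (time n k) ∧
        IsUniformWalks A n k (outputDist p n k (time n k)) ∧ StoresBits p n k (bits n k)) ∧
      ∃ C : ℝ, ∀ n k : ℕ, 2 ≤ n → 1 ≤ k →
        (time n k : ℝ) ≤ C * (k * (n * Real.log n)) ∧
        (bits n k : ℝ) ≤ C * (n + Real.log k) := by
  obtain ⟨⟨a, ha, hapos⟩, -⟩ := hA
  obtain ⟨d, hd⟩ : ∃ d : ℕ, ∀ b : Step A, b.weight.natAbs ≤ d :=
    ⟨∑ b : Step A, b.weight.natAbs, fun b =>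
      Finset.single_le_sum (f := fun b : Step A => b.weight.natAbs) (fun _ _ => Nat.zero_le _)
        (Finset.mem_univ b)⟩
  -- The strip has height `d + 1`, so that it contains the starting height `0` even if `d = 0`.
  have hg := Strip.generates (A := A) (d := d + 1) (fun b => by have := hd b; omega)
    (fun b => by have := hd b; omega)
  obtain ⟨S, hS, hX⟩ := exists_sampler hg (Strip.stay 0)
  have hmem : ∀ n w, w ∈ S.outputs n ↔ w ∈ walks A n := by
    intro n w
    rw [Sampler.outputs]
    split_ifs with h0
    · subst h0
      simp only [List.mem_singleton, walks, Set.mem_ofPred_eq, List.length_eq_zero_iff]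
      refine ⟨?_, fun h => h.1⟩
      rintro rfl
      refine ⟨rfl, fun p hp => ?_⟩
      simp [List.prefix_nil.mp hp]
    · rw [hS, hX, (hg.words_spec n _).2 w]
      simp only [Strip.lang, walks, IsNonnegWalk, height, Set.mem_ofPred_eq]
      constructor
      · rintro ⟨⟨-, h1⟩, h2⟩
        exact ⟨h2, fun p hp => by simpa using h1 p hp⟩
      · rintro ⟨h1, h2⟩
        refine ⟨⟨?_, fun p hp => by simpa using h2 p hp⟩, h1⟩
        rintro rfl
        exact h0 h1.symm
  have hnd : ∀ n, (S.outputs n).Nodup := by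
    intro n
    rw [Sampler.outputs]
    split_ifs
    · simp
    · rw [hS, hX]; exact ((hg.words_spec n _).1)
  have hne : ∀ n, S.outputs n ≠ [] := by
    intro n
    obtain ⟨b, hb⟩ : ∃ b : Step A, b.weight = a :=
      ⟨⟨a, ⟨0, Multiset.count_pos.mpr ha⟩⟩, rfl⟩
    -- Repeating a positive step gives a walk of every length.
    refine List.ne_nil_of_mem ((hmem n (List.replicate n b)).mpr ⟨by simp, fun p hp => ?_⟩)
    refine List.sum_nonneg fun x hx => ?_
    obtain ⟨y, hy, rfl⟩ := List.mem_map.mp hx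
    rw [List.eq_of_mem_replicate (hp.subset hy), hb]
    exact hapos.le
  obtain ⟨r, p, time, bits, h1, h2⟩ := S.exists_program hne hnd fun n w hw => ((hmem n w).mp hw).1
  refine ⟨r, p, time, bits, fun n k => ⟨(h1 n k).1, fun o => ?_, (h1 n k).2.2⟩, h2⟩
  rw [(h1 n k).2.1 o]
  have hcard : (walks A n).ncard = (S.outputs n).length := by
    rw [← List.toFinset_card_of_nodup (hnd n), ← Set.ncard_coe_finset]
    congr 1
    ext w
    simp [hmem]
  simp only [hmem, hcard]

end HalfPlane

namespace HalfPlane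

/-! ### Unambiguity of context-free grammars -/

section LeftmostDerivations

variable {T : Type} {g : ContextFreeGrammar T}

open Symbol

theorem map_terminal_injective : Function.Injective
    (List.map (terminal : T → Symbol T g.NT)) :=
  List.map_injective_iff.mpr fun a b h => by injection h

namespace LeftmostDerivation

theorem of_terminals {u : List T} {rs : List (ContextFreeRule T g.NT)} {w : List T}
    (h : LeftmostDerivation g (u.map terminal) rs w) : rs = [] ∧ w = u := by
  generalize hs : u.map terminal = s at h
  cases h with
  | done w => exact ⟨rfl, (map_terminal_injective hs).symm⟩
  | step u' v ρ rs w hρ h =>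
    have : nonterminal ρ.input ∈ u.map terminal := by rw [hs]; simp
    simp at this

theorem append_left (u : List T) {β : List (Symbol T g.NT)}
    {rs : List (ContextFreeRule T g.NT)} {w : List T} (h : LeftmostDerivation g β rs w) :
    LeftmostDerivation g (u.map terminal ++ β) rs (u ++ w) := by
  induction h with
  | done w => rw [← List.map_append]; exact .done _
  | step u' v ρ rs w hρ h ih =>
    have := LeftmostDerivation.step (u ++ u') v ρ rs (u ++ w) hρ
      (by simpa [List.map_append] using ih)
    simpa [List.map_append] using this

theorem append {α β : List (Symbol T g.NT)} {rs rs' : List (ContextFreeRule T g.NT)}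
    {w w' : List T} (h : LeftmostDerivation g α rs w) (h' : LeftmostDerivation g β rs' w') :
    LeftmostDerivation g (α ++ β) (rs ++ rs') (w ++ w') := by
  induction h with
  | done w => exact h'.append_left w
  | step u v ρ rs w hρ h ih =>
    have := LeftmostDerivation.step u (v ++ β) ρ (rs ++ rs') (w ++ w') hρ (by simpa using ih)
    simpa using this

/-- Rules are applied to the leftmost nonterminal, so all rules for `α` come before those for `β`,
and the list of rules is cut as well as the word. -/
theorem split {α β s : List (Symbol T g.NT)} {rs : List (ContextFreeRule T g.NT)} {w : List T}
    (h : LeftmostDerivation g s rs w) (hs : s = α ++ β) :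
    ∃ w₁ w₂ rs₁ rs₂, w = w₁ ++ w₂ ∧ rs = rs₁ ++ rs₂ ∧ LeftmostDerivation g α rs₁ w₁ ∧
      LeftmostDerivation g β rs₂ w₂ := by
  induction h generalizing α β with
  | done w =>
    obtain ⟨w₁, w₂, rfl, rfl, rfl⟩ := List.map_eq_append_iff.mp hs
    exact ⟨w₁, w₂, [], [], rfl, rfl, .done _, .done _⟩
  | step u v ρ rs w hρ h ih =>
    rw [List.append_assoc] at hs
    rcases List.append_eq_append_iff.mp hs with ⟨α', rfl, hα⟩ | ⟨β', hu, rfl⟩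
    · cases α' with
      | nil =>
        rw [List.nil_append] at hα
        subst hα
        exact ⟨u, w.drop u.length, [], ρ :: rs, by
          obtain ⟨w₁, w₂, rs₁, rs₂, rfl, -, h1, -⟩ :=
            ih (α := u.map terminal) (β := ρ.output ++ v) (by simp)
          obtain ⟨-, rfl⟩ := h1.of_terminals
          simp, rfl, by simpa using .done u, by
          obtain ⟨w₁, w₂, rs₁, rs₂, rfl, rfl, h1, h2⟩ :=
            ih (α := u.map terminal) (β := ρ.output ++ v) (by simp)
          obtain ⟨rfl, rfl⟩ := h1.of_terminals
          simpa using LeftmostDerivation.step [] v ρ rs₂ w₂ hρ (by simpa using h2)⟩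
      | cons x α' =>
        obtain ⟨rfl, rfl⟩ : nonterminal ρ.input = x ∧ v = α' ++ β := by simpa using hα
        obtain ⟨w₁, w₂, rs₁, rs₂, rfl, rfl, h1, h2⟩ :=
          ih (α := u.map terminal ++ ρ.output ++ α') (β := β) (by simp)
        refine ⟨w₁, w₂, ρ :: rs₁, rs₂, rfl, rfl, ?_, h2⟩
        simpa using LeftmostDerivation.step u α' ρ rs₁ w₁ hρ h1
    · obtain ⟨u₁, u₂, rfl, rfl, rfl⟩ := List.map_eq_append_iff.mp hu
      obtain ⟨w₁, w₂, rs₁, rs₂, rfl, rfl, h1, h2⟩ :=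
        ih (α := u₁.map terminal) (β := u₂.map terminal ++ ρ.output ++ v) (by simp)
      obtain ⟨rfl, rfl⟩ := h1.of_terminals
      refine ⟨w₁, w₂, [], ρ :: rs₂, rfl, rfl, h1, ?_⟩
      simpa using LeftmostDerivation.step u₂ v ρ rs₂ w₂ hρ h2

theorem of_nonterminal {N : g.NT} {rs : List (ContextFreeRule T g.NT)} {w : List T}
    (h : LeftmostDerivation g [nonterminal N] rs w) :
    ∃ ρ rs', ρ ∈ g.rules ∧ ρ.input = N ∧ rs = ρ :: rs' ∧ LeftmostDerivation g ρ.output rs' w := by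
  generalize hs : [nonterminal N] = s at h
  cases h with
  | done w =>
    have : nonterminal N ∈ w.map terminal := by rw [← hs]; simp
    simp at this
  | step u v ρ rs w hρ h =>
    cases u with
    | nil =>
      obtain ⟨h1, rfl⟩ : N = ρ.input ∧ [] = v := by simpa using hs
      exact ⟨ρ, rs, hρ, h1.symm, rfl, by simpa using h⟩
    | cons a u => simp at hs

theorem decompose {α : List (Symbol T g.NT)} {rs : List (ContextFreeRule T g.NT)} {w : List T}
    (h : LeftmostDerivation g α rs w) :
    ∃ ps : List (List T × List (ContextFreeRule T g.NT)),
      List.Forall₂ (fun s p => LeftmostDerivation g [s] p.2 p.1) α ps ∧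
      w = (ps.map Prod.fst).flatten ∧ rs = (ps.map Prod.snd).flatten := by
  induction α generalizing rs w with
  | nil =>
    obtain ⟨rfl, rfl⟩ := of_terminals (u := []) h
    exact ⟨[], .nil, rfl, rfl⟩
  | cons s α ih =>
    obtain ⟨w₁, w₂, rs₁, rs₂, rfl, rfl, h1, h2⟩ := h.split (α := [s]) (β := α) rfl
    obtain ⟨ps, h3, rfl, rfl⟩ := ih h2
    exact ⟨(w₁, rs₁) :: ps, .cons h1 h3, by simp, by simp⟩

theorem compose {α : List (Symbol T g.NT)} {ws : List (List T)}
    (h : List.Forall₂ (fun s w => ∃ rs, LeftmostDerivation g [s] rs w) α ws) :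
    ∃ rs, LeftmostDerivation g α rs ws.flatten := by
  induction h with
  | nil => exact ⟨[], .done []⟩
  | cons h1 _ ih =>
    obtain ⟨rs₁, h1⟩ := h1
    obtain ⟨rs₂, h2⟩ := ih
    exact ⟨rs₁ ++ rs₂, h1.append h2⟩

theorem derives {α : List (Symbol T g.NT)} {rs : List (ContextFreeRule T g.NT)} {w : List T}
    (h : LeftmostDerivation g α rs w) : g.Derives α (w.map terminal) := by
  induction h with
  | done w => exact .refl _
  | step u v ρ rs w hρ h ih =>
    exact (ContextFreeGrammar.Produces.single
      ⟨ρ, hρ, ρ.rewrites_of_exists_parts _ _⟩).trans ih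

end LeftmostDerivation

/-- The words described by a symbol, given the words described by the nonterminals. -/
def symbolLang {N : Type} (S : N → Set (List T)) : Symbol T N → Set (List T)
  | terminal a => {[a]}
  | nonterminal X => S X

/-- The words described by a string of symbols. -/
def stringLang {N : Type} (S : N → Set (List T)) (α : List (Symbol T N)) : Set (List T) :=
  {w | ∃ ws, List.Forall₂ (fun s w => w ∈ symbolLang S s) α ws ∧ w = ws.flatten}

theorem flatten_map_singleton (w : List T) : (w.map fun a => [a]).flatten = w := by
  induction w with
  | nil => rfl
  | cons a w ih => rw [List.map_cons, List.flatten_cons, ih]; rfl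

theorem mem_stringLang_append {N : Type} {S : N → Set (List T)} {α β : List (Symbol T N)}
    {w : List T} : w ∈ stringLang S (α ++ β) ↔
      ∃ u ∈ stringLang S α, ∃ v ∈ stringLang S β, w = u ++ v := by
  constructor
  · rintro ⟨ws, h, rfl⟩
    refine ⟨_, ⟨ws.take α.length, (List.forall₂_take_append ws α β h.flip).flip, rfl⟩,
      _, ⟨ws.drop α.length, (List.forall₂_drop_append ws α β h.flip).flip, rfl⟩, ?_⟩
    rw [← List.flatten_append, List.take_append_drop]
  · rintro ⟨_, ⟨us, hu, rfl⟩, _, ⟨vs, hv, rfl⟩, rfl⟩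
    exact ⟨us ++ vs, List.rel_append hu hv, by simp⟩

/-- The sets `S X` are the sets described by the nonterminals of the grammar, each word in only
one way. -/
structure Describes (g : ContextFreeGrammar T) (S : g.NT → Set (List T))
    (m : g.NT → List T → ℕ) : Prop where
  sound : ∀ ρ ∈ g.rules, ∀ w ∈ stringLang S ρ.output, w ∈ S ρ.input
  complete : ∀ X, ∀ w ∈ S X, ∃ ρ ∈ g.rules, ρ.input = X ∧ ∃ ws, w = ws.flatten ∧
    List.Forall₂ (fun s w' => w' ∈ symbolLang S s ∧ ∀ Y, s = nonterminal Y → m Y w' < m X w)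
      ρ.output ws
  unique : ∀ ρ ∈ g.rules, ∀ ρ' ∈ g.rules, ρ.input = ρ'.input → ∀ ws ws',
    List.Forall₂ (fun s w => w ∈ symbolLang S s) ρ.output ws →
    List.Forall₂ (fun s w => w ∈ symbolLang S s) ρ'.output ws' →
    ws.flatten = ws'.flatten → ρ = ρ' ∧ ws = ws'

namespace Describes

variable {S : g.NT → Set (List T)} {m : g.NT → List T → ℕ} (h : Describes g S m)
include h

/-- Induction on the measure, which is smaller for every factor in a nonterminal. -/
theorem exists_derivation (X : g.NT) (w : List T) (hw : w ∈ S X) :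
    ∃ rs, LeftmostDerivation g [nonterminal X] rs w := by
  induction hm : m X w using Nat.strong_induction_on generalizing X w with
  | _ n ih =>
  obtain ⟨ρ, hρ, rfl, ws, rfl, hws⟩ := h.complete X w hw
  obtain ⟨rs, hrs⟩ := LeftmostDerivation.compose (g := g) (hws.imp (S := fun s w =>
    ∃ rs, LeftmostDerivation g [s] rs w) fun s w' hs => by
      obtain ⟨h1, h2⟩ := hs
      cases s with
      | terminal a => rw [show w' = [a] from h1]; exact ⟨[], .done [a]⟩
      | nonterminal Y => exact ih _ (hm ▸ h2 Y rfl) Y w' h1 rfl)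
  exact ⟨ρ :: rs, by simpa using LeftmostDerivation.step [] [] ρ rs _ hρ (by simpa using hrs)⟩

/-- The derivation is read backwards from the terminal word: undoing a rule keeps the word in the
language of the string, by soundness. -/
theorem mem_of_derives {α : List (Symbol T g.NT)} {w : List T}
    (hd : g.Derives α (w.map terminal)) : w ∈ stringLang S α := by
  induction hd using Relation.ReflTransGen.head_induction_on with
  | refl =>
    refine ⟨w.map fun a => [a], ?_, (flatten_map_singleton w).symm⟩
    rw [List.forall₂_map_left_iff, List.forall₂_map_right_iff, List.forall₂_same]
    intro a _
    rfl
  | head hp _ ih =>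
    obtain ⟨ρ, hρ, hr⟩ := hp
    obtain ⟨p, q, rfl, rfl⟩ := hr.exists_parts
    obtain ⟨_, h1, v, hv, rfl⟩ := mem_stringLang_append.mp ih
    obtain ⟨u, hu, x, hx, rfl⟩ := mem_stringLang_append.mp h1
    refine mem_stringLang_append.mpr ⟨_, mem_stringLang_append.mpr ⟨u, hu, x, ?_, rfl⟩, v, hv, rfl⟩
    exact ⟨[x], .cons (h.sound ρ hρ x hx) .nil, by simp⟩

theorem mem_of_derivation {s : Symbol T g.NT} {rs : List (ContextFreeRule T g.NT)} {w : List T}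
    (hd : LeftmostDerivation g [s] rs w) : w ∈ symbolLang S s := by
  obtain ⟨ws, hws, rfl⟩ := h.mem_of_derives hd.derives
  cases hws with
  | cons h1 h2 => cases h2; simpa using h1

theorem language_eq : g.language = S g.initial := by
  ext w
  constructor
  · intro hw
    obtain ⟨ws, hws, rfl⟩ := h.mem_of_derives hw
    cases hws with
    | cons h1 h2 => cases h2; rw [List.flatten_cons, List.flatten_nil, List.append_nil]; exact h1
  · intro hw
    obtain ⟨rs, hrs⟩ := h.exists_derivation _ w hw
    exact hrs.derives

/-- The first rule and the factors of the word are determined by unique decomposition; the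
derivations of the factors use fewer rules, so induction on the number of rules applies. -/
theorem derivation_unique (X : g.NT) (w : List T) (rs rs' : List (ContextFreeRule T g.NT))
    (hd : LeftmostDerivation g [nonterminal X] rs w)
    (hd' : LeftmostDerivation g [nonterminal X] rs' w) : rs = rs' := by
  induction hn : rs.length using Nat.strong_induction_on generalizing X w rs rs' with
  | _ n ih =>
  obtain ⟨ρ, rs, hρ, rfl, rfl, h1⟩ := hd.of_nonterminal
  obtain ⟨ρ', rs', hρ', hin, rfl, h1'⟩ := hd'.of_nonterminal
  obtain ⟨ps, h2, rfl, rfl⟩ := h1.decompose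
  obtain ⟨ps', h2', he, rfl⟩ := h1'.decompose
  have key : ∀ {α : List (Symbol T g.NT)} {ps : List (List T × List (ContextFreeRule T g.NT))},
      List.Forall₂ (fun s p => LeftmostDerivation g [s] p.2 p.1) α ps →
      List.Forall₂ (fun s w => w ∈ symbolLang S s) α (ps.map Prod.fst) := fun hf =>
    List.forall₂_map_right_iff.mpr (hf.imp fun s p hp => h.mem_of_derivation hp)
  obtain ⟨rfl, he'⟩ := h.unique ρ hρ ρ' hρ' hin.symm _ _ (key h2) (key h2') he
  suffices ps = ps' by rw [this]
  have hlen : ∀ p ∈ ps, p.2.length < n := fun p hp => by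
    rw [← hn, List.length_cons, Nat.lt_succ_iff]
    exact (List.sublist_flatten_of_mem (List.mem_map_of_mem hp)).length_le
  clear hd hd' h1 h1' he hn
  generalize ρ.output = α at h2 h2'
  induction h2 generalizing ps' with
  | nil => cases h2'; rfl
  | cons h3 h4 ih' =>
    cases h2' with
    | cons h3' h4' =>
      rename_i s p α ps p' ps'
      obtain ⟨h5, h6⟩ : p.1 = p'.1 ∧ ps.map Prod.fst = ps'.map Prod.fst := by simpa using he'
      rw [ih' _ h6 (fun p hp => hlen p (List.mem_cons_of_mem _ hp)) h4']
      congr 1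
      refine Prod.ext h5 ?_
      rw [← h5] at h3'
      cases s with
      | terminal a =>
        rw [(LeftmostDerivation.of_terminals (u := [a]) h3).1,
          (LeftmostDerivation.of_terminals (u := [a]) h3').1]
      | nonterminal Y => exact ih _ (hlen p (by simp)) Y _ _ _ h3 h3' rfl

theorem unambiguous : Unambiguous g := by
  intro w hw
  rw [h.language_eq] at hw
  obtain ⟨rs, hrs⟩ := h.exists_derivation _ w hw
  exact ⟨rs, hrs, fun rs' hrs' => h.derivation_unique _ w _ _ hrs' hrs⟩

end Describes

end LeftmostDerivations

end HalfPlane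

namespace HalfPlane

/-! ### The words described by the grammar of a model -/

variable {A : Multiset ℤ}

theorem mem_stringLang_nil {T N : Type} {S : N → Set (List T)} {w : List T} :
    w ∈ stringLang S [] ↔ w = [] := by
  simp [stringLang]

theorem mem_stringLang_cons {T N : Type} {S : N → Set (List T)} {s : Symbol T N}
    {α : List (Symbol T N)} {w : List T} : w ∈ stringLang S (s :: α) ↔
      ∃ u ∈ symbolLang S s, ∃ v ∈ stringLang S α, w = u ++ v := by
  constructor
  · rintro ⟨ws, h, rfl⟩
    cases h with
    | cons h1 h2 => exact ⟨_, h1, _, ⟨_, h2, rfl⟩, rfl⟩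
  · rintro ⟨u, hu, _, ⟨vs, hv, rfl⟩, rfl⟩
    exact ⟨u :: vs, .cons hu hv, rfl⟩

/-- The nonempty walks of total height `i` whose proper nonempty prefixes are above `0`
and `i`. -/
def bridges (A : Multiset ℤ) (i : ℤ) : Set (List (Step A)) :=
  {w | w ≠ [] ∧ height w = i ∧ ∀ p, p <+: w → p ≠ [] → p ≠ w → 0 < height p ∧ i < height p}

/-- The nonnegative walks that end at `0`. -/
def excursions (A : Multiset ℤ) : Set (List (Step A)) :=
  {w | height w = 0 ∧ ∀ p, p <+: w → 0 ≤ height p}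

/-- The walks that are positive after the start. -/
def positiveWalks (A : Multiset ℤ) : Set (List (Step A)) :=
  {w | ∀ p, p <+: w → p ≠ [] → 0 < height p}

/-- The nonnegative walks. -/
def nonnegWalks (A : Multiset ℤ) : Set (List (Step A)) := {w | ∀ p, p <+: w → 0 ≤ height p}

variable {u v w x y z : List (Step A)} {a b i k : ℤ}

theorem mem_bridges_singleton {c : Step A} (h : c.weight = i) : [c] ∈ bridges A i := by
  refine ⟨by simp, by simpa using h, fun p hp hp0 hp1 => ?_⟩
  rcases Strip.prefix_singleton hp with rfl | rfl
  · exact absurd rfl hp0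
  · exact absurd rfl hp1

theorem isFirst_of_mem_bridges (h : u ∈ bridges A k) : IsFirst (fun p => height p ≤ k) u :=
  ⟨h.1, h.2.1.le, fun p hp hp0 hp1 => not_le.mpr (h.2.2 p hp hp0 hp1).2⟩

theorem isFirst_of_mem_bridges_zero (h : u ∈ bridges A 0) : IsFirst (fun p => height p = 0) u :=
  ⟨h.1, h.2.1, fun p hp hp0 hp1 => (h.2.2 p hp hp0 hp1).1.ne'⟩

theorem nil_mem_excursions : [] ∈ excursions A :=
  ⟨rfl, fun p hp => by simp [List.prefix_nil.mp hp]⟩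

/-! #### Nonnegative walks -/

theorem excursion_append_positive (hu : u ∈ excursions A) (hv : v ∈ positiveWalks A) :
    u ++ v ∈ nonnegWalks A := by
  intro p hp
  rcases prefix_append_iff.mp hp with hp | ⟨q, hq0, hq, rfl⟩
  · exact hu.2 p hp
  · have := hv q hq hq0
    have := hu.1
    simp; omega

/-- The cut is the last visit to height `0`, which makes it unique. -/
theorem isLast_of_positive (hu : u ∈ excursions A) (hv : v ∈ positiveWalks A) :
    IsLast (fun p => height p = 0) u v :=
  ⟨hu.1, fun q hq hq0 h => by
    have h1 := hv q hq hq0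
    have h2 := hu.1
    simp at h; omega⟩

theorem exists_excursion_append_positive (hw : w ∈ nonnegWalks A) :
    ∃ u ∈ excursions A, ∃ v ∈ positiveWalks A, w = u ++ v := by
  obtain ⟨u, v, rfl, h⟩ := exists_isLast (Q := fun p => height p = 0) (w := w) List.nil_prefix
    height_nil
  refine ⟨u, ⟨h.holds, fun p hp => hw p (hp.trans (List.prefix_append _ _))⟩, v,
    fun q hq hq0 => ?_, rfl⟩
  have h1 := hw (u ++ q) ((List.prefix_append_right_inj u).mpr hq)
  have h2 := h.not_after q hq hq0
  have h3 := h.holds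
  simp at h1 h2; omega

/-! #### Positive walks -/

theorem le_height_of_prefix (hu : u ∈ bridges A k) (hz : z ∈ nonnegWalks A) {p : List (Step A)}
    (hp : p <+: u ++ z) (hp0 : p ≠ []) : k ≤ height p := by
  rcases prefix_append_iff.mp hp with hp | ⟨q, hq0, hq, rfl⟩
  · by_cases h : p = u
    · rw [h, hu.2.1]
    · exact (hu.2.2 p hp hp0 h).2.le
  · have h1 := hz q hq
    have h2 := hu.2.1
    simp; omega

theorem bridge_append_nonneg (hk : 0 < k) (hu : u ∈ bridges A k) (hz : z ∈ nonnegWalks A) :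
    u ++ z ∈ positiveWalks A :=
  fun _ hp hp0 => hk.trans_le (le_height_of_prefix hu hz hp hp0)

/-- The number `k` is the minimum height of the nonempty prefixes, and `u` is the first prefix that
attains it. -/
theorem bridge_append_nonneg_unique {k' : ℤ} {u' z' : List (Step A)} (hu : u ∈ bridges A k)
    (hz : z ∈ nonnegWalks A) (hu' : u' ∈ bridges A k') (hz' : z' ∈ nonnegWalks A)
    (he : u ++ z = u' ++ z') : k = k' ∧ u = u' ∧ z = z' := by
  have h1 := le_height_of_prefix hu hz (he ▸ List.prefix_append u' z') hu'.1
  have h2 := le_height_of_prefix hu' hz' (he ▸ List.prefix_append u z) hu.1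
  rw [hu'.2.1] at h1
  rw [hu.2.1] at h2
  obtain rfl := le_antisymm h1 h2
  exact ⟨rfl, (isFirst_of_mem_bridges hu).eq (isFirst_of_mem_bridges hu') he⟩

theorem exists_bridge_append_nonneg (hw : w ∈ positiveWalks A) (hw0 : w ≠ []) :
    ∃ k : ℕ, 1 ≤ k ∧ ∃ u ∈ bridges A k, ∃ z ∈ nonnegWalks A, w = u ++ z := by
  obtain ⟨p, ⟨hp, hp0⟩, hmin⟩ := exists_least (P := fun p => p <+: w ∧ p ≠ []) (f := height)
    ⟨List.prefix_rfl, hw0⟩ fun p hp => (hw p hp.1 hp.2).le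
  have hpos := hw p hp hp0
  obtain ⟨u, z, rfl, hu⟩ := exists_isFirst (Q := fun q => height q ≤ height p) hp0 hp le_rfl
  have hup : height u = height p :=
    le_antisymm hu.holds (hmin u ⟨List.prefix_append _ _, hu.ne_nil⟩)
  refine ⟨(height p).toNat, by omega, u, ⟨hu.ne_nil, by omega, fun q hq hq0 hq1 => ?_⟩, z,
    fun q hq => ?_, rfl⟩
  · have := hu.not_before q hq hq0 hq1
    omega
  · have := hmin (u ++ q) ⟨(List.prefix_append_right_inj u).mpr hq, by simp [hu.ne_nil]⟩
    simp at this; omega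

/-! #### Excursions -/

theorem bridge_append_excursion (hu : u ∈ bridges A 0) (hv : v ∈ excursions A) :
    u ++ v ∈ excursions A := by
  refine ⟨by simp [hu.2.1, hv.1], fun p hp => ?_⟩
  by_cases hp0 : p = []
  · simp [hp0]
  · exact le_height_of_prefix hu hv.2 hp hp0

/-- The cut is at the first return to `0`, before which all heights are positive. -/
theorem exists_bridge_append_excursion (hw : w ∈ excursions A) (hw0 : w ≠ []) :
    ∃ u ∈ bridges A 0, ∃ v ∈ excursions A, w = u ++ v := by
  obtain ⟨u, v, rfl, hu⟩ := exists_isFirst (Q := fun p => height p = 0) hw0 List.prefix_rfl hw.1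
  have hu0 := hu.holds
  refine ⟨u, ⟨hu.ne_nil, hu0, fun p hp hp0 hp1 => ?_⟩, v, ⟨?_, fun p hp => ?_⟩, rfl⟩
  · have h1 := hw.2 p (hp.trans (List.prefix_append _ _))
    have h2 := hu.not_before p hp hp0 hp1
    omega
  · have := hw.1
    simp at this; omega
  · have := hw.2 (u ++ p) ((List.prefix_append_right_inj u).mpr hp)
    simp at this; omega

/-! #### Bridges -/

theorem le_height_of_proper_prefix (hu : u ∈ bridges A a) (hx : x ∈ excursions A)
    (hy : y ∈ bridges A b) {p : List (Step A)} (hp : p <+: u ++ (x ++ y)) (hp0 : p ≠ [])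
    (hp1 : p ≠ u ++ (x ++ y)) : a ≤ height p := by
  have h2 := hu.2.1
  rcases prefix_append_iff.mp hp with hp | ⟨q, hq0, hq, rfl⟩
  · by_cases h : p = u
    · rw [h, h2]
    · exact (hu.2.2 p hp hp0 h).2.le
  · rcases prefix_append_iff.mp hq with hq | ⟨q', hq0', hq', rfl⟩
    · have h1 := hx.2 q hq
      simp; omega
    · have h1 := hy.2.2 q' hq' hq0' (fun h => hp1 (by rw [h]))
      have h3 := hx.1
      simp; omega

theorem bridge_append_bridge (ha : 0 < a) (hb : b < 0) (hu : u ∈ bridges A a)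
    (hx : x ∈ excursions A) (hy : y ∈ bridges A b) : u ++ (x ++ y) ∈ bridges A (a + b) := by
  refine ⟨by simp [hu.1], by simp [hu.2.1, hx.1, hy.2.1], fun p hp hp0 hp1 => ?_⟩
  have := le_height_of_proper_prefix hu hx hy hp hp0 hp1
  omega

theorem isLast_of_bridge (hb : b < 0) (hx : x ∈ excursions A) (hy : y ∈ bridges A b) :
    IsLast (fun p => height p = 0) x y := by
  refine ⟨hx.1, fun q hq hq0 h => ?_⟩
  have h1 := hx.1
  simp only [height_append, h1, zero_add] at h
  by_cases h2 : q = y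
  · rw [h2, hy.2.1] at h; omega
  · have := (hy.2.2 q hq hq0 h2).1; omega

/-- The number `a` is the minimum height of the proper nonempty prefixes, `u` is the first prefix
that attains it, and `u ++ x` the last. -/
theorem bridge_append_bridge_unique {a' b' : ℤ} {u' x' y' : List (Step A)} (hb : b < 0)
    (hb' : b' < 0) (hu : u ∈ bridges A a) (hx : x ∈ excursions A) (hy : y ∈ bridges A b)
    (hu' : u' ∈ bridges A a') (hx' : x' ∈ excursions A) (hy' : y' ∈ bridges A b')
    (he : u ++ (x ++ y) = u' ++ (x' ++ y')) : a = a' ∧ u = u' ∧ x = x' ∧ y = y' := by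
  have h1 := le_height_of_proper_prefix hu hx hy (he ▸ List.prefix_append u' _) hu'.1
    (by rw [he]; simp [hy'.1])
  have h2 := le_height_of_proper_prefix hu' hx' hy' (he ▸ List.prefix_append u _) hu.1
    (by rw [← he]; simp [hy.1])
  rw [hu'.2.1] at h1
  rw [hu.2.1] at h2
  obtain rfl := le_antisymm h1 h2
  obtain ⟨h3, h4⟩ := (isFirst_of_mem_bridges hu).eq (isFirst_of_mem_bridges hu') he
  exact ⟨rfl, h3, (isLast_of_bridge hb hx hy).eq (isLast_of_bridge hb' hx' hy') h4⟩

theorem weight_le_maxUp (c : Step A) : c.weight ≤ maxUp A := by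
  have : c.weight.toNat ≤ maxUp A := by
    refine Multiset.le_sup (Multiset.mem_map_of_mem _ ?_)
    exact Multiset.coe_mem
  omega

theorem neg_weight_le_maxDown (c : Step A) : -c.weight ≤ maxDown A := by
  have : (-c.weight).toNat ≤ maxDown A := by
    refine Multiset.le_sup (Multiset.mem_map_of_mem (fun a : ℤ => (-a).toNat) ?_)
    exact Multiset.coe_mem
  omega

/-- The first step already reaches a height of at least `k`. -/
theorem le_maxUp_of_mem_bridges (hu : u ∈ bridges A k) : k ≤ maxUp A := by
  obtain ⟨h0, h1, h2⟩ := hu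
  obtain ⟨c, u, rfl⟩ := List.exists_cons_of_ne_nil h0
  refine le_trans ?_ (weight_le_maxUp c)
  by_cases h : u = []
  · subst h; simp at h1; omega
  · have := (h2 [c] ⟨u, rfl⟩ (by simp) (by simpa using Ne.symm h)).2
    simp at this; omega

/-- The last step starts from a height of at least `0` and ends at `k`. -/
theorem neg_le_maxDown_of_mem_bridges (hu : u ∈ bridges A k) : -k ≤ maxDown A := by
  obtain ⟨h0, h1, h2⟩ := hu
  obtain ⟨u, c, rfl⟩ := (List.eq_nil_or_concat' u).resolve_left h0
  refine le_trans ?_ (neg_weight_le_maxDown c)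
  simp at h1
  by_cases h : u = []
  · subst h; simp at h1; omega
  · have := (h2 u (List.prefix_append _ _) h (by simp)).1
    omega

/-- Let `k` be the minimum height of the proper nonempty prefixes; it is above both ends `0` and
`i`. The first visit to `k` ends `u`, the last one ends `x`, and what remains goes down to `i` while
staying above `k` before its end. -/
theorem exists_bridge_append_bridge (hw : w ∈ bridges A i) (hl : 2 ≤ w.length) :
    ∃ k m : ℕ, 1 ≤ k ∧ 1 ≤ m ∧ k ≤ maxUp A ∧ m ≤ maxDown A ∧ (k : ℤ) - m = i ∧
      ∃ u ∈ bridges A k, ∃ x ∈ excursions A, ∃ y ∈ bridges A (-m), w = u ++ (x ++ y) := by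
  obtain ⟨hw0, hw1, hw2⟩ := hw
  obtain ⟨p, ⟨hp, hp0, hp1⟩, hmin⟩ := exists_least (P := fun p => p <+: w ∧ p ≠ [] ∧ p ≠ w)
    (f := height) (b := 0) (p := w.take 1)
    ⟨List.take_prefix _ _, by simp [hw0], fun h => by
      have := congrArg List.length h; simp at this; omega⟩
    fun p hp => (hw2 p hp.1 hp.2.1 hp.2.2).1.le
  obtain ⟨hk0, hki⟩ := hw2 p hp hp0 hp1
  obtain ⟨u, v, rfl, hu⟩ := exists_isFirst (Q := fun q => height q ≤ height p) hp0
    List.prefix_rfl le_rfl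
  obtain ⟨v', rfl⟩ := hp
  have hv' : v' ≠ [] := by rintro rfl; simp at hp1
  clear hw0 hp0 hp1
  rw [List.append_assoc] at hw1 hw2 hmin hl ⊢
  generalize height (u ++ v) = k at *
  obtain ⟨z, hz⟩ : ∃ z, v ++ v' = z := ⟨_, rfl⟩
  have hz0 : z ≠ [] := by rw [← hz]; simp [hv']
  rw [hz] at hw1 hw2 hmin hl ⊢
  clear hz
  -- After `u`, the walk does not go below the minimum `k` before its end.
  have hprop : ∀ q, q <+: z → q ≠ z → k ≤ height u + height q := fun q hq hqz => by
    simpa using hmin (u ++ q) ⟨(List.prefix_append_right_inj u).mpr hq, by simp [hu.ne_nil],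
      by simpa using hqz⟩
  have huk : height u = k :=
    le_antisymm hu.holds (by simpa using hprop [] List.nil_prefix (Ne.symm hz0))
  simp only [height_append] at hw1
  obtain ⟨x, y, rfl, hx⟩ := exists_isLast (Q := fun p => height p = 0) (w := z) List.nil_prefix
    height_nil
  have hxh := hx.holds
  have hy0 : y ≠ [] := by
    rintro rfl
    rw [List.append_nil] at hw1
    omega
  simp only [height_append] at hw1
  have hub : u ∈ bridges A k := by
    refine ⟨hu.ne_nil, huk, fun q hq hq0 hq1 => ?_⟩
    have := hu.not_before q hq hq0 hq1
    omega
  have hyb : y ∈ bridges A (i - k) := by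
    refine ⟨hy0, by omega, fun q hq hq0 hq1 => ?_⟩
    have h1 := hprop (x ++ q) ((List.prefix_append_right_inj x).mpr hq) (by simpa using hq1)
    have h2 := hx.not_after q hq hq0
    simp at h1 h2
    omega
  have hup := le_maxUp_of_mem_bridges hub
  have hdown := neg_le_maxDown_of_mem_bridges hyb
  refine ⟨k.toNat, (k - i).toNat, by omega, by omega, by omega, by omega, by omega, u, ?_, x,
    ⟨hxh, fun q hq => ?_⟩, y, ?_, rfl⟩
  · rwa [Int.toNat_of_nonneg (by omega)]
  · have := hprop q (hq.trans (List.prefix_append _ _)) (by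
      intro h
      have h1 := hq.length_le
      have h2 := List.length_pos_iff.mpr hy0
      rw [h, List.length_append] at h1
      omega)
    omega
  · rwa [Int.toNat_of_nonneg (by omega), neg_sub]

end HalfPlane

namespace HalfPlane

/-! ### The grammar of the model describes the walks -/

section GrammarRules

open Symbol

/-- The rules of the grammar. -/
inductive IsGrammarRule (A : Multiset ℤ) : ContextFreeRule (Step A) NT → Prop
  | walk : IsGrammarRule A ⟨.P, [nonterminal .D, nonterminal .Paux]⟩
  | auxNil : IsGrammarRule A ⟨.Paux, []⟩
  | aux (k : ℕ) (h₁ : 1 ≤ k) (h₂ : k ≤ maxUp A) :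
      IsGrammarRule A ⟨.Paux, [nonterminal (.L k), nonterminal .D, nonterminal .Paux]⟩
  | nil : IsGrammarRule A ⟨.D, []⟩
  | flat (c : Step A) (hc : c.weight = 0) :
      IsGrammarRule A ⟨.D, [terminal c, nonterminal .D]⟩
  | arch (k : ℕ) (h₁ : 1 ≤ k) (h₂ : k ≤ maxUp A ∨ k ≤ maxDown A) :
      IsGrammarRule A
        ⟨.D, [nonterminal (.L k), nonterminal .D, nonterminal (.R k), nonterminal .D]⟩
  | upStep (i : ℕ) (s : Step A) (hi : 1 ≤ i) (hs : s.weight = i) :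
      IsGrammarRule A ⟨.L i, [terminal s]⟩
  | up (i k : ℕ) (h₁ : 1 ≤ i) (h₂ : i < k) (h₃ : k ≤ maxUp A) (h₄ : k ≤ i + maxDown A) :
      IsGrammarRule A ⟨.L i, [nonterminal (.L k), nonterminal .D, nonterminal (.R (k - i))]⟩
  | downStep (j : ℕ) (s : Step A) (hj : 1 ≤ j) (hs : s.weight = -j) :
      IsGrammarRule A ⟨.R j, [terminal s]⟩
  | down (j k : ℕ) (h₁ : 1 ≤ j) (h₂ : j < k) (h₃ : k ≤ j + maxUp A) (h₄ : k ≤ maxDown A) :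
      IsGrammarRule A ⟨.R j, [nonterminal (.L (k - j)), nonterminal .D, nonterminal (.R k)]⟩

theorem mem_grammarRules {A : Multiset ℤ} {ρ : ContextFreeRule (Step A) NT} :
    ρ ∈ grammarRules A ↔ IsGrammarRule A ρ := by
  simp only [grammarRules, Finset.mem_union, Finset.mem_insert, Finset.mem_singleton,
    Finset.mem_image, Finset.mem_Icc, Finset.mem_filter, Finset.mem_univ, true_and,
    Finset.mem_biUnion, le_max_iff, le_min_iff]
  constructor
  · rintro (((((((((rfl | rfl | rfl) | ⟨k, h, rfl⟩) | ⟨c, h, rfl⟩) | ⟨k, h, rfl⟩) | ⟨s, h, rfl⟩) |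
      ⟨i, hi, k, h, rfl⟩) | ⟨s, h, rfl⟩) | ⟨j, hj, k, h, rfl⟩))
    · exact .walk
    · exact .auxNil
    · exact .nil
    · exact .aux k h.1 h.2
    · exact .flat c h
    · exact .arch k h.1 h.2
    · exact .upStep _ s (by omega) (by omega)
    · exact .up i k hi.1 h.1 h.2.1 h.2.2
    · exact .downStep _ s (by omega) (by omega)
    · exact .down j k hj.1 h.1 h.2.1 h.2.2
  · intro h
    cases h with
    | walk => simp
    | auxNil => simp
    | aux k h₁ h₂ => simp [h₁, h₂]
    | nil => simp
    | flat c hc => simp [hc]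
    | arch k h₁ h₂ => simp [h₁, h₂]
    | upStep i s hi hs =>
      iterate 3 left
      right
      exact ⟨s, by omega, by rw [hs]; simp⟩
    | up i k h₁ h₂ h₃ h₄ =>
      iterate 2 left
      right
      exact ⟨i, by omega, k, by omega, rfl⟩
    | downStep j s hj hs =>
      left
      right
      exact ⟨s, by omega, by rw [hs]; simp⟩
    | down j k h₁ h₂ h₃ h₄ =>
      right
      exact ⟨j, by omega, k, by omega, rfl⟩

/-- The words described by the nonterminals of the grammar. -/
def grammarLang (A : Multiset ℤ) : NT → Set (List (Step A))
  | .P => nonnegWalks A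
  | .Paux => positiveWalks A
  | .D => excursions A
  | .L k => {w | 1 ≤ k ∧ w ∈ bridges A k}
  | .R k => {w | 1 ≤ k ∧ w ∈ bridges A (-k)}

/-- A measure that decreases in the derivations. -/
def grammarMeasure {A : Multiset ℤ} : NT → List (Step A) → ℕ
  | .P, w => 3 * w.length + 2
  | .Paux, w => 3 * w.length + 1
  | _, w => 3 * w.length

variable {A : Multiset ℤ}

theorem grammar_sound (ρ : ContextFreeRule (Step A) NT) (hρ : IsGrammarRule A ρ)
    (w : List (Step A)) (hw : w ∈ stringLang (grammarLang A) ρ.output) :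
    w ∈ grammarLang A ρ.input := by
  cases hρ with
  | walk =>
    simp only [mem_stringLang_cons, mem_stringLang_nil] at hw
    obtain ⟨u, hu, _, ⟨v, hv, _, rfl, rfl⟩, rfl⟩ := hw
    rw [List.append_nil]
    exact excursion_append_positive hu hv
  | auxNil =>
    rw [mem_stringLang_nil] at hw
    subst hw
    exact fun p hp hp0 => absurd (List.prefix_nil.mp hp) hp0
  | aux k h₁ h₂ =>
    simp only [mem_stringLang_cons, mem_stringLang_nil] at hw
    obtain ⟨u, hu, _, ⟨x, hx, _, ⟨v, hv, _, rfl, rfl⟩, rfl⟩, rfl⟩ := hw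
    rw [List.append_nil]
    exact bridge_append_nonneg (by omega) hu.2 (excursion_append_positive hx hv)
  | nil =>
    rw [mem_stringLang_nil] at hw
    subst hw
    exact nil_mem_excursions
  | flat c hc =>
    simp only [mem_stringLang_cons, mem_stringLang_nil] at hw
    obtain ⟨u, rfl, _, ⟨v, hv, _, rfl, rfl⟩, rfl⟩ := hw
    rw [List.append_nil]
    exact bridge_append_excursion (mem_bridges_singleton hc) hv
  | arch k h₁ h₂ =>
    simp only [mem_stringLang_cons, mem_stringLang_nil] at hw
    obtain ⟨u, hu, _, ⟨x, hx, _, ⟨y, hy, _, ⟨v, hv, _, rfl, rfl⟩, rfl⟩, rfl⟩, rfl⟩ := hw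
    have := bridge_append_bridge (by omega) (by omega) hu.2 hx hy.2
    rw [add_neg_cancel] at this
    have h := bridge_append_excursion this hv
    simp only [List.append_assoc, List.append_nil] at h ⊢
    exact h
  | upStep i s hi hs =>
    simp only [mem_stringLang_cons, mem_stringLang_nil] at hw
    obtain ⟨u, rfl, _, rfl, rfl⟩ := hw
    exact ⟨hi, mem_bridges_singleton hs⟩
  | up i k h₁ h₂ h₃ h₄ =>
    simp only [mem_stringLang_cons, mem_stringLang_nil] at hw
    obtain ⟨u, hu, _, ⟨x, hx, _, ⟨y, hy, _, rfl, rfl⟩, rfl⟩, rfl⟩ := hw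
    have := bridge_append_bridge (by omega) (by omega) hu.2 hx hy.2
    rw [List.append_nil]
    exact ⟨h₁, by rwa [show (i : ℤ) = k + -((k - i : ℕ) : ℤ) by omega]⟩
  | downStep j s hj hs =>
    simp only [mem_stringLang_cons, mem_stringLang_nil] at hw
    obtain ⟨u, rfl, _, rfl, rfl⟩ := hw
    exact ⟨hj, mem_bridges_singleton hs⟩
  | down j k h₁ h₂ h₃ h₄ =>
    simp only [mem_stringLang_cons, mem_stringLang_nil] at hw
    obtain ⟨u, hu, _, ⟨x, hx, _, ⟨y, hy, _, rfl, rfl⟩, rfl⟩, rfl⟩ := hw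
    have := bridge_append_bridge (by omega) (by omega) hu.2 hx hy.2
    rw [List.append_nil]
    exact ⟨h₁, by rwa [show -(j : ℤ) = ((k - j : ℕ) : ℤ) + -k by omega]⟩

theorem length_eq_one_or_two_le {w : List (Step A)} (hw : w ≠ []) :
    (∃ s, w = [s]) ∨ 2 ≤ w.length := by
  match w, hw with
  | [s], _ => exact Or.inl ⟨s, rfl⟩
  | _ :: _ :: _, _ => right; simp

/-- Bridges are nonempty, so most factors are strictly shorter than the word. In `P → D P_aux`, and
for the bridge in `P_aux → L_k D P_aux`, a factor may be the whole word; the constants added in the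
measure take care of this. -/
theorem grammar_complete (X : NT) (w : List (Step A)) (hw : w ∈ grammarLang A X) :
    ∃ ρ, IsGrammarRule A ρ ∧ ρ.input = X ∧ ∃ ws, w = ws.flatten ∧
      List.Forall₂ (fun s w' => w' ∈ symbolLang (grammarLang A) s ∧
        ∀ Y, s = nonterminal Y → grammarMeasure Y w' < grammarMeasure X w) ρ.output ws := by
  have pos : ∀ {i : ℤ} {u : List (Step A)}, u ∈ bridges A i → 0 < u.length :=
    fun h => List.length_pos_iff.mpr h.1
  cases X with
  | P =>
    obtain ⟨u, hu, v, hv, rfl⟩ := exists_excursion_append_positive hw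
    refine ⟨_, .walk, rfl, [u, v], by simp, .cons ⟨hu, ?_⟩ (.cons ⟨hv, ?_⟩ .nil)⟩ <;>
      (rintro _ ⟨⟩; simp only [grammarMeasure, List.length_append]; omega)
  | Paux =>
    by_cases hw0 : w = []
    · exact ⟨_, .auxNil, rfl, [], by simp [hw0], .nil⟩
    obtain ⟨k, hk, u, hu, z, hz, rfl⟩ := exists_bridge_append_nonneg hw hw0
    obtain ⟨x, hx, v, hv, rfl⟩ := exists_excursion_append_positive hz
    have h1 := le_maxUp_of_mem_bridges hu
    have h2 := pos hu
    refine ⟨_, .aux k hk (by omega), rfl, [u, x, v], by simp,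
      .cons ⟨⟨hk, hu⟩, ?_⟩ (.cons ⟨hx, ?_⟩ (.cons ⟨hv, ?_⟩ .nil))⟩ <;>
      rintro _ ⟨⟩ <;> simp [grammarMeasure] <;> omega
  | D =>
    by_cases hw0 : w = []
    · exact ⟨_, .nil, rfl, [], by simp [hw0], .nil⟩
    obtain ⟨e, he, v, hv, rfl⟩ := exists_bridge_append_excursion hw hw0
    rcases length_eq_one_or_two_le he.1 with ⟨c, rfl⟩ | hl
    · refine ⟨_, .flat c (by simpa using he.2.1), rfl, [[c], v], by simp,
        .cons ⟨rfl, ?_⟩ (.cons ⟨hv, ?_⟩ .nil)⟩ <;>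
        rintro _ ⟨⟩
      simp [grammarMeasure]
    · obtain ⟨k, m, hk, hm, hku, hmd, hkm, u, hu, x, hx, y, hy, rfl⟩ :=
        exists_bridge_append_bridge he hl
      obtain rfl : k = m := by omega
      have h1 := pos hu
      have h2 := pos hy
      refine ⟨_, .arch k hk (Or.inl hku), rfl, [u, x, y, v], by simp,
        .cons ⟨⟨hk, hu⟩, ?_⟩ (.cons ⟨hx, ?_⟩ (.cons ⟨⟨hk, hy⟩, ?_⟩ (.cons ⟨hv, ?_⟩ .nil)))⟩ <;>
        rintro _ ⟨⟩ <;> simp [grammarMeasure] <;> omega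
  | L i =>
    obtain ⟨hi, hw⟩ := hw
    rcases length_eq_one_or_two_le hw.1 with ⟨s, rfl⟩ | hl
    · refine ⟨_, .upStep i s hi (by simpa using hw.2.1), rfl, [[s]], by simp,
        .cons ⟨rfl, ?_⟩ .nil⟩
      rintro _ ⟨⟩
    · obtain ⟨k, m, hk, hm, hku, hmd, hkm, u, hu, x, hx, y, hy, rfl⟩ :=
        exists_bridge_append_bridge hw hl
      obtain rfl : m = k - i := by omega
      have h1 := pos hu
      have h2 := pos hy
      refine ⟨_, .up i k hi (by omega) hku (by omega), rfl, [u, x, y], by simp,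
        .cons ⟨⟨hk, hu⟩, ?_⟩ (.cons ⟨hx, ?_⟩ (.cons ⟨⟨hm, hy⟩, ?_⟩ .nil))⟩ <;>
        rintro _ ⟨⟩ <;> simp [grammarMeasure] <;> omega
  | R j =>
    obtain ⟨hj, hw⟩ := hw
    rcases length_eq_one_or_two_le hw.1 with ⟨s, rfl⟩ | hl
    · refine ⟨_, .downStep j s hj (by simpa using hw.2.1), rfl, [[s]], by simp,
        .cons ⟨rfl, ?_⟩ .nil⟩
      rintro _ ⟨⟩
    · obtain ⟨k, m, hk, hm, hku, hmd, hkm, u, hu, x, hx, y, hy, rfl⟩ :=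
        exists_bridge_append_bridge hw hl
      obtain rfl : k = m - j := by omega
      have h1 := pos hu
      have h2 := pos hy
      refine ⟨_, .down j m hj (by omega) (by omega) hmd, rfl, [u, x, y], by simp,
        .cons ⟨⟨hk, hu⟩, ?_⟩ (.cons ⟨hx, ?_⟩ (.cons ⟨⟨hm, hy⟩, ?_⟩ .nil))⟩ <;>
        rintro _ ⟨⟩ <;> simp [grammarMeasure] <;> omega

theorem forall₂_one {α β : Type*} {R : α → β → Prop} {a : α} {l : List β}
    (h : List.Forall₂ R [a] l) : ∃ u, R a u ∧ l = [u] := by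
  cases h with | cons h1 h2 => cases h2; exact ⟨_, h1, rfl⟩

theorem forall₂_two {α β : Type*} {R : α → β → Prop} {a b : α} {l : List β}
    (h : List.Forall₂ R [a, b] l) : ∃ u v, R a u ∧ R b v ∧ l = [u, v] := by
  cases h with
  | cons h1 h2 => obtain ⟨v, hv, rfl⟩ := forall₂_one h2; exact ⟨_, v, h1, hv, rfl⟩

theorem forall₂_three {α β : Type*} {R : α → β → Prop} {a b c : α} {l : List β}
    (h : List.Forall₂ R [a, b, c] l) : ∃ u v x, R a u ∧ R b v ∧ R c x ∧ l = [u, v, x] := by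
  cases h with
  | cons h1 h2 => obtain ⟨v, x, hv, hx, rfl⟩ := forall₂_two h2; exact ⟨_, v, x, h1, hv, hx, rfl⟩

theorem forall₂_four {α β : Type*} {R : α → β → Prop} {a b c d : α} {l : List β}
    (h : List.Forall₂ R [a, b, c, d] l) :
    ∃ u v x y, R a u ∧ R b v ∧ R c x ∧ R d y ∧ l = [u, v, x, y] := by
  cases h with
  | cons h1 h2 =>
    obtain ⟨v, x, y, hv, hx, hy, rfl⟩ := forall₂_three h2
    exact ⟨_, v, x, y, h1, hv, hx, hy, rfl⟩

theorem length_append_bridges {i k : ℤ} {u x y : List (Step A)} (hu : u ∈ bridges A i)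
    (hy : y ∈ bridges A k) (s : Step A) : u ++ (x ++ y) ≠ [s] := by
  intro h
  have h1 := List.length_pos_iff.mpr hu.1
  have h2 := List.length_pos_iff.mpr hy.1
  have h3 := congrArg List.length h
  simp at h3
  omega

/-- Rules with the same left-hand side are separated by the empty word and by the length of the
leading bridge, one step or more. Within one kind of rule, the cuts at first and last visits
determine the factors, and the heights of the factors determine `k`. -/
theorem grammar_unique (ρ : ContextFreeRule (Step A) NT) (hρ : IsGrammarRule A ρ)
    (ρ' : ContextFreeRule (Step A) NT) (hρ' : IsGrammarRule A ρ') (hin : ρ.input = ρ'.input)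
    (ws ws' : List (List (Step A)))
    (h : List.Forall₂ (fun s w => w ∈ symbolLang (grammarLang A) s) ρ.output ws)
    (h' : List.Forall₂ (fun s w => w ∈ symbolLang (grammarLang A) s) ρ'.output ws')
    (he : ws.flatten = ws'.flatten) : ρ = ρ' ∧ ws = ws' := by
  cases hρ with
  | walk =>
    cases hρ' with
    | walk =>
      obtain ⟨u, v, hu, hv, rfl⟩ := forall₂_two h
      obtain ⟨u', v', hu', hv', rfl⟩ := forall₂_two h'
      obtain ⟨rfl, rfl⟩ := (isLast_of_positive hu hv).eq (isLast_of_positive hu' hv')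
        (by simpa using he)
      exact ⟨rfl, rfl⟩
    | _ => cases hin
  | auxNil =>
    cases h
    cases hρ' with
    | auxNil => cases h'; exact ⟨rfl, rfl⟩
    | aux =>
      obtain ⟨u, x, v, hu, -, -, rfl⟩ := forall₂_three h'
      simp [hu.2.1] at he
    | _ => cases hin
  | aux k h₁ h₂ =>
    obtain ⟨u, x, v, hu, hx, hv, rfl⟩ := forall₂_three h
    cases hρ' with
    | auxNil => cases h'; simp [hu.2.1] at he
    | aux k' =>
      obtain ⟨u', x', v', hu', hx', hv', rfl⟩ := forall₂_three h'
      obtain ⟨hk, rfl, hz⟩ := bridge_append_nonneg_unique hu.2 (excursion_append_positive hx hv)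
        hu'.2 (excursion_append_positive hx' hv') (by simpa using he)
      obtain ⟨rfl, rfl⟩ := (isLast_of_positive hx hv).eq (isLast_of_positive hx' hv') hz
      obtain rfl : k = k' := by omega
      exact ⟨rfl, rfl⟩
    | _ => cases hin
  | nil =>
    cases h
    cases hρ' with
    | nil => cases h'; exact ⟨rfl, rfl⟩
    | flat =>
      obtain ⟨u, v, hu, -, rfl⟩ := forall₂_two h'
      obtain rfl : u = _ := hu
      simp at he
    | arch =>
      obtain ⟨u, x, y, v, hu, -, -, -, rfl⟩ := forall₂_four h'
      simp [hu.2.1] at he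
    | _ => cases hin
  | flat c hc =>
    obtain ⟨u, v, hu, hv, rfl⟩ := forall₂_two h
    obtain rfl : u = _ := hu
    cases hρ' with
    | nil => cases h'; simp at he
    | flat c' =>
      obtain ⟨u', v', hu', hv', rfl⟩ := forall₂_two h'
      obtain rfl : u' = _ := hu'
      obtain ⟨rfl, rfl⟩ : c = c' ∧ v = v' := by simpa using he
      exact ⟨rfl, rfl⟩
    | arch k' =>
      obtain ⟨u', x', y', v', hu', hx', hy', hv', rfl⟩ := forall₂_four h'
      have h1 := bridge_append_bridge (by omega) (by omega) hu'.2 hx' hy'.2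
      rw [add_neg_cancel] at h1
      obtain ⟨h2, -⟩ := (isFirst_of_mem_bridges_zero (mem_bridges_singleton hc)).eq
        (isFirst_of_mem_bridges_zero h1) (v := v) (v' := v') (by simpa using he)
      exact absurd h2.symm (length_append_bridges hu'.2 hy'.2 c)
    | _ => cases hin
  | arch k h₁ h₂ =>
    obtain ⟨u, x, y, v, hu, hx, hy, hv, rfl⟩ := forall₂_four h
    have h1 := bridge_append_bridge (by omega) (by omega) hu.2 hx hy.2
    rw [add_neg_cancel] at h1
    cases hρ' with
    | nil => cases h'; simp [hu.2.1] at he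
    | flat c hc =>
      obtain ⟨u', v', hu', hv', rfl⟩ := forall₂_two h'
      obtain rfl : u' = _ := hu'
      obtain ⟨h2, -⟩ := (isFirst_of_mem_bridges_zero h1).eq
        (isFirst_of_mem_bridges_zero (mem_bridges_singleton hc)) (v := v) (v' := v')
        (by simpa using he)
      exact absurd h2 (length_append_bridges hu.2 hy.2 c)
    | arch k' =>
      obtain ⟨u', x', y', v', hu', hx', hy', hv', rfl⟩ := forall₂_four h'
      have h1' := bridge_append_bridge (by omega) (by omega) hu'.2 hx' hy'.2
      rw [add_neg_cancel] at h1'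
      obtain ⟨h2, rfl⟩ := (isFirst_of_mem_bridges_zero h1).eq
        (isFirst_of_mem_bridges_zero h1') (v := v) (v' := v') (by simpa using he)
      obtain ⟨hk, rfl, rfl, rfl⟩ := bridge_append_bridge_unique (by omega) (by omega)
        hu.2 hx hy.2 hu'.2 hx' hy'.2 h2
      obtain rfl : k = k' := by omega
      exact ⟨rfl, rfl⟩
    | _ => cases hin
  | upStep i s hi hs =>
    obtain ⟨u, hu, rfl⟩ := forall₂_one h
    obtain rfl : u = _ := hu
    cases hρ' with
    | upStep i' s' =>
      obtain ⟨u', hu', rfl⟩ := forall₂_one h'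
      obtain rfl : u' = _ := hu'
      obtain rfl : i = i' := by simpa using hin
      obtain rfl : s = s' := by simpa using he
      exact ⟨rfl, rfl⟩
    | up =>
      obtain ⟨u', x', y', hu', hx', hy', rfl⟩ := forall₂_three h'
      exact absurd (by simpa using he.symm) (length_append_bridges hu'.2 hy'.2 s (x := x'))
    | _ => cases hin
  | up i k h₁ h₂ h₃ h₄ =>
    obtain ⟨u, x, y, hu, hx, hy, rfl⟩ := forall₂_three h
    cases hρ' with
    | upStep i' s =>
      obtain ⟨u', hu', rfl⟩ := forall₂_one h'
      obtain rfl : u' = _ := hu'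
      exact absurd (by simpa using he) (length_append_bridges hu.2 hy.2 s (x := x))
    | up i' k' =>
      obtain ⟨u', x', y', hu', hx', hy', rfl⟩ := forall₂_three h'
      obtain rfl : i = i' := by simpa using hin
      obtain ⟨hk, rfl, rfl, rfl⟩ := bridge_append_bridge_unique (by omega) (by omega)
        hu.2 hx hy.2 hu'.2 hx' hy'.2 (by simpa using he)
      obtain rfl : k = k' := by omega
      exact ⟨rfl, rfl⟩
    | _ => cases hin
  | downStep j s hj hs =>
    obtain ⟨u, hu, rfl⟩ := forall₂_one h
    obtain rfl : u = _ := hu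
    cases hρ' with
    | downStep j' s' =>
      obtain ⟨u', hu', rfl⟩ := forall₂_one h'
      obtain rfl : u' = _ := hu'
      obtain rfl : j = j' := by simpa using hin
      obtain rfl : s = s' := by simpa using he
      exact ⟨rfl, rfl⟩
    | down =>
      obtain ⟨u', x', y', hu', hx', hy', rfl⟩ := forall₂_three h'
      exact absurd (by simpa using he.symm) (length_append_bridges hu'.2 hy'.2 s (x := x'))
    | _ => cases hin
  | down j k h₁ h₂ h₃ h₄ =>
    obtain ⟨u, x, y, hu, hx, hy, rfl⟩ := forall₂_three h
    cases hρ' with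
    | downStep j' s =>
      obtain ⟨u', hu', rfl⟩ := forall₂_one h'
      obtain rfl : u' = _ := hu'
      exact absurd (by simpa using he) (length_append_bridges hu.2 hy.2 s (x := x))
    | down j' k' =>
      obtain ⟨u', x', y', hu', hx', hy', rfl⟩ := forall₂_three h'
      obtain rfl : j = j' := by simpa using hin
      obtain ⟨hk, rfl, rfl, rfl⟩ := bridge_append_bridge_unique (by omega) (by omega)
        hu.2 hx hy.2 hu'.2 hx' hy'.2 (by simpa using he)
      obtain rfl : k = k' := by omega
      exact ⟨rfl, rfl⟩
    | _ => cases hin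

theorem grammar_describes (A : Multiset ℤ) :
    Describes (grammar A) (grammarLang A) grammarMeasure where
  sound ρ hρ w hw := grammar_sound ρ (mem_grammarRules.mp hρ) w hw
  complete X w hw := by
    obtain ⟨ρ, hρ, h⟩ := grammar_complete X w hw
    exact ⟨ρ, mem_grammarRules.mpr hρ, h⟩
  unique ρ hρ ρ' hρ' := grammar_unique ρ (mem_grammarRules.mp hρ) ρ' (mem_grammarRules.mp hρ')

end GrammarRules

end HalfPlane

theorem mainTheorem4 (A : Multiset ℤ) (hA : HalfPlane.Nontriv A) :
    ((HalfPlane.grammar A).language = {w | HalfPlane.IsNonnegWalk w} ∧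
      HalfPlane.Unambiguous (HalfPlane.grammar A)) ∧
    ∃ (r : ℕ) (p : HalfPlane.Prog (HalfPlane.Step A) (r + 2)) (time bits : ℕ → ℕ → ℕ),
      (∀ n k : ℕ,
        HalfPlane.HaltsWithin p n k (time n k) ∧
        HalfPlane.IsUniformWalks A n k (HalfPlane.outputDist p n k (time n k)) ∧
        HalfPlane.StoresBits p n k (bits n k)) ∧
      ∃ C : ℝ, ∀ n k : ℕ, 2 ≤ n → 1 ≤ k →
        (time n k : ℝ) ≤ C * (k * (n * Real.log n)) ∧
        (bits n k : ℝ) ≤ C * (n + Real.log k) :=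
  ⟨⟨(HalfPlane.grammar_describes A).language_eq, (HalfPlane.grammar_describes A).unambiguous⟩,
    HalfPlane.exists_walk_program hA⟩
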